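/- **Setting.** Let $n,m\ge 0$ and $L,N\ge 1$. Consider $\dot x=f(x)+g(x)u$ with $f:\mathbb R^n\to\mathbb R^n$ continuously differentiable, $f(0)=0$, and $g:\mathbb R^n\to\mathbb R^{n\times m}$ locally Lipschitz; the cost is $\int_{0}^\infty r(x,u)\,d\tau$, $r(x,u)=Q(x)+u^TRu$, with $Q$ continuous and positive definite and $R$ symmetric positive definite. The optimal value function $V^*(x_0)$ is the infimum of this cost over all locally integrable controls that have a trajectory on $[0,\infty)$ from $x_0$; assume that an optimal control with finite cost exists from every $x_0$ and that $V^*$ is continuously differentiable. All norms are Euclidean norms and induced matrix norms. *Kernels.* Let $\zeta,r>0$, let $\chi\subset\mathbb R^n$ be compact and contain $B_r(x)$ for every $x\in B_\chi:=\{\|x\|\le\zeta\}$ ($B_r(x)$: closed ball), let $H$ be a reproducing kernel Hilbert space over $\chi$ whose kernel $k$ is (strictly) positive definite on $\chi$ and continuously differentiable on a neighbourhood of $\chi\times\chi$, and let $\overline V^*\in H$ be continuously differentiable on a neighbourhood of $\chi$. Let $c=(c_1,\dots,c_L)$ be continuously differentiable on a neighbourhood of $\chi$, with distinct centers $c_j(x)\in\chi\cap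 B_r(x)$ for $x\in\chi$. Put $\sigma(y,C)=[k(y,C_1),\dots,k(y,C_L)]^T$ and let $\nabla\sigma$ be the Jacobian in the first argument. The ideal weights are $W(x)=\arg\min_{a\in\mathbb R^L}\|a^T\sigma(\cdot,c(x))-\overline V^*\|_{H_{x,r}}$, where $H_{x,r}$ is the restriction of $H$ to $B_r(x)\cap\chi$ with its quotient norm. Extrapolation functions $x_1,\dots,x_N:\mathbb R^n\times\mathbb R_{\ge0}\to\mathbb R^n$ satisfy $x_i(x,t)\in B_r(x)$ for $x\in B_\chi$, $t\ge0$. *Controller.* For points $y,x$ and weights $\hat W_a,\hat W_c$, write $G(y)=g(y)R^{-1}g(y)^T$, $\nabla\sigma=\nabla\sigma(y,c(x))$, $G_\sigma(y,x)=\nabla\sigma\, G(y)\nabla\sigma^T$, $\hat u=-\frac12R^{-1}g(y)^T\nabla\sigma^T\hat W_a$, $\omega=\nabla\sigma f(y)-\frac12G_\sigma\hat W_a$, $\rho=\sqrt{1+\nu\,\omega^T\omega}$, $\delta=\hat W_c^T\omega+r(y,\hat u)$. Let $\omega,\rho,\delta_t,G_\sigma$ (and $u$) be these quantities at $y=x(t)$,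 and $\omega_i,\rho_i,\delta_{ti},G_{\sigma i}$ those at $y=x_i(x(t),t)$, always with the centers $c(x(t))$. For constants $\eta_{c1},\eta_{c2},\eta_{a1},\eta_{a2},\nu,\beta>0$, an initial time $t_0\ge0$ and a symmetric positive definite $\Gamma_0$, the closed loop on $[t_0,\infty)$ is $$\dot x=f(x)+g(x)u,\qquad \dot{\hat W}_c=-\eta_{c1}\Gamma\frac{\omega}{\rho}\delta_t-\frac{\eta_{c2}}N\Gamma\sum_{i=1}^N\frac{\omega_i}{\rho_i}\delta_{ti},$$ $$\dot\Gamma=\beta\Gamma-\eta_{c1}\Gamma\frac{\omega\omega^T}{\rho^2}\Gamma-\frac{\eta_{c2}}N\Gamma\sum_{i=1}^N\frac{\omega_i\omega_i^T}{\rho_i^2}\Gamma,\quad\Gamma(t_0)=\Gamma_0,$$ $$\dot{\hat W}_a=-\eta_{a1}(\hat W_a-\hat W_c)-\eta_{a2}\hat W_a+\frac{\eta_{c1}G_\sigma^T\hat W_a\omega^T}{4\rho}\hat W_c+\sum_{i=1}^N\frac{\eta_{c2}G_{\sigma i}^T\hat W_a\omega_i^T}{4N\rho_i}\hat W_c .$$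 Its solutions are continuous signals on $[t_0,\infty)$ whose right derivatives satisfy the equations at every $t\ge t_0$ (classical solutions are included). Put $\tilde W_c=W(x)-\hat W_c$, $\tilde W_a=W(x)-\hat W_a$, $Z=[x^T,\tilde W_c^T,\tilde W_a^T]^T$. *Assumption 1 (excitation).* $T>0$, $\underline c_1,\underline c_2,\underline c_3\ge0$ are constants, not all zero, and for all $t\ge t_0$: $\underline c_1I\le\int_t^{t+T}\frac{\omega\omega^T}{\rho^2}d\tau$, $\ \underline c_2I\le\frac1N\sum_i\frac{\omega_i(t)\omega_i(t)^T}{\rho_i(t)^2}$, $\ \underline c_3I\le\frac1N\int_t^{t+T}\sum_i\frac{\omega_i\omega_i^T}{\rho_i^2}d\tau$. *Constants.* Let $\overline\Gamma=\bigl(\min\{\eta_{c1}\underline c_1+\eta_{c2}\max\{\underline c_2T,\underline c_3\},\lambda_{\min}(\Gamma_0^{-1})\}e^{-\beta T}\bigr)^{-1}$, $\underline\Gamma=\bigl(\lambda_{\max}(\Gamma_0^{-1})+\frac{\eta_{c1}+\eta_{c2}}{\beta\nu}\bigr)^{-1}$, $\underline c=\frac{\beta}{2\overline\Gamma\eta_{c2}}+\frac{\underline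 c_2}2$. Let $\epsilon(y,x)=V^*(y)-W(x)^T\sigma(y,c(x))$, with $\nabla\epsilon$ its gradient (a row) in $y$, and $$\Delta(y,x)=\tfrac12W(x)^T\nabla\sigma\,G\nabla\epsilon^T+\tfrac14\nabla\epsilon\,G\nabla\epsilon^T-\nabla\epsilon f(y),$$ $G_{W\sigma}=\nabla W\,G\,\nabla\sigma^T$, $G_{V\sigma}=\nabla V^*G\,\nabla\sigma^T$, $G_{V\epsilon}=\nabla V^*G\,\nabla\epsilon^T$ (at $y=x$). A bar $\overline{\|\cdot\|}$ is the supremum over $x\in B_\chi$; for $\Delta$, $G_\sigma$ and $W^TG_\sigma$ it is taken also over all evaluation points $y\in\{x\}\cup\{x_i(x,t):1\le i\le N,\ t\ge0\}$, and for $\Gamma^{-1}G_{W\sigma}W$ also over $t\ge t_0$. Let $$\iota=\frac{3\Bigl(\frac{(\eta_{c1}+\eta_{c2})\overline{\|\Delta\|}}{\sqrt\nu}+\frac{\overline{\|\nabla Wf\|}}{\underline\Gamma}+\frac{\overline{\|\Gamma^{-1}G_{W\sigma}W\|}}2\Bigr)^2}{4\eta_{c2}\underline c}+\frac{\Bigl(\frac{\overline{\|G_{W\sigma}W\|}+\overline{\|G_{V\sigma}\|}}2+\eta_{a2}\overline{\|W\|}+\overline{\|\nabla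 Wf\|}+\frac{(\eta_{c1}+\eta_{c2})\overline{\|G_\sigma\|}\,\overline{\|W\|}^2}{4\sqrt\nu}\Bigr)^2}{\eta_{a1}+\eta_{a2}}+\tfrac12\overline{\|G_{V\epsilon}\|}.$$ Let $\underline{v_l},\overline{v_l},v_l$ be class $\mathcal K$ functions (continuous and strictly increasing on $[0,\infty)$, zero at $0$) such that $V_L(Z,t)=V^*(x)+\frac12\tilde W_c^T\Gamma^{-1}(t)\tilde W_c+\frac12\tilde W_a^T\tilde W_a$ satisfies $\underline{v_l}(\|Z\|)\le V_L(Z,t)\le\overline{v_l}(\|Z\|)$ for all $Z\in\mathbb R^{n+2L}$, $t\ge t_0$, and $v_l(\|Z\|)\le\frac{Q(x)}2+\frac{\eta_{c2}\underline c}6\|\tilde W_c\|^2+\frac{\eta_{a1}+\eta_{a2}}8\|\tilde W_a\|^2$ for $\|Z\|\le\zeta$. *Gain conditions.* $$\frac{\eta_{c2}\underline c}3\ge\frac{\Bigl(\frac{\overline{\|G_{W\sigma}\|}}{2\underline\Gamma}+\frac{(\eta_{c1}+\eta_{c2})\overline{\|W^TG_\sigma\|}}{4\sqrt\nu}+\eta_{a1}\Bigr)^2}{\eta_{a1}+\eta_{a2}},\qquad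 \frac{\eta_{a1}+\eta_{a2}}4\ge\frac{\overline{\|G_{W\sigma}\|}}2+\frac{(\eta_{c1}+\eta_{c2})\overline{\|W\|}\,\overline{\|G_\sigma\|}}{4\sqrt\nu},$$ and $\iota$ lies in the range of $v_l$ with $v_l^{-1}(\iota)<\overline{v_l}^{-1}(\underline{v_l}(\zeta))$. **Theorem.** Suppose that Assumption 1 and the gain conditions hold along a solution of the closed loop and that $\|Z(t_0)\|\le\overline{v_l}^{-1}(\underline{v_l}(\zeta))$. Then the state $x$ and the weight estimation errors $\tilde W_c,\tilde W_a$ are uniformly ultimately bounded: $\|Z(t)\|\le\zeta$ for all $t\ge t_0$, $$\limsup_{t\to\infty}\|Z(t)\|\le b_0:=\underline{v_l}^{-1}\bigl(\overline{v_l}(v_l^{-1}(\iota))\bigr)$$ (where $\overline{v_l}(v_l^{-1}(\iota))$ is in the range of $\underline{v_l}$), and for every $b>b_0$ there is $\tau(b)\ge0$, the same for all initial times and all such solutions with the same value of $\iota$, such that $\|Z(t)\|\le b$ for all $t\ge t_0+\tau(b)$. -/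

import Mathlib

open Set Filter Topology MeasureTheory
open scoped ENNReal RealInnerProductSpace

noncomputable section

namespace StaF

/-- The Euclidean space `ℝⁿ`. Matrices are continuous linear maps between Euclidean spaces,
so that matrix norms are induced 2-norms and transposes are adjoints. -/
abbrev E (n : ℕ) : Type := EuclideanSpace ℝ (Fin n)

/-- The data of the control problem and of the actor-critic controller. -/
structure System (n m L N : ℕ) where
  /-- drift dynamics -/
  f : E n → E n
  /-- control effectiveness -/
  g : E n → (E m →L[ℝ] E n)
  /-- state cost -/
  Q : E n → ℝ
  /-- control cost matrix -/
  R : E m →L[ℝ] E m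
  /-- kernel function -/
  k : E n → E n → ℝ
  /-- centers of the kernels, as functions of the state -/
  c : E n → Fin L → E n
  /-- radius of the approximation neighbourhood of the state -/
  r : ℝ
  /-- extrapolation functions: `xi i x t` is the `i`-th extrapolation point -/
  xi : Fin N → E n → ℝ → E n
  ηc1 : ℝ
  ηc2 : ℝ
  ηa1 : ℝ
  ηa2 : ℝ
  ν : ℝ
  /-- forgetting factor -/
  β : ℝ

/-- Symmetric positive definite matrices. -/
def PosDefOp {d : ℕ} (A : E d →L[ℝ] E d) : Prop :=
  IsSelfAdjoint A ∧ ∀ v : E d, v ≠ 0 → 0 < ⟪v, A v⟫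

/-- Smallest eigenvalue of a symmetric matrix. -/
def lambdaMin {d : ℕ} (A : E d →L[ℝ] E d) : ℝ := sInf (spectrum ℝ A)

/-- Largest eigenvalue of a symmetric matrix. -/
def lambdaMax {d : ℕ} (A : E d →L[ℝ] E d) : ℝ := sSup (spectrum ℝ A)

/-- The matrix `w wᵀ`. -/
def outer {d : ℕ} (w : E d) : E d →L[ℝ] E d := (innerSL ℝ w).smulRight w

/-- Class `𝒦` functions on `[0, ∞)`. -/
def ClassK (v : ℝ → ℝ) : Prop :=
  ContinuousOn v (Ici 0) ∧ StrictMonoOn v (Ici 0) ∧ v 0 = 0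

/-- The inverse of a class `𝒦` function, meaningful on the range of the function. -/
def kInv (v : ℝ → ℝ) (y : ℝ) : ℝ := Function.invFunOn v (Ici 0) y

/-- Euclidean norm of the stacked vector `[xᵀ, w_cᵀ, w_aᵀ]ᵀ`. -/
def normZ {n L : ℕ} (x : E n) (wc wa : E L) : ℝ := √(‖x‖ ^ 2 + ‖wc‖ ^ 2 + ‖wa‖ ^ 2)

namespace System

variable {n m L N : ℕ} (S : System n m L N)

/-! ### The optimal control problem -/

/-- Instantaneous cost. -/
def cost (x : E n) (u : E m) : ℝ := S.Q x + ⟪u, S.R u⟫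

/-- `φ` is the trajectory on `[0, ∞)` of `φ' = f(φ) + g(φ) u` from `x₀` under the
locally integrable control signal `u`. -/
def IsControlled (x₀ : E n) (φ : ℝ → E n) (u : ℝ → E m) : Prop :=
  LocallyIntegrableOn u (Ici 0) ∧ ContinuousOn φ (Ici 0) ∧
    ∀ t, 0 ≤ t → φ t = x₀ + ∫ τ in (0 : ℝ)..t, (S.f (φ τ) + S.g (φ τ) (u τ))

/-- Total cost of a trajectory and a control signal. -/
def totalCost (φ : ℝ → E n) (u : ℝ → E m) : ℝ≥0∞ :=
  ∫⁻ τ in Ici (0 : ℝ), ENNReal.ofReal (S.cost (φ τ) (u τ))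

/-- Infimum of the total cost over all control signals. -/
def optCost (x₀ : E n) : ℝ≥0∞ :=
  ⨅ (φ : ℝ → E n) (u : ℝ → E m) (_ : S.IsControlled x₀ φ u), S.totalCost φ u

/-- Optimal value function. -/
def Vstar (x : E n) : ℝ := (S.optCost x).toReal

/-! ### StaF kernels and ideal weights -/

/-- The vector of basis functions `σ(y, C)`. -/
def sigma (y : E n) (C : Fin L → E n) : E L := WithLp.toLp 2 fun j => S.k y (C j)

/-- `∇σ(y, c(x))`, the Jacobian with respect to the first argument. -/
def gradSigma (y x : E n) : E n →L[ℝ] E L := fderiv ℝ (fun y' => S.sigma y' (S.c x)) y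

/-- Norm, in the restriction of the Hilbert space `H` to the ball `B_r(x)`, of
`aᵀ σ(·, c(x)) - V̄`: the least norm of an element of `H` with these values on the ball. -/
def restrictedError {χ : Set (E n)} {H : Type*} [NormedAddCommGroup H] [InnerProductSpace ℝ H]
    [RKHS ℝ H χ ℝ] (Vbar : H) (x : E n) (a : E L) : ℝ :=
  sInf {s : ℝ | ∃ F : H, s = ‖F‖ ∧ ∀ y : χ, (y : E n) ∈ Metric.closedBall x S.r →
    F y = ⟪a, S.sigma y (S.c x)⟫ - Vbar y}

open Classical in
/-- The ideal weight function: a minimizer of the error over all weight vectors. -/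
def idealWeights {χ : Set (E n)} {H : Type*} [NormedAddCommGroup H] [InnerProductSpace ℝ H]
    [RKHS ℝ H χ ℝ] (Vbar : H) (x : E n) : E L :=
  Classical.epsilon fun a => IsMinOn (S.restrictedError Vbar x) univ a

/-! ### The controller, evaluated at a point `y` with the centers of the state `x` -/

/-- `G(y) = g(y) R⁻¹ g(y)ᵀ`. -/
def G (y : E n) : E n →L[ℝ] E n :=
  S.g y ∘L Ring.inverse S.R ∘L ContinuousLinearMap.adjoint (S.g y)

/-- `G_σ = ∇σ g R⁻¹ gᵀ ∇σᵀ`. -/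
def Gsigma (y x : E n) : E L →L[ℝ] E L :=
  S.gradSigma y x ∘L S.G y ∘L ContinuousLinearMap.adjoint (S.gradSigma y x)

/-- Approximate policy. -/
def uHat (y x : E n) (wa : E L) : E m :=
  -(1 / 2 : ℝ) • Ring.inverse S.R (ContinuousLinearMap.adjoint (S.g y)
    (ContinuousLinearMap.adjoint (S.gradSigma y x) wa))

/-- Regressor. -/
def omega (y x : E n) (wa : E L) : E L :=
  S.gradSigma y x (S.f y) - (1 / 2 : ℝ) • S.Gsigma y x wa

/-- Normalization of the regressor. -/
def rho (y x : E n) (wa : E L) : ℝ := √(1 + S.ν * ⟪S.omega y x wa, S.omega y x wa⟫)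

/-- Bellman error. -/
def delta (y x : E n) (wc wa : E L) : ℝ :=
  ⟪wc, S.omega y x wa⟫ + S.cost y (S.uHat y x wa)

end System

/-- The signals of the closed loop: state, critic weights, actor weights, gain matrix. -/
structure Signals (n L : ℕ) where
  x : ℝ → E n
  Wc : ℝ → E L
  Wa : ℝ → E L
  Γ : ℝ → (E L →L[ℝ] E L)

namespace System

variable {n m L N : ℕ} (S : System n m L N)

/-- The `i`-th extrapolation point along the signals. -/
def pt (z : Signals n L) (i : Fin N) (t : ℝ) : E n := S.xi i (z.x t) t

/-- `ω ωᵀ / ρ²` at time `t`. -/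
def excitation (z : Signals n L) (t : ℝ) : E L →L[ℝ] E L :=
  (S.rho (z.x t) (z.x t) (z.Wa t) ^ 2)⁻¹ • outer (S.omega (z.x t) (z.x t) (z.Wa t))

/-- `∑ᵢ ωᵢ ωᵢᵀ / ρᵢ²` at time `t`. -/
def excitationSum (z : Signals n L) (t : ℝ) : E L →L[ℝ] E L :=
  ∑ i, (S.rho (S.pt z i t) (z.x t) (z.Wa t) ^ 2)⁻¹ •
    outer (S.omega (S.pt z i t) (z.x t) (z.Wa t))

/-- Right-hand side of the plant under the feedback controller. -/
def xRhs (z : Signals n L) (t : ℝ) : E n :=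
  S.f (z.x t) + S.g (z.x t) (S.uHat (z.x t) (z.x t) (z.Wa t))

/-- Right-hand side of the critic update law. -/
def criticRhs (z : Signals n L) (t : ℝ) : E L :=
  -(S.ηc1 * S.delta (z.x t) (z.x t) (z.Wc t) (z.Wa t) / S.rho (z.x t) (z.x t) (z.Wa t)) •
      z.Γ t (S.omega (z.x t) (z.x t) (z.Wa t))
    - (S.ηc2 / N) • z.Γ t (∑ i,
      (S.delta (S.pt z i t) (z.x t) (z.Wc t) (z.Wa t) / S.rho (S.pt z i t) (z.x t) (z.Wa t)) •
        S.omega (S.pt z i t) (z.x t) (z.Wa t))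

/-- Right-hand side of the gain matrix update law. -/
def gainRhs (z : Signals n L) (t : ℝ) : E L →L[ℝ] E L :=
  S.β • z.Γ t - S.ηc1 • (z.Γ t ∘L S.excitation z t ∘L z.Γ t)
    - (S.ηc2 / N) • (z.Γ t ∘L S.excitationSum z t ∘L z.Γ t)

/-- Right-hand side of the actor update law. -/
def actorRhs (z : Signals n L) (t : ℝ) : E L :=
  -S.ηa1 • (z.Wa t - z.Wc t) - S.ηa2 • z.Wa t
    + (S.ηc1 * ⟪S.omega (z.x t) (z.x t) (z.Wa t), z.Wc t⟫ /
        (4 * S.rho (z.x t) (z.x t) (z.Wa t))) •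
      ContinuousLinearMap.adjoint (S.Gsigma (z.x t) (z.x t)) (z.Wa t)
    + ∑ i, (S.ηc2 * ⟪S.omega (S.pt z i t) (z.x t) (z.Wa t), z.Wc t⟫ /
        (4 * N * S.rho (S.pt z i t) (z.x t) (z.Wa t))) •
      ContinuousLinearMap.adjoint (S.Gsigma (S.pt z i t) (z.x t)) (z.Wa t)

/-- `z` solves the closed loop on `[t₀, ∞)`. Right derivatives are used so that, besides
classical solutions, extrapolation points that jump at isolated times are covered. -/
structure IsClosedLoop (t₀ : ℝ) (Γ₀ : E L →L[ℝ] E L) (z : Signals n L) : Prop where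
  x_cont : ContinuousOn z.x (Ici t₀)
  Wc_cont : ContinuousOn z.Wc (Ici t₀)
  Wa_cont : ContinuousOn z.Wa (Ici t₀)
  Γ_cont : ContinuousOn z.Γ (Ici t₀)
  x_deriv : ∀ t, t₀ ≤ t → HasDerivWithinAt z.x (S.xRhs z t) (Ici t) t
  Wc_deriv : ∀ t, t₀ ≤ t → HasDerivWithinAt z.Wc (S.criticRhs z t) (Ici t) t
  Wa_deriv : ∀ t, t₀ ≤ t → HasDerivWithinAt z.Wa (S.actorRhs z t) (Ici t) t
  Γ_deriv : ∀ t, t₀ ≤ t → HasDerivWithinAt z.Γ (S.gainRhs z t) (Ici t) t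
  Γ_init : z.Γ t₀ = Γ₀

/-- The excitation inequalities along the signals, in the order of symmetric matrices. -/
structure IsExciting (T c₁ c₂ c₃ t₀ : ℝ) (z : Signals n L) : Prop where
  first : ∀ t, t₀ ≤ t →
    c₁ • (1 : E L →L[ℝ] E L) ≤ ∫ τ in t..(t + T), S.excitation z τ
  second : ∀ t, t₀ ≤ t →
    c₂ • (1 : E L →L[ℝ] E L) ≤ (1 / N : ℝ) • S.excitationSum z t
  third : ∀ t, t₀ ≤ t →
    c₃ • (1 : E L →L[ℝ] E L) ≤ (1 / N : ℝ) • ∫ τ in t..(t + T), S.excitationSum z τ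

/-- Standing assumptions on the plant, the cost, the kernels and the design parameters. -/
structure Standing (χ : Set (E n)) {H : Type*} [NormedAddCommGroup H] [InnerProductSpace ℝ H]
    [CompleteSpace H] [RKHS ℝ H χ ℝ] (Vbar : H) (ζ : ℝ) : Prop where
  L_pos : 0 < L
  N_pos : 0 < N
  f_contDiff : ContDiff ℝ 1 S.f
  f_zero : S.f 0 = 0
  g_lipschitz : LocallyLipschitz S.g
  Q_cont : Continuous S.Q
  Q_zero : S.Q 0 = 0
  Q_pos : ∀ x, x ≠ 0 → 0 < S.Q x
  R_posDef : PosDefOp S.R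
  /-- an optimal control with finite cost exists from every initial state -/
  optimal_exists : ∀ x₀, ∃ φ u, S.IsControlled x₀ φ u ∧
    S.totalCost φ u = S.optCost x₀ ∧ S.totalCost φ u ≠ ⊤
  Vstar_contDiff : ContDiff ℝ 1 S.Vstar
  χ_compact : IsCompact χ
  ζ_pos : 0 < ζ
  r_pos : 0 < S.r
  /-- the neighbourhoods of the states of norm at most `ζ` lie in `χ` -/
  ball_subset : ∀ x ∈ Metric.closedBall (0 : E n) ζ, Metric.closedBall x S.r ⊆ χ
  /-- `H` is the reproducing kernel Hilbert space of `k` over `χ` -/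
  kernel_eq : ∀ y z : χ, S.k y z = RKHS.kernel H y z 1
  kernel_contDiff : ∀ y ∈ χ, ∀ z ∈ χ,
    ContDiffAt ℝ 1 (fun p : E n × E n => S.k p.1 p.2) (y, z)
  kernel_posDef : ∀ (s : Finset χ) (a : χ → ℝ), (∃ y ∈ s, a y ≠ 0) →
    0 < ∑ y ∈ s, ∑ z ∈ s, a y * a z * S.k y z
  c_contDiff : ∀ x ∈ χ, ContDiffAt ℝ 1 S.c x
  c_mem : ∀ x ∈ χ, ∀ j, S.c x j ∈ χ ∩ Metric.closedBall x S.r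
  c_distinct : ∀ x ∈ χ, Function.Injective (S.c x)
  Vbar_contDiff : ∃ F : E n → ℝ, (∀ y : χ, F y = Vbar y) ∧ ∀ y ∈ χ, ContDiffAt ℝ 1 F y
  xi_mem : ∀ i, ∀ x ∈ Metric.closedBall (0 : E n) ζ, ∀ t, 0 ≤ t →
    S.xi i x t ∈ Metric.closedBall x S.r
  ηc1_pos : 0 < S.ηc1
  ηc2_pos : 0 < S.ηc2
  ηa1_pos : 0 < S.ηa1
  ηa2_pos : 0 < S.ηa2
  ν_pos : 0 < S.ν
  β_pos : 0 < S.β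

/-! ### Constants of the gain conditions -/

/-- `Γ̄`. -/
def gammaUpper (T c₁ c₂ c₃ : ℝ) (Γ₀ : E L →L[ℝ] E L) : ℝ :=
  1 / (min (S.ηc1 * c₁ + S.ηc2 * max (c₂ * T) c₃) (lambdaMin (Ring.inverse Γ₀)) *
    Real.exp (-S.β * T))

/-- `Γ̲`. -/
def gammaLower (Γ₀ : E L →L[ℝ] E L) : ℝ :=
  1 / (lambdaMax (Ring.inverse Γ₀) + (S.ηc1 + S.ηc2) / (S.β * S.ν))

/-- `c̲ = β / (2 Γ̄ η_{c2}) + c̲₂ / 2`. -/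
def cLower (T c₁ c₂ c₃ : ℝ) (Γ₀ : E L →L[ℝ] E L) : ℝ :=
  S.β / (2 * S.gammaUpper T c₁ c₂ c₃ Γ₀ * S.ηc2) + c₂ / 2

/-- `∇ε(y, x)ᵀ`, the gradient in the first argument of the approximation error
`ε(y, x) = V*(y) - W(x)ᵀ σ(y, c(x))`. -/
def gradEps (W : E n → E L) (y x : E n) : E n :=
  gradient (fun y' => S.Vstar y' - ⟪W x, S.sigma y' (S.c x)⟫) y

/-- `Δ = (1/2) Wᵀ ∇σ G ∇εᵀ + (1/4) ∇ε G ∇εᵀ - ∇ε f`. -/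
def Delta (W : E n → E L) (y x : E n) : ℝ :=
  (1 / 2) * ⟪W x, S.gradSigma y x (S.G y (S.gradEps W y x))⟫
    + (1 / 4) * ⟪S.gradEps W y x, S.G y (S.gradEps W y x)⟫
    - ⟪S.gradEps W y x, S.f y⟫

/-- `G_{Wσ} = ∇W g R⁻¹ gᵀ ∇σᵀ`. -/
def GWsigma (W : E n → E L) (x : E n) : E L →L[ℝ] E L :=
  fderiv ℝ W x ∘L S.G x ∘L ContinuousLinearMap.adjoint (S.gradSigma x x)

/-- The transpose of `G_{Vσ} = ∇V* g R⁻¹ gᵀ ∇σᵀ`. -/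
def GVsigma (x : E n) : E L := S.gradSigma x x (S.G x (gradient S.Vstar x))

/-- `G_{Vε} = ∇V* g R⁻¹ gᵀ ∇εᵀ`. -/
def GVeps (W : E n → E L) (x : E n) : ℝ := ⟪gradient S.Vstar x, S.G x (S.gradEps W x x)⟫

/-- Supremum over the states of norm at most `ζ`. -/
def supState (ζ : ℝ) (h : E n → ℝ) : ℝ := sSup (h '' Metric.closedBall 0 ζ)

/-- Supremum over the states `x` of norm at most `ζ` and over the points `y` at which the
Bellman error is evaluated for that state: `x` itself and the extrapolation points. -/
def supEval (ζ : ℝ) (h : E n → E n → ℝ) : ℝ :=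
  sSup {s | ∃ x ∈ Metric.closedBall (0 : E n) ζ, ∃ y,
    (y = x ∨ ∃ i, ∃ t, 0 ≤ t ∧ y = S.xi i x t) ∧ s = h y x}

/-- Supremum of `‖Γ⁻¹(t) G_{Wσ}(x) W(x)‖` over the states of norm at most `ζ` and `t ≥ t₀`. -/
def supGammaGW (ζ t₀ : ℝ) (W : E n → E L) (Γ : ℝ → (E L →L[ℝ] E L)) : ℝ :=
  sSup {s | ∃ x ∈ Metric.closedBall (0 : E n) ζ, ∃ t, t₀ ≤ t ∧
    s = ‖Ring.inverse (Γ t) (S.GWsigma W x (W x))‖}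

/-- The residual constant `ι`. -/
def iota (ζ T c₁ c₂ c₃ : ℝ) (W : E n → E L) (Γ₀ : E L →L[ℝ] E L) (t₀ : ℝ)
    (Γ : ℝ → (E L →L[ℝ] E L)) : ℝ :=
  3 * ((S.ηc1 + S.ηc2) * S.supEval ζ (fun y x => ‖S.Delta W y x‖) / √S.ν
      + supState ζ (fun x => ‖fderiv ℝ W x (S.f x)‖) / S.gammaLower Γ₀
      + S.supGammaGW ζ t₀ W Γ / 2) ^ 2 / (4 * S.ηc2 * S.cLower T c₁ c₂ c₃ Γ₀)
    + 1 / (S.ηa1 + S.ηa2) *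
      ((supState ζ (fun x => ‖S.GWsigma W x (W x)‖) + supState ζ (fun x => ‖S.GVsigma x‖)) / 2
        + S.ηa2 * supState ζ (fun x => ‖W x‖)
        + supState ζ (fun x => ‖fderiv ℝ W x (S.f x)‖)
        + (S.ηc1 + S.ηc2) * S.supEval ζ (fun y x => ‖S.Gsigma y x‖)
            * supState ζ (fun x => ‖W x‖) ^ 2 / (4 * √S.ν)) ^ 2
    + (1 / 2) * supState ζ (fun x => ‖S.GVeps W x‖)

/-- The two sufficient conditions on the learning gains. -/
structure GainConditions (ζ T c₁ c₂ c₃ : ℝ) (W : E n → E L) (Γ₀ : E L →L[ℝ] E L) : Prop where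
  critic :
    (supState ζ (fun x => ‖S.GWsigma W x‖) / (2 * S.gammaLower Γ₀)
      + (S.ηc1 + S.ηc2)
          * S.supEval ζ (fun y x => ‖ContinuousLinearMap.adjoint (S.Gsigma y x) (W x)‖)
          / (4 * √S.ν)
      + S.ηa1) ^ 2 / (S.ηa1 + S.ηa2) ≤ S.ηc2 * S.cLower T c₁ c₂ c₃ Γ₀ / 3
  actor :
    supState ζ (fun x => ‖S.GWsigma W x‖) / 2
      + (S.ηc1 + S.ηc2) * supState ζ (fun x => ‖W x‖)
          * S.supEval ζ (fun y x => ‖S.Gsigma y x‖) / (4 * √S.ν)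
      ≤ (S.ηa1 + S.ηa2) / 4

/-- The candidate Lyapunov function `V_L(Z, t)` for the gain matrix `Γ`. -/
def lyap (Γ : ℝ → (E L →L[ℝ] E L)) (x : E n) (wc wa : E L) (t : ℝ) : ℝ :=
  S.Vstar x + (1 / 2) * ⟪wc, Ring.inverse (Γ t) wc⟫ + (1 / 2) * ⟪wa, wa⟫

end System

/-- `‖Z(t)‖` along the signals, with `Z = [xᵀ, (W - Ŵ_c)ᵀ, (W - Ŵ_a)ᵀ]ᵀ`. -/
def Signals.normZAt {n L : ℕ} (z : Signals n L) (W : E n → E L) (t : ℝ) : ℝ :=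
  normZ (z.x t) (W (z.x t) - z.Wc t) (W (z.x t) - z.Wa t)

end StaF

end

/-! The proof is a Lyapunov argument on `V_L = V* + ½ w̃_cᵀ Γ⁻¹ w̃_c + ½ |w̃_a|²`. While `‖Z‖ ≤ ζ`,
its right derivative along the closed loop is at most `-2 v_l(‖Z‖) + ι`, so it decreases wherever
`‖Z‖` exceeds `v_l⁻¹(ι)`. The gain condition on `ι` says that the boundary of the sublevel set at
height `v̲_l(ζ)` lies in that region. The sublevel set is therefore invariant, and `V_L` drops to
`v̲_l(b)`, `b₀ < b < ζ`, within a time fixed by the class `𝒦` functions, `ζ`, `ι` and `b`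
(`uniformly_ultimately_bounded`).

Four facts give the rate. (1) A Grönwall estimate shows that `Γ` stays invertible
(`riccati_isUnit`), and `X = Γ⁻¹` turns the Riccati equation into the linear `X' = M - βX`, where
`M` collects the regressors. Boundedness of `M` bounds `X` above, and excitation over a window
bounds it below (`Standing.gainInv_inner_le`, `Standing.le_gainInv_inner`).

(2) The ideal weights are continuously differentiable: the centers lie in the ball, so the minimizer
interpolates at the centers and equals the inverse Gram matrix times the values there
(`Standing.idealWeights_eq`).

(3) `V*` solves the Hamilton–Jacobi–Bellman equation (`Standing.hamilton_jacobi_bellman`). This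
follows from dynamic programming alone, although the optimal control is only locally integrable.

(4) Subtracting that equation, the Bellman error becomes `-w̃_cᵀω + ¼ w̃_aᵀ G_σ w̃_a + Δ`
(`Standing.delta_eq`). In `V_L'` the first term dominates the regressor part of `M` because `ρ ≥ 1`,
and the cubic terms `w̃_cᵀω · w̃_aᵀ G_σ w̃_a` cancel against the last terms of the actor law
(`Standing.bellman_term_le`). What remains is quadratic in the errors, and Young's inequality with
the gain conditions finishes (`Standing.lyapDeriv_le`). -/

namespace StaF

/-! ### Positive definite operators and their extreme eigenvalues -/

section PosDef

variable {d : ℕ} {A : E d →L[ℝ] E d}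

lemma inner_apply_comm_of_isSelfAdjoint (hA : IsSelfAdjoint A) (v w : E d) :
    ⟪A v, w⟫ = ⟪v, A w⟫ :=
  hA.isSymmetric v w

lemma ringInverse_apply_apply (hA : IsUnit A) (v : E d) : Ring.inverse A (A v) = v := by
  have h := Ring.inverse_mul_cancel A hA
  simpa using congrArg (fun B : E d →L[ℝ] E d => B v) h

lemma apply_ringInverse_apply (hA : IsUnit A) (v : E d) : A (Ring.inverse A v) = v := by
  have h := Ring.mul_inverse_cancel A hA
  simpa using congrArg (fun B : E d →L[ℝ] E d => B v) h

lemma isUnit_of_injective (h : ∀ v : E d, A v = 0 → v = 0) : IsUnit A := by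
  rw [ContinuousLinearMap.isUnit_iff_bijective]
  have hi : Function.Injective (A : E d →ₗ[ℝ] E d) :=
    (injective_iff_map_eq_zero _).2 h
  exact ⟨hi, LinearMap.injective_iff_surjective.1 hi⟩

lemma PosDefOp.isUnit (hA : PosDefOp A) : IsUnit A := by
  refine isUnit_of_injective fun v hv => ?_
  by_contra h
  have := hA.2 v h
  simp [hv] at this

lemma ringInverse_isSelfAdjoint (hA : IsSelfAdjoint A) (hu : IsUnit A) :
    IsSelfAdjoint (Ring.inverse A) := by
  rw [ContinuousLinearMap.isSelfAdjoint_iff_isSymmetric]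
  intro v w
  have h := inner_apply_comm_of_isSelfAdjoint hA (Ring.inverse A v) (Ring.inverse A w)
  rw [apply_ringInverse_apply hu, apply_ringInverse_apply hu] at h
  exact h.symm

lemma PosDefOp.inverse (hA : PosDefOp A) : PosDefOp (Ring.inverse A) := by
  refine ⟨ringInverse_isSelfAdjoint hA.1 hA.isUnit, fun v hv => ?_⟩
  have hne : Ring.inverse A v ≠ 0 := fun h => hv (by
    rw [← apply_ringInverse_apply hA.isUnit v, h, map_zero])
  have := hA.2 _ hne
  rwa [apply_ringInverse_apply hA.isUnit, real_inner_comm] at this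

lemma PosDefOp.inner_nonneg (hA : PosDefOp A) (v : E d) : 0 ≤ ⟪v, A v⟫ := by
  by_cases hv : v = 0
  · simp [hv]
  · exact (hA.2 v hv).le

lemma mem_spectrum_of_apply_eq {μ : ℝ} {v : E d} (hv : v ≠ 0) (h : A v = μ • v) :
    μ ∈ spectrum ℝ A := by
  rw [spectrum.mem_iff]
  intro hu
  refine hv ?_
  have h0 : (algebraMap ℝ (E d →L[ℝ] E d) μ - A) v = 0 := by
    simp [Algebra.algebraMap_eq_smul_one, h]
  rw [← ringInverse_apply_apply hu v, h0, map_zero]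

/-- In finite dimension the infimum of the Rayleigh quotient is an eigenvalue. Dimension zero is
excluded because there are no nonzero vectors. -/
lemma exists_least_eigenvalue (hA : IsSelfAdjoint A) (hd : 0 < d) :
    ∃ (μ : ℝ) (x : E d), x ≠ 0 ∧ A x = μ • x ∧ ∀ v, μ * ‖v‖ ^ 2 ≤ ⟪v, A v⟫ := by
  have : NeZero d := ⟨hd.ne'⟩
  have : Nontrivial (E d) := inferInstance
  have hev := hA.isSymmetric.hasEigenvalue_iInf_of_finiteDimensional
  obtain ⟨x, hx⟩ := hev.exists_hasEigenvector
  refine ⟨_, x, hx.2, by simpa using hx.apply_eq_smul, fun v => ?_⟩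
  by_cases hv : v = 0
  · simp [hv]
  have hpos : 0 < ‖v‖ ^ 2 := by positivity
  rw [← le_div_iff₀ hpos]
  have hb : BddBelow (range fun x : {x : E d // x ≠ 0} => RCLike.re ⟪(A : E d →ₗ[ℝ] E d) x, x⟫ /
      ‖(x : E d)‖ ^ 2) := by
    refine ⟨-‖A‖, ?_⟩
    rintro _ ⟨y, rfl⟩
    exact (abs_le.1 (A.rayleighQuotient_le_norm y)).1
  refine (ciInf_le hb ⟨v, hv⟩).trans (le_of_eq ?_)
  simp [real_inner_comm]

lemma lambdaMin_mul_le (hA : IsSelfAdjoint A) (v : E d) :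
    lambdaMin A * ‖v‖ ^ 2 ≤ ⟪v, A v⟫ := by
  rcases Nat.eq_zero_or_pos d with rfl | hd
  · simp [Subsingleton.elim v 0]
  obtain ⟨μ, x, hx, hAx, h⟩ := exists_least_eigenvalue hA hd
  refine le_trans ?_ (h v)
  gcongr
  exact csInf_le (spectrum.isCompact A).bddBelow (mem_spectrum_of_apply_eq hx hAx)

lemma le_lambdaMax_mul (hA : IsSelfAdjoint A) (v : E d) :
    ⟪v, A v⟫ ≤ lambdaMax A * ‖v‖ ^ 2 := by
  rcases Nat.eq_zero_or_pos d with rfl | hd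
  · simp [Subsingleton.elim v 0]
  have hn : IsSelfAdjoint (-A) := ContinuousLinearMap.isSelfAdjoint_iff_isSymmetric.2 fun v w => by
    simpa using inner_apply_comm_of_isSelfAdjoint hA v w
  obtain ⟨μ, x, hx, hAx, h⟩ := exists_least_eigenvalue hn hd
  have hv := h v
  simp only [neg_apply, inner_neg_right] at hv hAx
  have hle : -μ ≤ lambdaMax A := le_csSup (spectrum.isCompact A).bddAbove
    (mem_spectrum_of_apply_eq hx (by rw [neg_smul, ← hAx, neg_neg]))
  nlinarith [sq_nonneg ‖v‖]

lemma PosDefOp.pos_of_mem_spectrum (hA : PosDefOp A) {s : ℝ} (hs : s ∈ spectrum ℝ A) :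
    0 < s := by
  by_contra! hs0
  rw [spectrum.mem_iff, IsUnit.sub_iff] at hs
  refine hs (isUnit_of_injective fun v hv => ?_)
  by_contra hne
  have h1 := hA.2 v hne
  have h2 : A v = s • v := by
    simpa [Algebra.algebraMap_eq_smul_one, sub_eq_zero] using hv
  rw [h2, inner_smul_right, real_inner_self_eq_norm_sq] at h1
  nlinarith [sq_nonneg ‖v‖]

lemma PosDefOp.lambdaMin_pos (hA : PosDefOp A) (hd : 0 < d) : 0 < lambdaMin A := by
  obtain ⟨μ, x, hx, hAx, -⟩ := exists_least_eigenvalue hA.1 hd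
  exact hA.pos_of_mem_spectrum
    ((spectrum.isCompact A).sInf_mem ⟨μ, mem_spectrum_of_apply_eq hx hAx⟩)

lemma PosDefOp.lambdaMax_pos (hA : PosDefOp A) (hd : 0 < d) : 0 < lambdaMax A := by
  obtain ⟨μ, x, hx, hAx, -⟩ := exists_least_eigenvalue hA.1 hd
  have hμ := mem_spectrum_of_apply_eq hx hAx
  exact (hA.pos_of_mem_spectrum hμ).trans_le (le_csSup (spectrum.isCompact A).bddAbove hμ)

lemma PosDefOp.exists_coercive (hA : PosDefOp A) :
    ∃ μ : ℝ, 0 < μ ∧ ∀ v, μ * ‖v‖ ^ 2 ≤ ⟪v, A v⟫ := by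
  rcases Nat.eq_zero_or_pos d with rfl | hd
  · exact ⟨1, one_pos, fun v => by simp [Subsingleton.elim v 0]⟩
  · exact ⟨_, hA.lambdaMin_pos hd, lambdaMin_mul_le hA.1⟩

/-- Completing the square. -/
lemma PosDefOp.neg_inner_inverse_le (hA : PosDefOp A) {s : ℝ} (hs : 0 < s) (q u : E d) :
    -(1 / (4 * s)) * ⟪q, Ring.inverse A q⟫ ≤ s * ⟪u, A u⟫ + ⟪q, u⟫ := by
  have h := hA.inner_nonneg (u + (1 / (2 * s)) • Ring.inverse A q)
  have hq : ⟪Ring.inverse A q, A u⟫ = ⟪q, u⟫ := by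
    rw [← inner_apply_comm_of_isSelfAdjoint hA.1, apply_ringInverse_apply hA.isUnit]
  simp only [map_add, map_smul, apply_ringInverse_apply hA.isUnit, inner_add_left, inner_add_right,
    inner_smul_left, inner_smul_right, hq, real_inner_comm q u,
    real_inner_comm q (Ring.inverse A q)] at h
  simp only [conj_trivial] at h
  have h' := mul_nonneg hs.le h
  field_simp at h' ⊢
  linarith

/-- Testing positivity on `w - C⁻¹ A w` and bounding the quadratic form at `A w` gives `C⁻¹ ‖A w‖² ≤
⟪w, A w⟫`. This turns form bounds on `Γ⁻¹` into norm bounds. -/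
lemma norm_apply_le_of_inner_le (hA : IsSelfAdjoint A) (h0 : ∀ v, 0 ≤ ⟪v, A v⟫) {C : ℝ}
    (hC : 0 < C) (h1 : ∀ v, ⟪v, A v⟫ ≤ C * ‖v‖ ^ 2) (w : E d) : ‖A w‖ ≤ C * ‖w‖ := by
  have h := h0 (w - C⁻¹ • A w)
  have hs : ⟪A w, A w⟫ = ⟪w, A (A w)⟫ := inner_apply_comm_of_isSelfAdjoint hA w (A w)
  have h2 := h1 (A w)
  have h3 := h1 w
  simp only [map_sub, map_smul, inner_sub_left, inner_sub_right, inner_smul_left,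
    inner_smul_right, ← hs, real_inner_self_eq_norm_sq, conj_trivial] at h
  have h4 : C⁻¹ * (C⁻¹ * ⟪A w, A (A w)⟫) ≤ C⁻¹ * ‖A w‖ ^ 2 := by
    have : C⁻¹ * ⟪A w, A (A w)⟫ ≤ ‖A w‖ ^ 2 := by
      rw [inv_mul_le_iff₀ hC]; exact h2
    gcongr
  have h5 : C⁻¹ * ‖A w‖ ^ 2 ≤ C * ‖w‖ ^ 2 := by linarith
  rw [inv_mul_le_iff₀ hC] at h5
  refine abs_le_of_sq_le_sq' ?_ (by positivity) |>.2
  nlinarith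

lemma outer_apply (w v : E d) : outer w v = ⟪w, v⟫ • w := by
  simp [outer]

lemma norm_outer_le (w : E d) : ‖outer w‖ ≤ ‖w‖ ^ 2 := by
  refine ContinuousLinearMap.opNorm_le_bound _ (by positivity) fun v => ?_
  rw [outer_apply, norm_smul]
  calc ‖⟪w, v⟫‖ * ‖w‖ ≤ (‖w‖ * ‖v‖) * ‖w‖ := by gcongr; exact norm_inner_le_norm _ _
    _ = ‖w‖ ^ 2 * ‖v‖ := by ring

end PosDef

end StaF

namespace StaF

/-! ### The Riccati equation of the gain and the linear equation of its inverse -/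

section Riccati

variable {d : ℕ} {Γ M : ℝ → E d →L[ℝ] E d} {β K t₀ : ℝ}

lemma le_of_hasDerivWithinAt_nonneg {φ φ' : ℝ → ℝ} {a b : ℝ} (hab : a ≤ b)
    (hc : ContinuousOn φ (Icc a b)) (hd : ∀ t ∈ Ico a b, HasDerivWithinAt φ (φ' t) (Ici t) t)
    (h0 : ∀ t ∈ Ico a b, 0 ≤ φ' t) : φ a ≤ φ b :=
  image_le_of_deriv_right_le_deriv_boundary (f := fun _ => φ a) (f' := fun _ => 0)
    continuousOn_const (fun _ _ => hasDerivWithinAt_const _ _ _) le_rfl hc hd h0 ⟨hab, le_rfl⟩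

/-- Both terms of the right-hand side, applied to `v`, factor through `Γ v`. Hence `‖Γ v‖` decays at
most exponentially, at a rate `C` built from a bound of `Γ` on the compact interval, and a kernel
vector at time `t` is already one at `t₀`. -/
lemma riccati_isUnit (hc : ContinuousOn Γ (Ici t₀))
    (hd : ∀ t, t₀ ≤ t → HasDerivWithinAt Γ (β • Γ t - Γ t ∘L M t ∘L Γ t) (Ici t) t)
    (hK : ∀ t, ‖M t‖ ≤ K) (h0 : IsUnit (Γ t₀)) {t : ℝ} (ht : t₀ ≤ t) : IsUnit (Γ t) := by
  refine isUnit_of_injective fun v hv => ?_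
  have hcI : ContinuousOn Γ (Icc t₀ t) := hc.mono Icc_subset_Ici_self
  obtain ⟨B, hB⟩ := isCompact_Icc.exists_bound_of_continuousOn hcI
  have hB0 : 0 ≤ B := (norm_nonneg _).trans (hB t₀ ⟨le_rfl, ht⟩)
  set C := |β| + B * K with hC
  have key : Real.exp (2 * C * t₀) * ‖Γ t₀ v‖ ^ 2 ≤ Real.exp (2 * C * t) * ‖Γ t v‖ ^ 2 := by
    refine le_of_hasDerivWithinAt_nonneg (φ := fun s => Real.exp (2 * C * s) * ‖Γ s v‖ ^ 2)
      (φ' := fun s => Real.exp (2 * C * s) * (2 * C) * ‖Γ s v‖ ^ 2 + Real.exp (2 * C * s) *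
        (2 * ⟪Γ s v, (β • Γ s - Γ s ∘L M s ∘L Γ s) v⟫)) ht ?_ ?_ ?_
    · exact ContinuousOn.mul (by fun_prop) ((hcI.clm_apply continuousOn_const).norm.pow 2)
    · intro s hs
      have h1 : HasDerivWithinAt (fun s => Γ s v) ((β • Γ s - Γ s ∘L M s ∘L Γ s) v) (Ici s) s := by
        simpa using (hd s hs.1).clm_apply (hasDerivWithinAt_const s (Ici s) v)
      have h2 : HasDerivWithinAt (fun s => Real.exp (2 * C * s)) (Real.exp (2 * C * s) * (2 * C))
          (Ici s) s := by
        have := ((hasDerivAt_id s).const_mul (2 * C)).exp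
        simpa using this.hasDerivWithinAt
      exact h2.mul h1.norm_sq
    · intro s hs
      have hBs := hB s ⟨hs.1, hs.2.le⟩
      have hi : -⟪Γ s v, (β • Γ s - Γ s ∘L M s ∘L Γ s) v⟫ ≤ C * ‖Γ s v‖ ^ 2 := by
        rw [← inner_neg_right]
        refine (real_inner_le_norm _ _).trans ?_
        have : ‖-((β • Γ s - Γ s ∘L M s ∘L Γ s) v)‖ ≤ C * ‖Γ s v‖ := by
          rw [norm_neg]
          simp only [sub_apply, smul_apply, ContinuousLinearMap.comp_apply]
          refine (norm_sub_le _ _).trans ?_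
          have h1 : ‖Γ s (M s (Γ s v))‖ ≤ B * (K * ‖Γ s v‖) :=
            (ContinuousLinearMap.le_opNorm _ _).trans (mul_le_mul hBs
              ((ContinuousLinearMap.le_opNorm _ _).trans
                (mul_le_mul_of_nonneg_right (hK s) (norm_nonneg _))) (norm_nonneg _) hB0)
          rw [norm_smul, Real.norm_eq_abs]
          linarith
        nlinarith [norm_nonneg (Γ s v)]
      have he := Real.exp_pos (2 * C * s)
      nlinarith
  rw [hv, norm_zero] at key
  have h3 : ‖Γ t₀ v‖ ^ 2 ≤ 0 := by
    have he := Real.exp_pos (2 * C * t₀)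
    by_contra! h
    have := mul_pos he h
    simp at key
    linarith
  have h4 : Γ t₀ v = 0 := by
    rw [← norm_eq_zero]
    exact pow_eq_zero_iff two_ne_zero |>.1 (le_antisymm h3 (sq_nonneg _))
  rw [← ringInverse_apply_apply h0 v, h4, map_zero]

/-- The rule `(Γ⁻¹)' = -Γ⁻¹ Γ' Γ⁻¹` removes the quadratic nonlinearity. -/
lemma riccati_inverse_hasDerivWithinAt (hu : ∀ t, t₀ ≤ t → IsUnit (Γ t))
    (hd : ∀ t, t₀ ≤ t → HasDerivWithinAt Γ (β • Γ t - Γ t ∘L M t ∘L Γ t) (Ici t) t)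
    {t : ℝ} (ht : t₀ ≤ t) :
    HasDerivWithinAt (fun s => Ring.inverse (Γ s)) (M t - β • Ring.inverse (Γ t)) (Ici t) t := by
  obtain ⟨U, hU⟩ := hu t ht
  have h := hasFDerivAt_ringInverse (𝕜 := ℝ) U
  rw [hU] at h
  refine (h.comp_hasDerivWithinAt t (hd t ht)).congr_deriv ?_
  ext1 v
  have hi : ∀ w, (↑U⁻¹ : E d →L[ℝ] E d) w = Ring.inverse (Γ t) w := fun w => by
    rw [← hU, Ring.inverse_unit]
  simp [hi, map_sub, ringInverse_apply_apply (hu t ht), apply_ringInverse_apply (hu t ht)]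
  abel

lemma riccati_inverse_continuousOn (hc : ContinuousOn Γ (Ici t₀))
    (hu : ∀ t, t₀ ≤ t → IsUnit (Γ t)) :
    ContinuousOn (fun s => Ring.inverse (Γ s)) (Ici t₀) := by
  intro t ht
  obtain ⟨U, hU⟩ := hu t ht
  have h := (hasFDerivAt_ringInverse (𝕜 := ℝ) U).continuousAt
  rw [hU] at h
  exact ContinuousAt.comp_continuousWithinAt (f := Γ) h (hc t ht)

variable {X : ℝ → E d →L[ℝ] E d}

/-- The integrating factor cancels the decay term `-β X`; the comparison arguments below all start
from here. -/
lemma expInner_hasDerivWithinAt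
    (hd : ∀ t, t₀ ≤ t → HasDerivWithinAt X (M t - β • X t) (Ici t) t)
    (v w : E d) {t : ℝ} (ht : t₀ ≤ t) :
    HasDerivWithinAt (fun s => Real.exp (β * s) * ⟪v, X s w⟫)
      (Real.exp (β * t) * ⟪v, M t w⟫) (Ici t) t := by
  have h1 : HasDerivWithinAt (fun s => X s w) ((M t - β • X t) w) (Ici t) t := by
    simpa using (hd t ht).clm_apply (hasDerivWithinAt_const t (Ici t) w)
  have h2 : HasDerivWithinAt (fun s => ⟪v, X s w⟫) ⟪v, (M t - β • X t) w⟫ (Ici t) t := by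
    simpa using (hasDerivWithinAt_const t (Ici t) v).inner ℝ h1
  have h3 : HasDerivWithinAt (fun s => Real.exp (β * s)) (Real.exp (β * t) * β) (Ici t) t := by
    simpa using ((hasDerivAt_id t).const_mul β).exp.hasDerivWithinAt
  refine (h3.mul h2).congr_deriv ?_
  simp [inner_sub_right, inner_smul_right]
  ring

lemma expInner_continuousOn (hc : ContinuousOn X (Ici t₀)) (v w : E d) :
    ContinuousOn (fun s => Real.exp (β * s) * ⟪v, X s w⟫) (Ici t₀) :=
  ContinuousOn.mul (by fun_prop)
    (continuousOn_const.inner (hc.clm_apply continuousOn_const))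

/-- Since `M` is symmetric, `exp (β t)` times the antisymmetric part of `X` has zero right
derivative, and it vanishes at `t₀`. -/
lemma linear_isSelfAdjoint (hc : ContinuousOn X (Ici t₀))
    (hd : ∀ t, t₀ ≤ t → HasDerivWithinAt X (M t - β • X t) (Ici t) t)
    (hM : ∀ t, IsSelfAdjoint (M t)) (h0 : IsSelfAdjoint (X t₀)) {t : ℝ} (ht : t₀ ≤ t) :
    IsSelfAdjoint (X t) := by
  rw [ContinuousLinearMap.isSelfAdjoint_iff_isSymmetric]
  intro v w
  change ⟪X t v, w⟫ = ⟪v, X t w⟫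
  have h := constant_of_has_deriv_right_zero
    (f := fun s => Real.exp (β * s) * ⟪v, X s w⟫ - Real.exp (β * s) * ⟪w, X s v⟫)
    (a := t₀) (b := t)
    (((expInner_continuousOn hc v w).sub (expInner_continuousOn hc w v)).mono Icc_subset_Ici_self)
    (fun s hs => ((expInner_hasDerivWithinAt hd v w hs.1).sub
      (expInner_hasDerivWithinAt hd w v hs.1)).congr_deriv (by
        rw [← inner_apply_comm_of_isSelfAdjoint (hM s), real_inner_comm, sub_self]))
    t ⟨ht, le_rfl⟩
  have h1 : ⟪v, X t₀ w⟫ = ⟪w, X t₀ v⟫ := by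
    rw [← inner_apply_comm_of_isSelfAdjoint h0, real_inner_comm]
  simp only [h1, sub_self, ← mul_sub] at h
  rw [real_inner_comm]
  have := (mul_eq_zero.1 h).resolve_left (Real.exp_pos _).ne'
  linarith

lemma linear_decay_le (hc : ContinuousOn X (Ici t₀))
    (hd : ∀ t, t₀ ≤ t → HasDerivWithinAt X (M t - β • X t) (Ici t) t)
    (hM : ∀ t v, 0 ≤ ⟪v, M t v⟫) (v : E d) {s t : ℝ} (hs : t₀ ≤ s) (hst : s ≤ t) :
    Real.exp (-(β * (t - s))) * ⟪v, X s v⟫ ≤ ⟪v, X t v⟫ := by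
  have h := le_of_hasDerivWithinAt_nonneg hst
    ((expInner_continuousOn (β := β) hc v v).mono
      (Icc_subset_Ici_self.trans (Ici_subset_Ici.2 hs)))
    (fun τ hτ => expInner_hasDerivWithinAt hd v v (hs.trans hτ.1))
    (fun τ _ => mul_nonneg (Real.exp_pos _).le (hM τ v))
  have he : Real.exp (-(β * (t - s))) = Real.exp (β * s) / Real.exp (β * t) := by
    rw [← Real.exp_sub]; ring_nf
  rw [he, div_mul_eq_mul_div, div_le_iff₀ (Real.exp_pos _)]
  linarith

/-- Variation of constants in comparison form: the discounted integral of the constant `K` is at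
most `K / β`. Monotonicity of a difference replaces the integral, since `M` is not assumed
measurable. -/
lemma linear_upper_bound (hβ : 0 < β) (hc : ContinuousOn X (Ici t₀))
    (hd : ∀ t, t₀ ≤ t → HasDerivWithinAt X (M t - β • X t) (Ici t) t)
    (hM : ∀ t v, ⟪v, M t v⟫ ≤ K * ‖v‖ ^ 2) (v : E d) (h0 : 0 ≤ ⟪v, X t₀ v⟫) (hK : 0 ≤ K)
    {t : ℝ} (ht : t₀ ≤ t) : ⟪v, X t v⟫ ≤ ⟪v, X t₀ v⟫ + K / β * ‖v‖ ^ 2 := by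
  have hB : ∀ s, HasDerivWithinAt (fun s => Real.exp (β * s) * (K / β * ‖v‖ ^ 2))
      (Real.exp (β * s) * (K * ‖v‖ ^ 2)) (Ici s) s := fun s => by
    have := ((hasDerivAt_id s).const_mul β).exp.mul_const (K / β * ‖v‖ ^ 2)
    refine this.hasDerivWithinAt.congr_deriv ?_
    simp; field_simp
  have h := le_of_hasDerivWithinAt_nonneg ht
    (φ := fun s => Real.exp (β * s) * (K / β * ‖v‖ ^ 2) - Real.exp (β * s) * ⟪v, X s v⟫)
    ((ContinuousOn.sub (by fun_prop) (expInner_continuousOn hc v v)).mono Icc_subset_Ici_self)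
    (fun τ hτ => (hB τ).sub (expInner_hasDerivWithinAt hd v v hτ.1))
    (fun τ _ => by
      rw [← mul_sub]
      exact mul_nonneg (Real.exp_pos _).le (sub_nonneg.2 (hM τ v)))
  have he : Real.exp (β * t₀) ≤ Real.exp (β * t) := by gcongr
  have hp := Real.exp_pos (β * t₀)
  have h2 : 0 ≤ K / β * ‖v‖ ^ 2 := by positivity
  have h3 : Real.exp (β * t₀) * ⟪v, X t₀ v⟫ ≤ Real.exp (β * t) * ⟪v, X t₀ v⟫ := by gcongr
  have h4 : 0 ≤ Real.exp (β * t₀) * (K / β * ‖v‖ ^ 2) := by positivity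
  refine le_of_mul_le_mul_left ?_ (Real.exp_pos (β * t))
  nlinarith

/-- Over a window of length `T` the weight loses at most the factor `exp (-βT)`. An integrable
minorant `ℓ` stands in for the quadratic form of `M`, which need not be integrable. -/
lemma linear_window_lower_bound (hβ : 0 < β) (hc : ContinuousOn X (Ici t₀))
    (hd : ∀ t, t₀ ≤ t → HasDerivWithinAt X (M t - β • X t) (Ici t) t)
    (hM : ∀ t v, 0 ≤ ⟪v, M t v⟫) (v : E d) {s T : ℝ} (hs : t₀ ≤ s) (hT : 0 ≤ T)
    (h0 : 0 ≤ ⟪v, X s v⟫) {ℓ : ℝ → ℝ}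
    (hℓ : IntervalIntegrable ℓ volume s (s + T)) (hℓM : ∀ τ, s ≤ τ → ℓ τ ≤ ⟪v, M τ v⟫) :
    Real.exp (-(β * T)) * (∫ τ in s..(s + T), ℓ τ) ≤ ⟪v, X (s + T) v⟫ := by
  have hsT : s ≤ s + T := by linarith
  have h := intervalIntegral.integral_le_sub_of_hasDeriv_right_of_le hsT
    (g := fun s => Real.exp (β * s) * ⟪v, X s v⟫) (φ := fun τ => Real.exp (β * s) * ℓ τ)
    ((expInner_continuousOn (β := β) hc v v).mono
      (Icc_subset_Ici_self.trans (Ici_subset_Ici.2 hs)))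
    (fun τ hτ => (expInner_hasDerivWithinAt hd v v (hs.trans hτ.1.le)).mono Ioi_subset_Ici_self)
    ((intervalIntegrable_iff_integrableOn_Icc_of_le hsT).1 (hℓ.const_mul _))
    (fun τ hτ => by
      have : Real.exp (β * s) ≤ Real.exp (β * τ) := by gcongr; exact hτ.1.le
      calc Real.exp (β * s) * ℓ τ ≤ Real.exp (β * s) * ⟪v, M τ v⟫ := by gcongr; exact hℓM τ hτ.1.le
        _ ≤ _ := mul_le_mul_of_nonneg_right this (hM τ v))
  rw [intervalIntegral.integral_const_mul] at h
  have he : Real.exp (-(β * T)) = Real.exp (β * s) / Real.exp (β * (s + T)) := by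
    rw [← Real.exp_sub]; ring_nf
  rw [he, div_mul_eq_mul_div, div_le_iff₀ (Real.exp_pos _)]
  have := mul_nonneg (Real.exp_pos (β * s)).le h0
  linarith

end Riccati

end StaF

/-! ### Excitation and two-sided bounds of the inverse gain along the closed loop -/

namespace StaF

lemma exists_integrable_minorant {d : ℕ} {P : ℝ → E d →L[ℝ] E d} {s T c : ℝ}
    (hP : ∀ τ v, 0 ≤ ⟪v, P τ v⟫) (h : c • (1 : E d →L[ℝ] E d) ≤ ∫ τ in s..(s + T), P τ)
    (v : E d) : ∃ ℓ : ℝ → ℝ, IntervalIntegrable ℓ volume s (s + T) ∧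
      (∀ τ, ℓ τ ≤ ⟪v, P τ v⟫) ∧ c * ‖v‖ ^ 2 ≤ ∫ τ in s..(s + T), ℓ τ := by
  have h1 : c * ‖v‖ ^ 2 ≤ ⟪v, (∫ τ in s..(s + T), P τ) v⟫ := by
    have h2 := ((ContinuousLinearMap.le_def _ _).1 h).inner_nonneg_right v
    simp only [sub_apply, smul_apply, one_apply_eq_self, inner_sub_right, inner_smul_right,
      real_inner_self_eq_norm_sq] at h2
    linarith
  by_cases hi : IntervalIntegrable P volume s (s + T)
  · let Λ : (E d →L[ℝ] E d) →L[ℝ] ℝ :=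
      (innerSL ℝ v).comp (ContinuousLinearMap.apply ℝ (E d) v)
    refine ⟨fun τ => ⟪v, P τ v⟫, ?_, fun _ => le_rfl, ?_⟩
    · exact ⟨Λ.integrable_comp hi.1, Λ.integrable_comp hi.2⟩
    · have h3 := Λ.intervalIntegral_comp_comm hi
      have h4 : ∀ A, Λ A = ⟪v, A v⟫ := fun A => by simp [Λ]
      simp only [h4] at h3
      rwa [h3]
  -- The integral of a non-integrable function is zero by convention, so the hypothesis forces `c
  -- ‖v‖² ≤ 0` and the zero minorant is enough.
  · rw [intervalIntegral.integral_undef hi] at h1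
    exact ⟨fun _ => 0, by simp, fun τ => hP τ v, by simpa using h1⟩

namespace System

variable {n m L N : ℕ} (S : System n m L N)

lemma rho_sq (hν : 0 < S.ν) (y x : E n) (wa : E L) :
    S.rho y x wa ^ 2 = 1 + S.ν * ‖S.omega y x wa‖ ^ 2 := by
  rw [rho, real_inner_self_eq_norm_sq, Real.sq_sqrt (by positivity)]

lemma one_le_rho (hν : 0 < S.ν) (y x : E n) (wa : E L) : 1 ≤ S.rho y x wa := by
  rw [rho, real_inner_self_eq_norm_sq, Real.one_le_sqrt]
  have : 0 ≤ S.ν * ‖S.omega y x wa‖ ^ 2 := by positivity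
  linarith

lemma norm_omega_div_rho_le (hν : 0 < S.ν) (y x : E n) (wa : E L) :
    ‖S.omega y x wa‖ / S.rho y x wa ≤ 1 / √S.ν := by
  have h1 := S.one_le_rho hν y x wa
  rw [div_le_div_iff₀ (by linarith) (Real.sqrt_pos.2 hν), one_mul]
  refine abs_le_of_sq_le_sq' ?_ (by linarith) |>.2
  rw [mul_pow, Real.sq_sqrt hν.le, S.rho_sq hν]
  linarith

/-- The matrix `ω ωᵀ / ρ²`. -/
noncomputable def regressorMatrix (y x : E n) (wa : E L) : E L →L[ℝ] E L :=
  (S.rho y x wa ^ 2)⁻¹ • outer (S.omega y x wa)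

lemma regressorMatrix_inner (y x : E n) (wa v w : E L) :
    ⟪v, S.regressorMatrix y x wa w⟫ =
      ⟪S.omega y x wa, v⟫ * ⟪S.omega y x wa, w⟫ / S.rho y x wa ^ 2 := by
  simp only [regressorMatrix, smul_apply, outer_apply, inner_smul_right,
    real_inner_comm (S.omega y x wa) v]
  ring

lemma regressorMatrix_inner_nonneg (y x : E n) (wa v : E L) :
    0 ≤ ⟪v, S.regressorMatrix y x wa v⟫ := by
  rw [regressorMatrix_inner]
  exact div_nonneg (mul_self_nonneg _) (sq_nonneg _)

lemma norm_regressorMatrix_le (hν : 0 < S.ν) (y x : E n) (wa : E L) :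
    ‖S.regressorMatrix y x wa‖ ≤ 1 / S.ν := by
  rw [regressorMatrix, norm_smul, norm_inv, S.rho_sq hν]
  have h : 0 ≤ S.ν * ‖S.omega y x wa‖ ^ 2 := by positivity
  rw [Real.norm_of_nonneg (by positivity), inv_mul_le_iff₀ (by positivity), mul_one_div,
    le_div_iff₀ hν]
  have := norm_outer_le (S.omega y x wa)
  nlinarith

/-- The information matrix that drives the gain matrix. -/
noncomputable def infoMatrix (z : Signals n L) (t : ℝ) : E L →L[ℝ] E L :=
  S.ηc1 • S.regressorMatrix (z.x t) (z.x t) (z.Wa t) +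
    (S.ηc2 / N) • ∑ i, S.regressorMatrix (S.pt z i t) (z.x t) (z.Wa t)

lemma gainRhs_eq (z : Signals n L) (t : ℝ) :
    S.gainRhs z t = S.β • z.Γ t - z.Γ t ∘L S.infoMatrix z t ∘L z.Γ t := by
  ext1 v
  simp only [gainRhs, infoMatrix, excitation, excitationSum, regressorMatrix, sub_apply,
    smul_apply, add_apply, ContinuousLinearMap.comp_apply, map_add, map_smul]
  abel

lemma infoMatrix_inner (z : Signals n L) (t : ℝ) (v w : E L) :
    ⟪v, S.infoMatrix z t w⟫ = S.ηc1 * ⟪v, S.regressorMatrix (z.x t) (z.x t) (z.Wa t) w⟫ +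
      S.ηc2 / N * ∑ i, ⟪v, S.regressorMatrix (S.pt z i t) (z.x t) (z.Wa t) w⟫ := by
  simp [infoMatrix, inner_add_right, inner_smul_right, inner_sum, sum_apply]

lemma infoMatrix_isSelfAdjoint (z : Signals n L) (t : ℝ) :
    IsSelfAdjoint (S.infoMatrix z t) := by
  rw [ContinuousLinearMap.isSelfAdjoint_iff_isSymmetric]
  intro v w
  change ⟪S.infoMatrix z t v, w⟫ = ⟪v, S.infoMatrix z t w⟫
  rw [real_inner_comm]
  simp only [infoMatrix_inner, regressorMatrix_inner, mul_comm]

variable {χ : Set (E n)} {H : Type*} [NormedAddCommGroup H] [InnerProductSpace ℝ H]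
  [CompleteSpace H] [RKHS ℝ H χ ℝ] {Vbar : H} {ζ : ℝ}

variable {S}

lemma Standing.natCast_pos (hS : S.Standing χ Vbar ζ) : (0 : ℝ) < N := by
  exact_mod_cast hS.N_pos

lemma Standing.infoMatrix_inner_nonneg (hS : S.Standing χ Vbar ζ) (z : Signals n L) (t : ℝ)
    (v : E L) : 0 ≤ ⟪v, S.infoMatrix z t v⟫ := by
  have h1 := hS.ηc1_pos
  have h2 := hS.ηc2_pos
  rw [infoMatrix_inner]
  exact add_nonneg (mul_nonneg h1.le (S.regressorMatrix_inner_nonneg _ _ _ _))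
    (mul_nonneg (by positivity) (Finset.sum_nonneg fun i _ => S.regressorMatrix_inner_nonneg _ _ _ _))

lemma Standing.norm_infoMatrix_le (hS : S.Standing χ Vbar ζ) (z : Signals n L) (t : ℝ) :
    ‖S.infoMatrix z t‖ ≤ (S.ηc1 + S.ηc2) / S.ν := by
  have h1 := hS.ηc1_pos
  have h2 := hS.ηc2_pos
  have h3 := hS.natCast_pos
  have hsum : ‖∑ i, S.regressorMatrix (S.pt z i t) (z.x t) (z.Wa t)‖ ≤ N * (1 / S.ν) := by
    refine (norm_sum_le _ _).trans ?_
    refine (Finset.sum_le_sum fun i _ => S.norm_regressorMatrix_le hS.ν_pos _ _ _).trans ?_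
    simp
  refine (norm_add_le _ _).trans ?_
  rw [norm_smul, norm_smul, Real.norm_of_nonneg h1.le, Real.norm_of_nonneg (by positivity)]
  calc _ ≤ S.ηc1 * (1 / S.ν) + S.ηc2 / N * (N * (1 / S.ν)) := by
        gcongr
        exact S.norm_regressorMatrix_le hS.ν_pos _ _ _
    _ = _ := by field_simp

variable {Γ₀ : E L →L[ℝ] E L} {t₀ T c₁ c₂ c₃ : ℝ} {z : Signals n L}

lemma Standing.gain_isUnit (hS : S.Standing χ Vbar ζ) (hΓ₀ : PosDefOp Γ₀)
    (hz : S.IsClosedLoop t₀ Γ₀ z) {t : ℝ} (ht : t₀ ≤ t) : IsUnit (z.Γ t) :=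
  riccati_isUnit hz.Γ_cont (fun t ht => (hz.Γ_deriv t ht).congr_deriv (S.gainRhs_eq z t))
    (hS.norm_infoMatrix_le z) (by rw [hz.Γ_init]; exact hΓ₀.isUnit) ht

lemma Standing.gainInv_hasDerivWithinAt (hS : S.Standing χ Vbar ζ) (hΓ₀ : PosDefOp Γ₀)
    (hz : S.IsClosedLoop t₀ Γ₀ z) {t : ℝ} (ht : t₀ ≤ t) :
    HasDerivWithinAt (fun s => Ring.inverse (z.Γ s))
      (S.infoMatrix z t - S.β • Ring.inverse (z.Γ t)) (Ici t) t :=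
  riccati_inverse_hasDerivWithinAt (fun _ ht => hS.gain_isUnit hΓ₀ hz ht)
    (fun t ht => (hz.Γ_deriv t ht).congr_deriv (S.gainRhs_eq z t)) ht

lemma Standing.gainInv_continuousOn (hS : S.Standing χ Vbar ζ) (hΓ₀ : PosDefOp Γ₀)
    (hz : S.IsClosedLoop t₀ Γ₀ z) : ContinuousOn (fun s => Ring.inverse (z.Γ s)) (Ici t₀) :=
  riccati_inverse_continuousOn hz.Γ_cont fun _ ht => hS.gain_isUnit hΓ₀ hz ht

lemma Standing.gainInv_isSelfAdjoint (hS : S.Standing χ Vbar ζ) (hΓ₀ : PosDefOp Γ₀)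
    (hz : S.IsClosedLoop t₀ Γ₀ z) {t : ℝ} (ht : t₀ ≤ t) : IsSelfAdjoint (Ring.inverse (z.Γ t)) :=
  linear_isSelfAdjoint (X := fun s => Ring.inverse (z.Γ s)) (hS.gainInv_continuousOn hΓ₀ hz)
    (fun _ ht => hS.gainInv_hasDerivWithinAt hΓ₀ hz ht) (S.infoMatrix_isSelfAdjoint z)
    (by simpa only [hz.Γ_init] using hΓ₀.inverse.1) ht

lemma Standing.gainInv_inner_nonneg (hS : S.Standing χ Vbar ζ) (hΓ₀ : PosDefOp Γ₀)
    (hz : S.IsClosedLoop t₀ Γ₀ z) {t : ℝ} (ht : t₀ ≤ t) (v : E L) :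
    0 ≤ ⟪v, Ring.inverse (z.Γ t) v⟫ := by
  refine le_trans ?_ (linear_decay_le (X := fun s => Ring.inverse (z.Γ s))
    (hS.gainInv_continuousOn hΓ₀ hz) (fun _ ht => hS.gainInv_hasDerivWithinAt hΓ₀ hz ht)
    (hS.infoMatrix_inner_nonneg z) v le_rfl ht)
  simp only [hz.Γ_init]
  exact mul_nonneg (Real.exp_pos _).le (hΓ₀.inverse.inner_nonneg v)

lemma Standing.gammaLower_pos (hS : S.Standing χ Vbar ζ) (hΓ₀ : PosDefOp Γ₀) :
    0 < S.gammaLower Γ₀ := by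
  have h1 := hS.ηc1_pos
  have h2 := hS.ηc2_pos
  have h3 := hS.β_pos
  have h4 := hS.ν_pos
  have h5 := hΓ₀.inverse.lambdaMax_pos hS.L_pos
  rw [gammaLower]
  positivity

lemma Standing.gainInv_inner_le (hS : S.Standing χ Vbar ζ) (hΓ₀ : PosDefOp Γ₀)
    (hz : S.IsClosedLoop t₀ Γ₀ z) {t : ℝ} (ht : t₀ ≤ t) (v : E L) :
    ⟪v, Ring.inverse (z.Γ t) v⟫ ≤ 1 / S.gammaLower Γ₀ * ‖v‖ ^ 2 := by
  have h1 := hS.ηc1_pos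
  have h2 := hS.ηc2_pos
  have h3 := hS.ν_pos
  have h0 := hΓ₀.inverse.inner_nonneg v
  rw [← hz.Γ_init] at h0
  have h := linear_upper_bound (X := fun s => Ring.inverse (z.Γ s)) hS.β_pos
    (hS.gainInv_continuousOn hΓ₀ hz) (fun _ ht => hS.gainInv_hasDerivWithinAt hΓ₀ hz ht)
    (K := (S.ηc1 + S.ηc2) / S.ν)
    (fun s w => (real_inner_le_norm _ _).trans (by
      rw [sq, ← mul_assoc, mul_comm]
      gcongr
      exact (ContinuousLinearMap.le_opNorm _ _).trans
        (mul_le_mul_of_nonneg_right (hS.norm_infoMatrix_le z s) (norm_nonneg _))))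
    v h0 (by positivity) ht
  refine h.trans ?_
  rw [hz.Γ_init]
  have := le_lambdaMax_mul hΓ₀.inverse.1 v
  rw [gammaLower, one_div_one_div, add_mul, div_div, mul_comm S.ν]
  linarith

lemma Standing.norm_gainInv_apply_le (hS : S.Standing χ Vbar ζ) (hΓ₀ : PosDefOp Γ₀)
    (hz : S.IsClosedLoop t₀ Γ₀ z) {t : ℝ} (ht : t₀ ≤ t) (v : E L) :
    ‖Ring.inverse (z.Γ t) v‖ ≤ 1 / S.gammaLower Γ₀ * ‖v‖ :=
  norm_apply_le_of_inner_le (hS.gainInv_isSelfAdjoint hΓ₀ hz ht)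
    (hS.gainInv_inner_nonneg hΓ₀ hz ht) (one_div_pos.2 (hS.gammaLower_pos hΓ₀))
    (hS.gainInv_inner_le hΓ₀ hz ht) v

lemma Standing.excitation_level_pos (hS : S.Standing χ Vbar ζ) (hT : 0 < T) (hc₁ : 0 ≤ c₁)
    (hc₂ : 0 ≤ c₂) (hc₃ : 0 ≤ c₃) (hc : 0 < c₁ ∨ 0 < c₂ ∨ 0 < c₃) :
    0 < S.ηc1 * c₁ + S.ηc2 * max (c₂ * T) c₃ := by
  have h1 := hS.ηc1_pos
  have h2 := hS.ηc2_pos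
  rcases hc with h | h | h
  · have : 0 ≤ max (c₂ * T) c₃ := le_max_of_le_right hc₃
    positivity
  · have : 0 < max (c₂ * T) c₃ := lt_max_of_lt_left (by positivity)
    positivity
  · have : 0 < max (c₂ * T) c₃ := lt_max_of_lt_right h
    positivity

lemma Standing.gammaUpper_pos (hS : S.Standing χ Vbar ζ) (hΓ₀ : PosDefOp Γ₀) (hT : 0 < T)
    (hc₁ : 0 ≤ c₁) (hc₂ : 0 ≤ c₂) (hc₃ : 0 ≤ c₃) (hc : 0 < c₁ ∨ 0 < c₂ ∨ 0 < c₃) :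
    0 < S.gammaUpper T c₁ c₂ c₃ Γ₀ := by
  rw [gammaUpper]
  exact one_div_pos.2 (mul_pos (lt_min (hS.excitation_level_pos hT hc₁ hc₂ hc₃ hc)
    (hΓ₀.inverse.lambdaMin_pos hS.L_pos)) (Real.exp_pos _))

/-- The trajectory part uses the first excitation inequality; the extrapolation part uses whichever
of the other two gives the higher level. This produces the constant in `gammaUpper`. -/
lemma Standing.exists_infoMatrix_minorant (hS : S.Standing χ Vbar ζ)
    (hex : S.IsExciting T c₁ c₂ c₃ t₀ z) {s : ℝ} (hs : t₀ ≤ s) (v : E L) :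
    ∃ ℓ : ℝ → ℝ, IntervalIntegrable ℓ volume s (s + T) ∧
      (∀ τ, t₀ ≤ τ → ℓ τ ≤ ⟪v, S.infoMatrix z τ v⟫) ∧
      (S.ηc1 * c₁ + S.ηc2 * max (c₂ * T) c₃) * ‖v‖ ^ 2 ≤ ∫ τ in s..(s + T), ℓ τ := by
  have h1 := hS.ηc1_pos
  have h2 := hS.ηc2_pos
  have h3 := hS.natCast_pos
  have hE : ∀ τ w, 0 ≤ ⟪w, S.excitation z τ w⟫ := fun τ w =>
    S.regressorMatrix_inner_nonneg (z.x τ) (z.x τ) (z.Wa τ) w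
  have hEs : ∀ τ w, ⟪w, ((1 / N : ℝ) • S.excitationSum z τ) w⟫ =
      1 / N * ∑ i, ⟪w, S.regressorMatrix (S.pt z i τ) (z.x τ) (z.Wa τ) w⟫ := fun τ w => by
    simp [excitationSum, regressorMatrix, inner_smul_right, inner_sum, sum_apply]
  have hEs0 : ∀ τ w, 0 ≤ ⟪w, ((1 / N : ℝ) • S.excitationSum z τ) w⟫ := fun τ w => by
    rw [hEs]
    exact mul_nonneg (by positivity)
      (Finset.sum_nonneg fun i _ => S.regressorMatrix_inner_nonneg _ _ _ _)
  obtain ⟨ℓ₁, hi₁, hle₁, hint₁⟩ := exists_integrable_minorant hE (hex.first s hs) v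
  obtain ⟨ℓ₂, hi₂, hle₂, hint₂⟩ : ∃ ℓ : ℝ → ℝ, IntervalIntegrable ℓ volume s (s + T) ∧
      (∀ τ, t₀ ≤ τ → ℓ τ ≤ ⟪v, ((1 / N : ℝ) • S.excitationSum z τ) v⟫) ∧
      max (c₂ * T) c₃ * ‖v‖ ^ 2 ≤ ∫ τ in s..(s + T), ℓ τ := by
    rcases le_total (c₂ * T) c₃ with h | h
    · rw [max_eq_right h]
      have h3 := hex.third s hs
      rw [← intervalIntegral.integral_smul] at h3
      obtain ⟨ℓ, hi, hle, hint⟩ := exists_integrable_minorant hEs0 h3 v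
      exact ⟨ℓ, hi, fun τ _ => hle τ, hint⟩
    -- The pointwise excitation inequality supplies a constant minorant, whose integral over the
    -- window gains the factor `T`.
    · rw [max_eq_left h]
      refine ⟨fun _ => c₂ * ‖v‖ ^ 2, by simp, fun τ hτ => ?_, by simp; linarith⟩
      have h2 := ((ContinuousLinearMap.le_def _ _).1 (hex.second τ hτ)).inner_nonneg_right v
      simp only [sub_apply, inner_sub_right, smul_apply, one_apply_eq_self, inner_smul_right,
        real_inner_self_eq_norm_sq] at h2 ⊢
      linarith
  refine ⟨fun τ => S.ηc1 * ℓ₁ τ + S.ηc2 * ℓ₂ τ, (hi₁.const_mul _).add (hi₂.const_mul _),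
    fun τ hτ => ?_, ?_⟩
  · have e1 : S.ηc1 * ℓ₁ τ ≤ S.ηc1 * ⟪v, S.regressorMatrix (z.x τ) (z.x τ) (z.Wa τ) v⟫ := by
      gcongr; exact hle₁ τ
    have e2 : S.ηc2 * ℓ₂ τ ≤ S.ηc2 *
        (1 / N * ∑ i, ⟪v, S.regressorMatrix (S.pt z i τ) (z.x τ) (z.Wa τ) v⟫) := by
      rw [← hEs]; gcongr; exact hle₂ τ hτ
    rw [infoMatrix_inner]
    calc _ ≤ _ := add_le_add e1 e2
      _ = _ := by ring
  · rw [intervalIntegral.integral_add (hi₁.const_mul _) (hi₂.const_mul _),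
      intervalIntegral.integral_const_mul, intervalIntegral.integral_const_mul]
    nlinarith

/-- Up to time `t₀ + T` the initial value has lost at most the factor `exp (-βT)`; afterwards the
window `[t - T, t]` lies in the past and its excitation gives the bound. The minimum in `gammaUpper`
covers both cases. -/
lemma Standing.le_gainInv_inner (hS : S.Standing χ Vbar ζ) (hΓ₀ : PosDefOp Γ₀)
    (hz : S.IsClosedLoop t₀ Γ₀ z) (hT : 0 < T) (hc₁ : 0 ≤ c₁)
    (hc₂ : 0 ≤ c₂) (hc₃ : 0 ≤ c₃) (hc : 0 < c₁ ∨ 0 < c₂ ∨ 0 < c₃)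
    (hex : S.IsExciting T c₁ c₂ c₃ t₀ z) {t : ℝ} (ht : t₀ ≤ t) (v : E L) :
    1 / S.gammaUpper T c₁ c₂ c₃ Γ₀ * ‖v‖ ^ 2 ≤ ⟪v, Ring.inverse (z.Γ t) v⟫ := by
  have hlev := hS.excitation_level_pos hT hc₁ hc₂ hc₃ hc
  have hmin := hΓ₀.inverse.lambdaMin_pos hS.L_pos
  set a := S.ηc1 * c₁ + S.ηc2 * max (c₂ * T) c₃ with ha
  set b := lambdaMin (Ring.inverse Γ₀) with hb
  rw [gammaUpper, one_div_one_div]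
  have hβ := hS.β_pos
  rcases le_total t (t₀ + T) with h | h
  · refine le_trans ?_ (linear_decay_le (X := fun s => Ring.inverse (z.Γ s))
      (hS.gainInv_continuousOn hΓ₀ hz) (fun _ ht => hS.gainInv_hasDerivWithinAt hΓ₀ hz ht)
      (hS.infoMatrix_inner_nonneg z) v le_rfl ht)
    rw [hz.Γ_init]
    have h1 := lambdaMin_mul_le hΓ₀.inverse.1 v
    have h2 : Real.exp (-S.β * T) ≤ Real.exp (-(S.β * (t - t₀))) := by
      rw [neg_mul]; gcongr; linarith
    calc min a b * Real.exp (-S.β * T) * ‖v‖ ^ 2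
        ≤ b * Real.exp (-(S.β * (t - t₀))) * ‖v‖ ^ 2 := by
          gcongr
          exact min_le_right _ _
      _ = Real.exp (-(S.β * (t - t₀))) * (b * ‖v‖ ^ 2) := by ring
      _ ≤ _ := by gcongr
  · have hs : t₀ ≤ t - T := by linarith
    obtain ⟨ℓ, hi, hle, hint⟩ := hS.exists_infoMatrix_minorant hex hs v
    have hw := linear_window_lower_bound (X := fun s => Ring.inverse (z.Γ s)) hS.β_pos
      (hS.gainInv_continuousOn hΓ₀ hz) (fun _ ht => hS.gainInv_hasDerivWithinAt hΓ₀ hz ht)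
      (hS.infoMatrix_inner_nonneg z) v hs hT.le (hS.gainInv_inner_nonneg hΓ₀ hz hs v) hi
      (fun τ hτ => hle τ (hs.trans hτ))
    rw [sub_add_cancel] at hw hint
    calc min a b * Real.exp (-S.β * T) * ‖v‖ ^ 2
        ≤ a * Real.exp (-S.β * T) * ‖v‖ ^ 2 := by
          gcongr
          exact min_le_left _ _
      _ = Real.exp (-(S.β * T)) * (a * ‖v‖ ^ 2) := by rw [neg_mul]; ring
      _ ≤ Real.exp (-(S.β * T)) * _ := by gcongr
      _ ≤ _ := hw

end System

end StaF

/-! ### Ideal weights: interpolation at the centers and differentiability -/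

namespace StaF.System

variable {n m L N : ℕ} (S : System n m L N)

/-- The Gram matrix of the kernels centred at `c(x)`. -/
noncomputable def gram (x : E n) : E L →L[ℝ] E L :=
  ∑ i, ∑ j, S.k (S.c x i) (S.c x j) •
    (innerSL ℝ (EuclideanSpace.single j (1 : ℝ))).smulRight (EuclideanSpace.single i (1 : ℝ))

lemma gram_apply (x : E n) (a : E L) (i : Fin L) :
    S.gram x a i = ∑ j, S.k (S.c x i) (S.c x j) * a j := by
  simp [gram, sum_apply, EuclideanSpace.inner_single_left, Finset.sum_apply,
    Pi.single_apply]

variable {χ : Set (E n)} {H : Type*} [NormedAddCommGroup H] [InnerProductSpace ℝ H]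
  [CompleteSpace H] [RKHS ℝ H χ ℝ] {Vbar : H} {ζ : ℝ} {S}

/-- The centers of the kernels as points of `χ`. -/
def Standing.center (hS : S.Standing χ Vbar ζ) {x : E n} (hx : x ∈ χ) (j : Fin L) : χ :=
  ⟨S.c x j, (hS.c_mem x hx j).1⟩

lemma Standing.center_injective (hS : S.Standing χ Vbar ζ) {x : E n} (hx : x ∈ χ) :
    Function.Injective (hS.center hx) := fun _ _ h =>
  hS.c_distinct x hx (congrArg Subtype.val h)

/-- The element `aᵀ σ(·, c(x))` of `H`. -/
noncomputable def Standing.fit (hS : S.Standing χ Vbar ζ) {x : E n} (hx : x ∈ χ) (a : E L) : H :=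
  ∑ j, a j • RKHS.kerFun H (hS.center hx j) (1 : ℝ)

lemma Standing.fit_apply (hS : S.Standing χ Vbar ζ) {x : E n} (hx : x ∈ χ) (a : E L) (y : χ) :
    hS.fit hx a y = ⟪a, S.sigma y (S.c x)⟫ := by
  have h1 : ∀ F : H, F y = ⟪RKHS.kerFun H y (1 : ℝ), F⟫ := fun F => by simp
  rw [h1, fit, inner_sum, PiLp.inner_apply]
  refine Finset.sum_congr rfl fun j _ => ?_
  rw [inner_smul_right, ← h1, RKHS.kerFun_apply, ← hS.kernel_eq]
  simp [sigma, center, mul_comm]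

lemma Standing.inner_fit (hS : S.Standing χ Vbar ζ) {x : E n} (hx : x ∈ χ) (a : E L) (F : H) :
    ⟪hS.fit hx a, F⟫ = ∑ j, a j * F (hS.center hx j) := by
  simp [fit, sum_inner, inner_smul_left]

lemma Standing.fit_apply_center (hS : S.Standing χ Vbar ζ) {x : E n} (hx : x ∈ χ) (a : E L)
    (i : Fin L) : hS.fit hx a (hS.center hx i) = S.gram x a i := by
  rw [fit_apply, gram_apply, PiLp.inner_apply]
  simp [sigma, center]

lemma Standing.fit_sub (hS : S.Standing χ Vbar ζ) {x : E n} (hx : x ∈ χ) (a b : E L) :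
    hS.fit hx (a - b) = hS.fit hx a - hS.fit hx b := by
  simp [fit, sub_smul]

/-- The squared norm is the Gram quadratic form, positive because the kernel is strictly positive
definite and the centers are distinct. -/
lemma Standing.norm_fit_pos (hS : S.Standing χ Vbar ζ) {x : E n} (hx : x ∈ χ) {a : E L}
    (ha : a ≠ 0) : 0 < ‖hS.fit hx a‖ ^ 2 := by
  obtain ⟨i, hi⟩ : ∃ i, a i ≠ 0 := by
    by_contra! h
    exact ha (by ext i; simpa using h i)
  let e : Fin L ↪ χ := ⟨hS.center hx, hS.center_injective hx⟩
  have hext : ∀ j, Function.extend e (fun j => a j) 0 (e j) = a j := fun j =>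
    e.injective.extend_apply _ _ _
  have h := hS.kernel_posDef (Finset.univ.map e) (Function.extend e (fun j => a j) 0)
    ⟨e i, by simp, by rwa [hext]⟩
  simp only [Finset.sum_map, hext] at h
  rw [← real_inner_self_eq_norm_sq, inner_fit]
  refine h.trans_le (le_of_eq (Finset.sum_congr rfl fun i _ => ?_))
  rw [fit_apply_center, gram_apply, Finset.mul_sum]
  exact Finset.sum_congr rfl fun j _ => by
    rw [mul_right_comm, mul_assoc]; rfl

lemma Standing.gram_isUnit (hS : S.Standing χ Vbar ζ) {x : E n} (hx : x ∈ χ) :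
    IsUnit (S.gram x) := by
  refine isUnit_of_injective fun a ha => ?_
  by_contra hne
  have h := hS.norm_fit_pos hx hne
  rw [← real_inner_self_eq_norm_sq, inner_fit] at h
  simp [fit_apply_center, ha] at h

/-- Functions of `H` that vanish on the neighbourhood of `x` are the orthogonal complement of
this subspace. -/
noncomputable def localSpan (S : System n m L N) (χ : Set (E n)) (H : Type*)
    [NormedAddCommGroup H] [InnerProductSpace ℝ H] [CompleteSpace H] [RKHS ℝ H χ ℝ] (x : E n) :
    Submodule ℝ H :=
  Submodule.span ℝ {F | ∃ y : χ, (y : E n) ∈ Metric.closedBall x S.r ∧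
    F = RKHS.kerFun H y (1 : ℝ)}

/-- By the reproducing property, orthogonality to the kernel section at `y` means vanishing at `y`.
-/
lemma mem_localSpan_orthogonal {x : E n} {F : H} :
    F ∈ (S.localSpan χ H x)ᗮ ↔ ∀ y : χ, (y : E n) ∈ Metric.closedBall x S.r → F y = 0 := by
  constructor
  · intro hF y hy
    have := (Submodule.mem_orthogonal _ _).1 hF (RKHS.kerFun H y (1 : ℝ))
      (Submodule.subset_span ⟨y, hy, rfl⟩)
    simpa using this
  · intro hF
    rw [localSpan, Submodule.mem_orthogonal]
    intro u hu
    induction hu using Submodule.span_induction with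
    | mem u hu =>
      obtain ⟨y, hy, rfl⟩ := hu
      simp [hF y hy]
    | zero => simp
    | add u v _ _ hu hv => rw [inner_add_left, hu, hv, add_zero]
    | smul c u _ hu => rw [inner_smul_left, hu, mul_zero]

lemma Standing.fit_mem_localSpan (hS : S.Standing χ Vbar ζ) {x : E n} (hx : x ∈ χ) (a : E L) :
    hS.fit hx a ∈ S.localSpan χ H x :=
  Submodule.sum_mem _ fun j _ => Submodule.smul_mem _ _
    (Submodule.subset_span ⟨hS.center hx j, (hS.c_mem x hx j).2, rfl⟩)

/-- The component of `F` orthogonal to the functions vanishing on the neighbourhood of `x`. -/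
noncomputable def localPart (S : System n m L N) {χ : Set (E n)} {H : Type*}
    [NormedAddCommGroup H] [InnerProductSpace ℝ H] [CompleteSpace H] [RKHS ℝ H χ ℝ] (x : E n)
    (F : H) : H :=
  F - (S.localSpan χ H x)ᗮ.starProjection F

lemma localPart_sub_mem (x : E n) (F : H) :
    S.localPart x F - F ∈ (S.localSpan χ H x)ᗮ := by
  rw [localPart, sub_sub_cancel_left]
  exact Submodule.neg_mem _ (Submodule.starProjection_apply_mem _ _)

lemma inner_localPart_eq_zero {x : E n} (F : H) {G : H} (hG : G ∈ (S.localSpan χ H x)ᗮ) :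
    ⟪S.localPart x F, G⟫ = 0 :=
  Submodule.starProjection_inner_eq_zero F G hG

/-- Elements with the prescribed values on the ball differ by elements of the orthogonal complement
of `localSpan`. By Pythagoras the least norm is attained at the component orthogonal to that
complement. -/
lemma Standing.restrictedError_eq (hS : S.Standing χ Vbar ζ) {x : E n} (hx : x ∈ χ) (a : E L) :
    S.restrictedError Vbar x a = ‖S.localPart x (hS.fit hx a - Vbar)‖ := by
  set h := hS.fit hx a - Vbar with hh
  have hval : ∀ y : χ, h y = ⟪a, S.sigma y (S.c x)⟫ - Vbar y := fun y => by
    rw [hh, RKHS.coe_sub, Pi.sub_apply, fit_apply]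
  refine IsLeast.csInf_eq ⟨⟨S.localPart x h, rfl, fun y hy => ?_⟩, ?_⟩
  · have := mem_localSpan_orthogonal.1 (localPart_sub_mem (S := S) x h) y hy
    rw [RKHS.coe_sub, Pi.sub_apply, sub_eq_zero] at this
    rw [this, hval]
  · rintro _ ⟨F, rfl, hF⟩
    have h1 : F - h ∈ (S.localSpan χ H x)ᗮ := mem_localSpan_orthogonal.2 fun y hy => by
      rw [RKHS.coe_sub, Pi.sub_apply, hF y hy, hval, sub_self]
    have h2 : F - S.localPart x h ∈ (S.localSpan χ H x)ᗮ := by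
      have := Submodule.sub_mem _ h1 (localPart_sub_mem (S := S) x h)
      rwa [sub_sub_sub_cancel_right] at this
    have h3 := norm_add_sq_eq_norm_sq_add_norm_sq_of_inner_eq_zero _ _
      (inner_localPart_eq_zero h h2)
    rw [add_sub_cancel] at h3
    nlinarith [norm_nonneg F, norm_nonneg (S.localPart x h), norm_nonneg (F - S.localPart x h)]

/-- The values of the approximated function at the centers. -/
noncomputable def Standing.target (hS : S.Standing χ Vbar ζ) {x : E n} (hx : x ∈ χ) : E L :=
  WithLp.toLp 2 fun i => Vbar (hS.center hx i)

/-- The residual of the interpolant vanishes at the centers, hence is orthogonal to every kernel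
combination. These combinations lie in `localSpan` because the centers lie in the ball, so
Pythagoras applies. -/
lemma Standing.norm_localPart_sq (hS : S.Standing χ Vbar ζ) {x : E n} (hx : x ∈ χ) {b : E L}
    (hb : S.gram x b = hS.target hx) (a : E L) :
    ‖S.localPart x (hS.fit hx a - Vbar)‖ ^ 2 =
      ‖S.localPart x (hS.fit hx b - Vbar)‖ ^ 2 + ‖hS.fit hx (a - b)‖ ^ 2 := by
  set U := S.localSpan χ H x
  have hmem := hS.fit_mem_localSpan hx (a - b)
  have h0 : Uᗮ.starProjection (hS.fit hx (a - b)) = 0 := by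
    rw [Submodule.starProjection_apply_eq_zero_iff]
    exact Submodule.le_orthogonal_orthogonal U hmem
  have h1 : S.localPart x (hS.fit hx a - Vbar) =
      S.localPart x (hS.fit hx b - Vbar) + hS.fit hx (a - b) := by
    have h2 : hS.fit hx a - Vbar = (hS.fit hx b - Vbar) + hS.fit hx (a - b) := by
      rw [fit_sub]; abel
    rw [h2, localPart, map_add, h0, localPart]
    abel
  have h2 : ⟪S.localPart x (hS.fit hx b - Vbar), hS.fit hx (a - b)⟫ = 0 := by
    have h3 := (Submodule.mem_orthogonal _ _).1
      (localPart_sub_mem (S := S) x (hS.fit hx b - Vbar)) _ hmem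
    rw [inner_sub_right, sub_eq_zero] at h3
    rw [real_inner_comm, h3, inner_fit]
    refine Finset.sum_eq_zero fun j _ => ?_
    rw [RKHS.coe_sub, Pi.sub_apply, fit_apply_center, hb]
    simp [target]
  have h3 := norm_add_sq_eq_norm_sq_add_norm_sq_of_inner_eq_zero _ _ h2
  rw [h1]
  simpa [sq] using h3

lemma Standing.idealWeights_eq (hS : S.Standing χ Vbar ζ) {x : E n} (hx : x ∈ χ) :
    S.idealWeights Vbar x = Ring.inverse (S.gram x) (hS.target hx) := by
  set b := Ring.inverse (S.gram x) (hS.target hx) with hb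
  have hgb : S.gram x b = hS.target hx := apply_ringInverse_apply (hS.gram_isUnit hx) _
  -- Existence of a minimizer makes the choice operator meaningful; Pythagoras then shows that the
  -- interpolant is the only minimizer.
  have hmin : ∃ a, IsMinOn (S.restrictedError Vbar x) univ a := by
    refine ⟨b, fun a _ => ?_⟩
    have h := hS.norm_localPart_sq hx hgb a
    simp only [mem_ofPred_eq]
    rw [hS.restrictedError_eq hx, hS.restrictedError_eq hx]
    exact abs_le_of_sq_le_sq' (by nlinarith [sq_nonneg ‖hS.fit hx (a - b)‖]) (norm_nonneg _) |>.2
  have hW : IsMinOn (S.restrictedError Vbar x) univ (S.idealWeights Vbar x) :=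
    Classical.epsilon_spec hmin
  have h1 : S.restrictedError Vbar x (S.idealWeights Vbar x) ≤ S.restrictedError Vbar x b :=
    hW (mem_univ b)
  have h := hS.norm_localPart_sq hx hgb (S.idealWeights Vbar x)
  rw [hS.restrictedError_eq hx, hS.restrictedError_eq hx] at h1
  by_contra hne
  have h2 := hS.norm_fit_pos hx (sub_ne_zero.2 hne)
  have h3 := pow_le_pow_left₀ (norm_nonneg _) h1 2
  linarith

lemma Standing.kernel_centers_contDiffAt (hS : S.Standing χ Vbar ζ) {x : E n} (hx : x ∈ χ)
    (i j : Fin L) : ContDiffAt ℝ 1 (fun x' => S.k (S.c x' i) (S.c x' j)) x := by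
  have hc := fun i => contDiffAt_pi.1 (hS.c_contDiff x hx) i
  exact (hS.kernel_contDiff _ (hS.c_mem x hx i).1 _ (hS.c_mem x hx j).1).comp x
    ((hc i).prodMk (hc j))

lemma Standing.gram_contDiffAt (hS : S.Standing χ Vbar ζ) {x : E n} (hx : x ∈ χ) :
    ContDiffAt ℝ 1 S.gram x := by
  unfold gram
  exact ContDiffAt.sum fun i _ => ContDiffAt.sum fun j _ =>
    (hS.kernel_centers_contDiffAt hx i j).smul contDiffAt_const

lemma Standing.idealWeights_contDiffAt (hS : S.Standing χ Vbar ζ) {x : E n}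
    (hx : x ∈ interior χ) : ContDiffAt ℝ 1 (S.idealWeights Vbar) x := by
  obtain ⟨F, hF, hFc⟩ := hS.Vbar_contDiff
  have hxχ := interior_subset hx
  have hb : ContDiffAt ℝ 1 (fun x' => (WithLp.toLp 2 fun i => F (S.c x' i) : E L)) x := by
    rw [contDiffAt_euclidean]
    exact fun i => (hFc _ (hS.c_mem x hxχ i).1).comp x (contDiffAt_pi.1 (hS.c_contDiff x hxχ) i)
  obtain ⟨U, hU⟩ := hS.gram_isUnit hxχ
  have hinv : ContDiffAt ℝ 1 (fun x' => Ring.inverse (S.gram x')) x := by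
    have := contDiffAt_ringInverse ℝ (n := 1) U
    rw [hU] at this
    exact this.comp x (hS.gram_contDiffAt hxχ)
  refine (hinv.clm_apply hb).congr_of_eventuallyEq ?_
  -- The closed form is available only on `χ`, so differentiability is obtained at interior points,
  -- where it holds on a neighbourhood.
  filter_upwards [isOpen_interior.mem_nhds hx] with x' hx'
  rw [hS.idealWeights_eq (interior_subset hx')]
  congr 2
  ext i
  exact (hF _).symm

end StaF.System

/-! ### Controlled trajectories and dynamic programming -/

namespace StaF

lemma locallyIntegrableOn_Ici_iff {F : Type*} [NormedAddCommGroup F] {u : ℝ → F} :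
    LocallyIntegrableOn u (Ici 0) ↔ ∀ b, 0 ≤ b → IntervalIntegrable u volume 0 b := by
  rw [locallyIntegrableOn_iff isClosed_Ici.isLocallyClosed]
  constructor
  · intro h b hb
    exact (intervalIntegrable_iff_integrableOn_Icc_of_le hb).2 (h _ Icc_subset_Ici_self isCompact_Icc)
  · intro h k hk hkc
    obtain ⟨b, hb⟩ := hkc.bddAbove
    have h1 := (intervalIntegrable_iff_integrableOn_Icc_of_le (le_max_left 0 b)).1
      (h (max 0 b) (le_max_left _ _))
    exact h1.mono_set fun t ht => ⟨hk ht, (hb ht).trans (le_max_right _ _)⟩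

lemma setLIntegral_Ioi_shift (F : ℝ → ℝ≥0∞) (h : ℝ) :
    ∫⁻ τ in Ioi h, F τ = ∫⁻ τ in Ioi 0, F (τ + h) := by
  rw [← lintegral_indicator measurableSet_Ioi, ← lintegral_indicator measurableSet_Ioi,
    ← lintegral_add_right_eq_self _ h]
  refine lintegral_congr fun τ => ?_
  simp [indicator_apply]

lemma setLIntegral_Ici_split (F : ℝ → ℝ≥0∞) {h : ℝ} (hh : 0 ≤ h) :
    ∫⁻ τ in Ici 0, F τ = (∫⁻ τ in Ioc 0 h, F τ) + ∫⁻ τ in Ici 0, F (τ + h) := by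
  rw [← setLIntegral_congr (Ioi_ae_eq_Ici (a := (0 : ℝ))),
    ← setLIntegral_congr (f := fun τ => F (τ + h)) (Ioi_ae_eq_Ici (a := (0 : ℝ))),
    ← setLIntegral_Ioi_shift, ← Ioc_union_Ioi_eq_Ioi hh,
    lintegral_union measurableSet_Ioi Ioc_disjoint_Ioi_same]

/-- Local solutions of an autonomous locally Lipschitz differential equation. -/
lemma exists_local_solution {V : Type*} [NormedAddCommGroup V] [NormedSpace ℝ V] [CompleteSpace V]
    {F : V → V} {x₀ : V} {K : NNReal} {s : Set V} (hs : s ∈ 𝓝 x₀) (hF : LipschitzOnWith K F s) :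
    ∃ α : ℝ → V, α 0 = x₀ ∧ ∃ ε > (0 : ℝ), ∀ t ∈ Ioo (-ε) ε, HasDerivAt α (F (α t)) t := by
  obtain ⟨a, ha, has⟩ := Metric.nhds_basis_closedBall.mem_iff.1 hs
  lift a to NNReal using ha.le
  -- A bound of the field on the ball of radius `a`; the summand `1` keeps it positive, so that the
  -- existence time `a / B` is positive.
  set B : NNReal := K * a + ‖F x₀‖₊ + 1 with hB
  have hb : ∀ x ∈ Metric.closedBall x₀ (a : ℝ), ‖F x‖ ≤ B := fun x hx => by
    have h1 := hF.dist_le_mul x (has hx) x₀ (mem_of_mem_nhds hs)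
    have h2 : ‖F x‖ ≤ dist (F x) (F x₀) + ‖F x₀‖ := by
      rw [dist_eq_norm]; exact norm_le_norm_sub_add _ _
    have h3 : (K : ℝ) * dist x x₀ ≤ K * a := by gcongr; exact hx
    simp only [hB, NNReal.coe_add, NNReal.coe_mul, coe_nnnorm, NNReal.coe_one]
    linarith
  have hB0 : (0 : ℝ) < B := by rw [hB]; positivity
  set ε : ℝ := a / B with hε
  have hε0 : 0 < ε := div_pos ha hB0
  have hpl : IsPicardLindelof (fun _ => F) (tmin := -ε) (tmax := ε)
      ⟨0, by simp [hε0.le]⟩ x₀ a 0 B K := by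
    refine IsPicardLindelof.of_time_independent hb (hF.mono has) ?_
    simp [hε]
    field_simp
    exact le_rfl
  obtain ⟨α, h0, hα⟩ := hpl.exists_eq_forall_mem_Icc_hasDerivWithinAt₀
  exact ⟨α, h0, ε, hε0, fun t ht => (hα t (Ioo_subset_Icc_self ht)).hasDerivAt
    (Icc_mem_nhds ht.1 ht.2)⟩

namespace System

variable {n m L N : ℕ} {S : System n m L N}
  {χ : Set (E n)} {H : Type*} [NormedAddCommGroup H] [InnerProductSpace ℝ H]
  [CompleteSpace H] [RKHS ℝ H χ ℝ] {Vbar : H} {ζ : ℝ}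

lemma Standing.Q_nonneg (hS : S.Standing χ Vbar ζ) (x : E n) : 0 ≤ S.Q x := by
  by_cases h : x = 0
  · rw [h, hS.Q_zero]
  · exact (hS.Q_pos x h).le

lemma Standing.cost_nonneg (hS : S.Standing χ Vbar ζ) (x : E n) (u : E m) : 0 ≤ S.cost x u :=
  add_nonneg (hS.Q_nonneg x) (hS.R_posDef.inner_nonneg u)

lemma Standing.velocity_intervalIntegrable (hS : S.Standing χ Vbar ζ) {φ : ℝ → E n}
    {u : ℝ → E m} {a b : ℝ} (hab : a ≤ b) (hφ : ContinuousOn φ (Icc a b))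
    (hu : IntervalIntegrable u volume a b) :
    IntervalIntegrable (fun τ => S.f (φ τ) + S.g (φ τ) (u τ)) volume a b := by
  have hg : ContinuousOn (fun τ => S.g (φ τ)) (Icc a b) :=
    hS.g_lipschitz.continuous.comp_continuousOn hφ
  have hf : ContinuousOn (fun τ => S.f (φ τ)) (Icc a b) :=
    hS.f_contDiff.continuous.comp_continuousOn hφ
  obtain ⟨C, hC⟩ := isCompact_Icc.exists_bound_of_continuousOn hg
  refine IntervalIntegrable.add (hf.intervalIntegrable_of_Icc hab) ?_
  rw [intervalIntegrable_iff_integrableOn_Icc_of_le hab] at hu ⊢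
  exact (ContinuousLinearMap.id ℝ (E m →L[ℝ] E n)).integrable_of_bilin_of_bdd_left C
    (hg.aestronglyMeasurable measurableSet_Icc)
    ((ae_restrict_iff' measurableSet_Icc).2 (ae_of_all _ hC)) hu

lemma IsControlled.intervalIntegrable {x₀ : E n} {φ : ℝ → E n} {u : ℝ → E m}
    (h : S.IsControlled x₀ φ u) {b : ℝ} (hb : 0 ≤ b) : IntervalIntegrable u volume 0 b :=
  locallyIntegrableOn_Ici_iff.1 h.1 b hb

lemma IsControlled.zero {x₀ : E n} {φ : ℝ → E n} {u : ℝ → E m}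
    (h : S.IsControlled x₀ φ u) : φ 0 = x₀ := by
  simpa using h.2.2 0 le_rfl

lemma Standing.isControlled_velocity_intervalIntegrable (hS : S.Standing χ Vbar ζ) {x₀ : E n}
    {φ : ℝ → E n} {u : ℝ → E m} (h : S.IsControlled x₀ φ u) {b : ℝ} (hb : 0 ≤ b) :
    IntervalIntegrable (fun τ => S.f (φ τ) + S.g (φ τ) (u τ)) volume 0 b :=
  hS.velocity_intervalIntegrable hb (h.2.1.mono Icc_subset_Ici_self) (h.intervalIntegrable hb)

lemma Standing.isControlled_shift (hS : S.Standing χ Vbar ζ) {x₀ : E n} {φ : ℝ → E n}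
    {u : ℝ → E m} (hc : S.IsControlled x₀ φ u) {h : ℝ} (hh : 0 ≤ h) :
    S.IsControlled (φ h) (fun t => φ (t + h)) (fun t => u (t + h)) := by
  refine ⟨locallyIntegrableOn_Ici_iff.2 fun b hb => ?_, ?_, fun t ht => ?_⟩
  · rw [IntervalIntegrable.comp_add_right_iff, zero_add]
    exact (hc.intervalIntegrable hh).symm.trans (hc.intervalIntegrable (by positivity))
  · refine hc.2.1.comp (by fun_prop) fun t ht => ?_
    exact add_nonneg ht hh
  · have hth : 0 ≤ t + h := add_nonneg ht hh
    beta_reduce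
    rw [hc.2.2 (t + h) hth, hc.2.2 h hh,
      intervalIntegral.integral_comp_add_right (fun τ => S.f (φ τ) + S.g (φ τ) (u τ)), zero_add,
      ← intervalIntegral.integral_interval_sub_left
        (hS.isControlled_velocity_intervalIntegrable hc hth)
        (hS.isControlled_velocity_intervalIntegrable hc hh)]
    abel

lemma totalCost_eq_add (φ : ℝ → E n) (u : ℝ → E m) {h : ℝ} (hh : 0 ≤ h) :
    S.totalCost φ u = (∫⁻ τ in Ioc 0 h, ENNReal.ofReal (S.cost (φ τ) (u τ))) +
      S.totalCost (fun t => φ (t + h)) (fun t => u (t + h)) :=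
  setLIntegral_Ici_split _ hh

lemma optCost_le {x₀ : E n} {φ : ℝ → E n} {u : ℝ → E m} (h : S.IsControlled x₀ φ u) :
    S.optCost x₀ ≤ S.totalCost φ u :=
  iInf_le_of_le φ (iInf_le_of_le u (iInf_le_of_le h le_rfl))

lemma Standing.optCost_ne_top (hS : S.Standing χ Vbar ζ) (x : E n) : S.optCost x ≠ ⊤ := by
  obtain ⟨φ, u, -, h1, h2⟩ := hS.optimal_exists x
  rwa [← h1]

/-- Along an optimal trajectory the cost spent up to time `h` and the optimal cost from the point
reached do not exceed the optimal cost. -/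
lemma Standing.optimal_dynamic_programming (hS : S.Standing χ Vbar ζ) {x₀ : E n} {φ : ℝ → E n}
    {u : ℝ → E m} (hc : S.IsControlled x₀ φ u) (hopt : S.totalCost φ u = S.optCost x₀)
    {h : ℝ} (hh : 0 ≤ h) :
    IntervalIntegrable (fun τ => S.cost (φ τ) (u τ)) volume 0 h ∧
      (∫ τ in (0 : ℝ)..h, S.cost (φ τ) (u τ)) + S.Vstar (φ h) ≤ S.Vstar x₀ := by
  have hle : (∫⁻ τ in Ioc 0 h, ENNReal.ofReal (S.cost (φ τ) (u τ))) + S.optCost (φ h) ≤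
      S.optCost x₀ := by
    rw [← hopt, totalCost_eq_add φ u hh]
    gcongr
    exact optCost_le (hS.isControlled_shift hc hh)
  -- Finiteness of the optimal cost is what makes the running cost integrable, as the control itself
  -- is only locally integrable.
  have hfin : (∫⁻ τ in Ioc 0 h, ENNReal.ofReal (S.cost (φ τ) (u τ))) ≠ ⊤ :=
    ne_top_of_le_ne_top (hS.optCost_ne_top x₀) (le_self_add.trans hle)
  have hum : AEStronglyMeasurable u (volume.restrict (Ioc 0 h)) :=
    (hc.intervalIntegrable hh).aestronglyMeasurable
  have hφm : AEStronglyMeasurable φ (volume.restrict (Ioc 0 h)) :=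
    (hc.2.1.mono (Ioc_subset_Icc_self.trans Icc_subset_Ici_self)).aestronglyMeasurable
      measurableSet_Ioc
  have hm : AEStronglyMeasurable (fun τ => S.cost (φ τ) (u τ)) (volume.restrict (Ioc 0 h)) :=
    (hS.Q_cont.comp_aestronglyMeasurable hφm).add
      (hum.inner (S.R.continuous.comp_aestronglyMeasurable hum))
  have h0 : 0 ≤ᵐ[volume.restrict (Ioc 0 h)] fun τ => S.cost (φ τ) (u τ) :=
    ae_of_all _ fun τ => hS.cost_nonneg _ _
  have hint : IntegrableOn (fun τ => S.cost (φ τ) (u τ)) (Ioc 0 h) volume :=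
    (lintegral_ofReal_ne_top_iff_integrable hm h0).1 hfin
  refine ⟨(intervalIntegrable_iff_integrableOn_Ioc_of_le hh).2 hint, ?_⟩
  have h1 := ENNReal.toReal_mono (hS.optCost_ne_top x₀) hle
  rw [ENNReal.toReal_add hfin (hS.optCost_ne_top _)] at h1
  rw [intervalIntegral.integral_of_le hh, integral_eq_lintegral_of_nonneg_ae h0 hm]
  exact h1

/-- The optimal cost does not exceed the cost of a control on `[0, h]` followed by an optimal
control. -/
lemma Standing.Vstar_le_add (hS : S.Standing χ Vbar ζ) {x₀ : E n} {φ : ℝ → E n} {v : E m}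
    {h : ℝ} (hh : 0 ≤ h) (hφ : ContinuousOn φ (Icc 0 h))
    (hφi : ∀ t ∈ Icc 0 h, φ t = x₀ + ∫ τ in (0 : ℝ)..t, (S.f (φ τ) + S.g (φ τ) v)) :
    S.Vstar x₀ ≤ (∫ τ in (0 : ℝ)..h, S.cost (φ τ) v) + S.Vstar (φ h) := by
  obtain ⟨ψ, w, hψ, hopt, -⟩ := hS.optimal_exists (φ h)
  set φ' : ℝ → E n := fun t => if t ≤ h then φ t else ψ (t - h) with hφ'
  set u' : ℝ → E m := fun t => if t ≤ h then v else w (t - h) with hu'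
  have hle : ∀ t, t ≤ h → φ' t = φ t ∧ u' t = v := fun t ht => by simp [hφ', hu', ht]
  have hgt : ∀ t, h < t → φ' t = ψ (t - h) ∧ u' t = w (t - h) := fun t ht => by
    simp [hφ', hu', ht]
  have hge : ∀ t, h ≤ t → φ' t = ψ (t - h) := fun t ht => by
    rcases ht.eq_or_lt with rfl | ht
    · rw [(hle _ le_rfl).1, sub_self, hψ.zero]
    · exact (hgt t ht).1
  have hcont : ContinuousOn φ' (Ici 0) := by
    have h1 : ContinuousOn φ' (Icc 0 h) := hφ.congr fun t ht => (hle t ht.2).1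
    have h2 : ContinuousOn φ' (Ici h) := by
      refine ContinuousOn.congr (f := fun t => ψ (t - h)) ?_ fun t ht => hge t ht
      exact hψ.2.1.comp (by fun_prop) fun t ht => mem_Ici.2 (sub_nonneg.2 ht)
    rw [← Icc_union_Ici_eq_Ici hh]
    exact h1.union_of_isClosed h2 isClosed_Icc isClosed_Ici
  have hint1 : ∀ t, t ≤ h → IntervalIntegrable u' volume 0 t ∨ t < 0 := fun t ht => by
    by_cases h0 : t < 0
    · exact Or.inr h0
    · refine Or.inl ((intervalIntegrable_const (c := v)).congr fun τ hτ => ?_)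
      rw [uIoc_of_le (not_lt.1 h0)] at hτ
      exact ((hle τ (hτ.2.trans ht)).2).symm
  have hint2 : ∀ t, h ≤ t → IntervalIntegrable u' volume h t := fun t ht => by
    have h1 : IntervalIntegrable (fun τ => w (τ - h)) volume h t := by
      have := (hψ.intervalIntegrable (sub_nonneg.2 ht)).comp_sub_right h
      simpa using this
    refine h1.congr fun τ hτ => ?_
    rw [uIoc_of_le ht] at hτ
    exact ((hgt τ hτ.1).2).symm
  have hu'int : ∀ b, 0 ≤ b → IntervalIntegrable u' volume 0 b := fun b hb => by
    rcases le_total b h with hbh | hbh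
    · exact (hint1 b hbh).resolve_right (not_lt.2 hb)
    · exact ((hint1 h le_rfl).resolve_right (not_lt.2 hh)).trans (hint2 b hbh)
  have hsmall : ∀ t, 0 ≤ t → t ≤ h → φ' t = x₀ + ∫ τ in (0 : ℝ)..t,
      (S.f (φ' τ) + S.g (φ' τ) (u' τ)) := fun t h0 ht => by
    rw [(hle t ht).1, hφi t ⟨h0, ht⟩]
    congr 1
    refine intervalIntegral.integral_congr_Ioo_of_le h0 fun τ hτ => ?_
    have := hle τ (hτ.2.le.trans ht)
    simp only [this.1, this.2]
  have hvel : ∀ b, 0 ≤ b →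
      IntervalIntegrable (fun τ => S.f (φ' τ) + S.g (φ' τ) (u' τ)) volume 0 b := fun b hb =>
    hS.velocity_intervalIntegrable hb (hcont.mono Icc_subset_Ici_self) (hu'int b hb)
  have hctrl : S.IsControlled x₀ φ' u' := by
    refine ⟨locallyIntegrableOn_Ici_iff.2 hu'int, hcont, fun t ht => ?_⟩
    rcases le_total t h with hth | hth
    · exact hsmall t ht hth
    · rw [← intervalIntegral.integral_add_adjacent_intervals (hvel h hh)
        ((hvel h hh).symm.trans (hvel t ht)), ← add_assoc, ← hsmall h hh le_rfl, hge t hth,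
        hψ.2.2 (t - h) (sub_nonneg.2 hth), (hle h le_rfl).1]
      congr 1
      have h1 := intervalIntegral.integral_comp_sub_right (a := h) (b := t)
        (fun τ => S.f (ψ τ) + S.g (ψ τ) (w τ)) h
      rw [sub_self] at h1
      rw [← h1]
      refine intervalIntegral.integral_congr_Ioo_of_le hth fun τ hτ => ?_
      have := hgt τ hτ.1
      simp only [this.1, this.2]
  have hcostc : ContinuousOn (fun τ => S.cost (φ τ) v) (Icc 0 h) :=
    (hS.Q_cont.comp_continuousOn hφ).add continuousOn_const
  have h1 : S.optCost x₀ ≤ ENNReal.ofReal (∫ τ in (0 : ℝ)..h, S.cost (φ τ) v) +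
      S.optCost (φ h) := by
    refine (optCost_le hctrl).trans (le_of_eq ?_)
    rw [totalCost_eq_add φ' u' hh, ← hopt, intervalIntegral.integral_of_le hh,
      ofReal_integral_eq_lintegral_ofReal
        ((intervalIntegrable_iff_integrableOn_Ioc_of_le hh).1 (hcostc.intervalIntegrable_of_Icc hh))
        (ae_of_all _ fun τ => hS.cost_nonneg _ _)]
    congr 1
    · refine setLIntegral_congr_fun measurableSet_Ioc fun τ hτ => ?_
      simp only [(hle τ hτ.2).1, (hle τ hτ.2).2]
    · rw [totalCost, totalCost, ← setLIntegral_congr (Ioi_ae_eq_Ici (a := (0 : ℝ))),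
        ← setLIntegral_congr (Ioi_ae_eq_Ici (a := (0 : ℝ)))]
      refine setLIntegral_congr_fun measurableSet_Ioi fun τ hτ => ?_
      have := hgt (τ + h) (lt_add_of_pos_left h hτ)
      simp only [this.1, this.2, add_sub_cancel_right]
  have h0 : 0 ≤ ∫ τ in (0 : ℝ)..h, S.cost (φ τ) v :=
    intervalIntegral.integral_nonneg hh fun τ _ => hS.cost_nonneg _ _
  have h2 := ENNReal.toReal_mono (ENNReal.add_ne_top.2 ⟨ENNReal.ofReal_ne_top,
    hS.optCost_ne_top _⟩) h1
  rwa [ENNReal.toReal_add ENNReal.ofReal_ne_top (hS.optCost_ne_top _),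
    ENNReal.toReal_ofReal h0] at h2

end System

end StaF

/-! ### The Hamilton–Jacobi–Bellman equation -/

namespace StaF.System

variable {n m L N : ℕ} {S : System n m L N}
  {χ : Set (E n)} {H : Type*} [NormedAddCommGroup H] [InnerProductSpace ℝ H]
  [CompleteSpace H] [RKHS ℝ H χ ℝ] {Vbar : H} {ζ : ℝ}

lemma inner_gradient (V : E n → ℝ) (x v : E n) : ⟪gradient V x, v⟫ = fderiv ℝ V x v := by
  rw [gradient, InnerProductSpace.toDual_symm_apply]

lemma Standing.Vstar_hasFDerivAt (hS : S.Standing χ Vbar ζ) (x : E n) :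
    HasFDerivAt S.Vstar (fderiv ℝ S.Vstar x) x :=
  ((hS.Vstar_contDiff.differentiable one_ne_zero) x).hasFDerivAt

lemma Standing.G_continuous (hS : S.Standing χ Vbar ζ) : Continuous S.G := by
  have hg := hS.g_lipschitz.continuous
  have ha : Continuous fun y => ContinuousLinearMap.adjoint (S.g y) :=
    ContinuousLinearMap.adjoint.continuous.comp hg
  exact hg.clm_comp (continuous_const.clm_comp ha)

lemma inner_G (y p q : E n) : ⟪p, S.G y q⟫ = ⟪ContinuousLinearMap.adjoint (S.g y) p,
    Ring.inverse S.R (ContinuousLinearMap.adjoint (S.g y) q)⟫ := by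
  simp [G, ContinuousLinearMap.adjoint_inner_left]

/-- Applying the constant control `v` for a short time `h` and an optimal control afterwards costs
at least `V*(x₀)`. So `θ` is minimal at `h = 0` among small `h ≥ 0`, and its derivative there is the
Hamiltonian. -/
lemma Standing.hamiltonian_nonneg (hS : S.Standing χ Vbar ζ) (x₀ : E n) (v : E m) :
    0 ≤ S.cost x₀ v + ⟪gradient S.Vstar x₀, S.f x₀ + S.g x₀ v⟫ := by
  obtain ⟨K₁, s₁, hs₁, hl₁⟩ := (hS.f_contDiff.contDiffAt (x := x₀)).exists_lipschitzOnWith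
  obtain ⟨K₂, s₂, hs₂, hl₂⟩ := hS.g_lipschitz x₀
  have hl₃ := (ContinuousLinearMap.apply ℝ (E n) v).lipschitz.comp_lipschitzOnWith hl₂
  have hl := (hl₁.mono inter_subset_left).add (hl₃.mono (inter_subset_right (s := s₁)))
  obtain ⟨α, h0, ε, hε, hα⟩ := exists_local_solution (inter_mem hs₁ hs₂) hl
  have hα' : ∀ t ∈ Ioo (-ε) ε, HasDerivAt α (S.f (α t) + S.g (α t) v) t := hα
  have hαc : ContinuousOn α (Ioo (-ε) ε) := fun t ht =>
    (hα t ht).continuousAt.continuousWithinAt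
  have hFc : ContinuousOn (fun τ => S.f (α τ) + S.g (α τ) v) (Ioo (-ε) ε) :=
    (hS.f_contDiff.continuous.comp_continuousOn hαc).add
      ((hS.g_lipschitz.continuous.comp_continuousOn hαc).clm_apply continuousOn_const)
  have hcc : ContinuousOn (fun τ => S.cost (α τ) v) (Ioo (-ε) ε) :=
    (hS.Q_cont.comp_continuousOn hαc).add continuousOn_const
  set θ : ℝ → ℝ := fun h => (∫ τ in (0 : ℝ)..h, S.cost (α τ) v) + S.Vstar (α h) with hθ
  have hsub : ∀ h ∈ Ico 0 ε, Icc 0 h ⊆ Ioo (-ε) ε := fun h hh t ht =>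
    ⟨by linarith [ht.1], ht.2.trans_lt hh.2⟩
  have hθ0 : ∀ h ∈ Ico 0 ε, θ 0 ≤ θ h := fun h hh => by
    have := hS.Vstar_le_add (x₀ := x₀) hh.1 (hαc.mono (hsub h hh)) (v := v) fun t ht => by
      rw [intervalIntegral.integral_eq_sub_of_hasDerivAt (f := α), h0]
      · abel
      · intro τ hτ
        rw [uIcc_of_le ht.1] at hτ
        exact hα' τ (hsub h hh ⟨hτ.1, hτ.2.trans ht.2⟩)
      · exact ContinuousOn.intervalIntegrable_of_Icc ht.1
          (hFc.mono ((Icc_subset_Icc_right ht.2).trans (hsub h hh)))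
    simpa [hθ, h0] using this
  have h0mem : (0 : ℝ) ∈ Ioo (-ε) ε := ⟨by linarith, hε⟩
  have hd : HasDerivAt θ (S.cost x₀ v + ⟪gradient S.Vstar x₀, S.f x₀ + S.g x₀ v⟫) 0 := by
    have h1 : HasDerivAt (fun h => ∫ τ in (0 : ℝ)..h, S.cost (α τ) v) (S.cost (α 0) v) 0 :=
      intervalIntegral.integral_hasDerivAt_right (by simp)
        (hcc.stronglyMeasurableAtFilter isOpen_Ioo 0 h0mem)
        (hcc.continuousAt (isOpen_Ioo.mem_nhds h0mem))
    have h2 := (hS.Vstar_hasFDerivAt (α 0)).comp_hasDerivAt 0 (hα' 0 h0mem)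
    rw [h0] at h1 h2
    rw [inner_gradient]
    exact h1.add h2
  have hs := (hasDerivWithinAt_iff_tendsto_slope' (self_notMem_Ioi (a := (0 : ℝ)))).1
    hd.hasDerivWithinAt
  refine ge_of_tendsto hs ?_
  filter_upwards [Ioo_mem_nhdsGT hε] with h hh
  rw [slope_def_field]
  exact div_nonneg (sub_nonneg.2 (hθ0 h ⟨hh.1.le, hh.2⟩)) (by linarith [hh.1])

/-- A lower bound of the perturbed Hamiltonian over all controls. -/
noncomputable def hamiltonianBound (S : System n m L N) (p : E n) (μ ε : ℝ) (y : E n) : ℝ :=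
  S.Q y + ⟪p, S.f y⟫ - 1 / (4 * (1 - ε)) * ⟪p, S.G y p⟫ - ε * (‖S.f y‖ + ‖S.g y‖ ^ 2 / (4 * μ))

/-- The control cost is split: the share `1 - ε` completes the square against the linear term in
`u`, and by coercivity of `R` the share `ε` pays for the part of `ε ‖velocity‖` that depends on `u`.
-/
lemma Standing.hamiltonianBound_le (hS : S.Standing χ Vbar ζ) {μ ε : ℝ} (hμ : 0 < μ)
    (hR : ∀ u, μ * ‖u‖ ^ 2 ≤ ⟪u, S.R u⟫) (hε0 : 0 < ε) (hε1 : ε < 1) (p y : E n) (u : E m) :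
    S.hamiltonianBound p μ ε y ≤
      S.cost y u + ⟪p, S.f y + S.g y u⟫ - ε * ‖S.f y + S.g y u‖ := by
  have h1 := hS.R_posDef.neg_inner_inverse_le (sub_pos.2 hε1)
    (ContinuousLinearMap.adjoint (S.g y) p) u
  rw [← inner_G, ContinuousLinearMap.adjoint_inner_left] at h1
  have h2 : ‖S.f y + S.g y u‖ ≤ ‖S.f y‖ + ‖S.g y‖ * ‖u‖ :=
    (norm_add_le _ _).trans (by gcongr; exact (S.g y).le_opNorm u)
  have h3 : ‖S.g y‖ * ‖u‖ ≤ μ * ‖u‖ ^ 2 + ‖S.g y‖ ^ 2 / (4 * μ) := by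
    have h : μ * ‖u‖ ^ 2 + ‖S.g y‖ ^ 2 / (4 * μ) - ‖S.g y‖ * ‖u‖ =
        (2 * μ * ‖u‖ - ‖S.g y‖) ^ 2 / (4 * μ) := by field_simp; ring
    have : 0 ≤ (2 * μ * ‖u‖ - ‖S.g y‖) ^ 2 / (4 * μ) := by positivity
    linarith
  have h4 := hR u
  have h5 : ε * ‖S.f y + S.g y u‖ ≤
      ε * (‖S.f y‖ + (⟪u, S.R u⟫ + ‖S.g y‖ ^ 2 / (4 * μ))) := by
    gcongr; linarith
  rw [hamiltonianBound, cost, inner_add_right]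
  linarith

/-- The optimal control may have no limit at time zero, so the Hamiltonian is replaced by a
continuous bound free of `u`. Were it positive at `x₀`, its integral along a short optimal arc would
be positive. The term `ε ∫ ‖velocity‖` absorbs the linearization error of `V*`, and dynamic
programming is contradicted. -/
lemma Standing.hamiltonianBound_nonpos (hS : S.Standing χ Vbar ζ) {μ ε : ℝ} (hμ : 0 < μ)
    (hR : ∀ u, μ * ‖u‖ ^ 2 ≤ ⟪u, S.R u⟫) (hε0 : 0 < ε) (hε1 : ε < 1) (x₀ : E n) :
    S.hamiltonianBound (gradient S.Vstar x₀) μ ε x₀ ≤ 0 := by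
  by_contra! hpos
  set p := gradient S.Vstar x₀ with hp
  obtain ⟨φ, u, hc, hopt, -⟩ := hS.optimal_exists x₀
  have hbc : Continuous (S.hamiltonianBound p μ ε) := by
    have h1 := hS.Q_cont
    have h2 := hS.f_contDiff.continuous
    have h3 := hS.G_continuous
    have h4 := hS.g_lipschitz.continuous
    unfold hamiltonianBound
    fun_prop
  have hφ0 : Tendsto φ (𝓝[≥] 0) (𝓝 x₀) := by
    have := hc.2.1 0 self_mem_Ici
    rwa [ContinuousWithinAt, hc.zero] at this
  have hev : ∀ᶠ y in 𝓝 x₀, 0 < S.hamiltonianBound p μ ε y ∧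
      ‖S.Vstar y - S.Vstar x₀ - ⟪p, y - x₀⟫‖ ≤ ε * ‖y - x₀‖ := by
    refine (hbc.continuousAt.eventually (lt_mem_nhds hpos)).and ?_
    have := (hS.Vstar_hasFDerivAt x₀).isLittleO.def hε0
    simpa only [hp, inner_gradient] using this
  obtain ⟨h, hh0, hh⟩ := mem_nhdsGE_iff_exists_Icc_subset.1 (hφ0.eventually hev)
  have hh0 : 0 < h := hh0
  have hle := hh0.le
  obtain ⟨hci, hdp⟩ := hS.optimal_dynamic_programming hc hopt hle
  have hvi := hS.isControlled_velocity_intervalIntegrable hc hle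
  set F : ℝ → E n := fun τ => S.f (φ τ) + S.g (φ τ) (u τ) with hF
  have hφh : φ h - x₀ = ∫ τ in (0 : ℝ)..h, F τ := by rw [hc.2.2 h hle]; abel
  have hpi : IntervalIntegrable (fun τ => ⟪p, F τ⟫) volume 0 h :=
    ⟨(innerSL ℝ p).integrable_comp hvi.1, (innerSL ℝ p).integrable_comp hvi.2⟩
  have hinner : ⟪p, φ h - x₀⟫ = ∫ τ in (0 : ℝ)..h, ⟪p, F τ⟫ := by
    rw [hφh]
    exact ((innerSL ℝ p).intervalIntegral_comp_comm hvi).symm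
  have hnorm : ‖φ h - x₀‖ ≤ ∫ τ in (0 : ℝ)..h, ‖F τ‖ := by
    rw [hφh]
    exact intervalIntegral.norm_integral_le_integral_norm hle
  have hφc : ContinuousOn φ (Icc 0 h) := hc.2.1.mono Icc_subset_Ici_self
  have hbi : IntervalIntegrable (fun τ => S.hamiltonianBound p μ ε (φ τ)) volume 0 h :=
    (hbc.comp_continuousOn hφc).intervalIntegrable_of_Icc hle
  have h1 : 0 < ∫ τ in (0 : ℝ)..h, S.hamiltonianBound p μ ε (φ τ) :=
    intervalIntegral.intervalIntegral_pos_of_pos_on hbi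
      (fun τ hτ => (hh (Ioo_subset_Icc_self hτ)).1) hh0
  have h2 : ∫ τ in (0 : ℝ)..h, S.hamiltonianBound p μ ε (φ τ) ≤
      ∫ τ in (0 : ℝ)..h, (S.cost (φ τ) (u τ) + ⟪p, F τ⟫ - ε * ‖F τ‖) :=
    intervalIntegral.integral_mono_on hle hbi ((hci.add hpi).sub (hvi.norm.const_mul ε))
      fun τ _ => hS.hamiltonianBound_le hμ hR hε0 hε1 p (φ τ) (u τ)
  rw [intervalIntegral.integral_sub (hci.add hpi) (hvi.norm.const_mul ε),
    intervalIntegral.integral_add hci hpi, intervalIntegral.integral_const_mul, ← hinner] at h2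
  have h3 := (abs_le.1 ((Real.norm_eq_abs _).symm.trans_le (hh (right_mem_Icc.2 hle)).2)).1
  have h4 : ε * ‖φ h - x₀‖ ≤ ε * ∫ τ in (0 : ℝ)..h, ‖F τ‖ := by gcongr
  linarith

/-- The Hamilton–Jacobi–Bellman equation. -/
theorem Standing.hamilton_jacobi_bellman (hS : S.Standing χ Vbar ζ) (y : E n) :
    S.Q y + ⟪gradient S.Vstar y, S.f y⟫ -
      1 / 4 * ⟪gradient S.Vstar y, S.G y (gradient S.Vstar y)⟫ = 0 := by
  set p := gradient S.Vstar y with hp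
  refine le_antisymm ?_ ?_
  · obtain ⟨μ, hμ, hR⟩ := hS.R_posDef.exists_coercive
    -- Letting `ε` decrease to zero recovers the unperturbed minimum of the Hamiltonian.
    have hc : ContinuousAt (fun ε => S.hamiltonianBound p μ ε y) 0 := by
      unfold hamiltonianBound
      have : ContinuousAt (fun ε : ℝ => 1 / (4 * (1 - ε))) 0 :=
        ContinuousAt.div (by fun_prop) (by fun_prop) (by norm_num)
      fun_prop
    have ht : Tendsto (fun ε => S.hamiltonianBound p μ ε y) (𝓝[>] 0)
        (𝓝 (S.hamiltonianBound p μ 0 y)) := hc.tendsto.mono_left nhdsWithin_le_nhds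
    have h := le_of_tendsto ht (by
      filter_upwards [Ioo_mem_nhdsGT (one_pos : (0 : ℝ) < 1)] with ε hε
      exact hS.hamiltonianBound_nonpos hμ hR hε.1 hε.2 y)
    simpa [hamiltonianBound] using h
  -- The control inserted here minimizes the Hamiltonian.
  · have h := hS.hamiltonian_nonneg y (-(1 / 2 : ℝ) • Ring.inverse S.R
      (ContinuousLinearMap.adjoint (S.g y) p))
    have h1 : ⟪p, S.g y (Ring.inverse S.R (ContinuousLinearMap.adjoint (S.g y) p))⟫ =
      ⟪p, S.G y p⟫ := rfl
    have h2 : ⟪Ring.inverse S.R (ContinuousLinearMap.adjoint (S.g y) p),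
        ContinuousLinearMap.adjoint (S.g y) p⟫ = ⟪p, S.G y p⟫ := by
      rw [inner_G, real_inner_comm]
    simp only [cost, map_smul, inner_smul_left, inner_smul_right, inner_add_right,
      apply_ringInverse_apply hS.R_posDef.isUnit, ← hp, h1, h2, conj_trivial] at h
    linarith

end StaF.System

/-! ### Continuity on compact sets and finiteness of the suprema -/

namespace StaF.System

variable {n m L N : ℕ} {S : System n m L N}
  {χ : Set (E n)} {H : Type*} [NormedAddCommGroup H] [InnerProductSpace ℝ H]
  [CompleteSpace H] [RKHS ℝ H χ ℝ] {Vbar : H} {ζ : ℝ}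

/-- The pairs of an evaluation point and a state. -/
def evalSet (S : System n m L N) (ζ : ℝ) : Set (E n × E n) :=
  {p | p.2 ∈ Metric.closedBall 0 ζ ∧ p.1 ∈ Metric.closedBall p.2 S.r}

lemma isCompact_evalSet (S : System n m L N) (ζ : ℝ) : IsCompact (S.evalSet ζ) := by
  have h : S.evalSet ζ ⊆ Metric.closedBall 0 (ζ + S.r) ×ˢ Metric.closedBall 0 ζ := by
    rintro ⟨y, x⟩ ⟨hx, hy⟩
    refine ⟨?_, hx⟩
    simp only [Metric.mem_closedBall] at hx hy ⊢
    linarith [dist_triangle y x 0]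
  refine ((isCompact_closedBall _ _).prod (isCompact_closedBall _ _)).of_isClosed_subset ?_ h
  simp only [evalSet, Metric.mem_closedBall]
  exact (isClosed_le (f := fun p : E n × E n => dist p.2 0) (by fun_prop) continuous_const).inter
    (isClosed_le (f := fun p : E n × E n => dist p.1 p.2) (by fun_prop) continuous_const)

lemma Standing.evalSet_fst_mem (hS : S.Standing χ Vbar ζ) {p : E n × E n}
    (hp : p ∈ S.evalSet ζ) : p.1 ∈ χ :=
  hS.ball_subset p.2 hp.1 hp.2

lemma Standing.mem_interior (hS : S.Standing χ Vbar ζ) {x : E n}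
    (hx : x ∈ Metric.closedBall (0 : E n) ζ) : x ∈ interior χ :=
  mem_interior_iff_mem_nhds.2
    (mem_of_superset (Metric.closedBall_mem_nhds x hS.r_pos) (hS.ball_subset x hx))

lemma Standing.mem_of_mem_closedBall (hS : S.Standing χ Vbar ζ) {x : E n}
    (hx : x ∈ Metric.closedBall (0 : E n) ζ) : x ∈ χ :=
  interior_subset (hS.mem_interior hx)

lemma Standing.diag_mem_evalSet (hS : S.Standing χ Vbar ζ) {x : E n}
    (hx : x ∈ Metric.closedBall (0 : E n) ζ) : (x, x) ∈ S.evalSet ζ :=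
  ⟨hx, Metric.mem_closedBall_self hS.r_pos.le⟩

lemma Standing.sigma_contDiffAt (hS : S.Standing χ Vbar ζ) {y x : E n} (hy : y ∈ χ)
    (hx : x ∈ χ) : ContDiffAt ℝ 1 (fun p : E n × E n => S.sigma p.1 (S.c p.2)) (y, x) := by
  rw [contDiffAt_euclidean]
  intro j
  have h1 : ContDiffAt ℝ 1 (fun p : E n × E n => (p.1, S.c p.2 j)) (y, x) :=
    contDiffAt_fst.prodMk
      (ContDiffAt.comp (y, x) (contDiffAt_pi.1 (hS.c_contDiff x hx) j) contDiffAt_snd)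
  exact ContDiffAt.comp (y, x) (hS.kernel_contDiff y hy _ (hS.c_mem x hx j).1) h1

lemma Standing.sigma_hasFDerivAt (hS : S.Standing χ Vbar ζ) {y x : E n} (hy : y ∈ χ)
    (hx : x ∈ χ) : HasFDerivAt (fun y' => S.sigma y' (S.c x)) (S.gradSigma y x) y := by
  have h : ContDiffAt ℝ 1 (fun y' => S.sigma y' (S.c x)) y :=
    ContDiffAt.comp (g := fun p : E n × E n => S.sigma p.1 (S.c p.2))
      (f := fun y' => (y', x)) y (hS.sigma_contDiffAt hy hx) (contDiffAt_id.prodMk contDiffAt_const)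
  exact (h.differentiableAt one_ne_zero).hasFDerivAt

/-- The derivative is taken in an auxiliary variable `y'`, with `(y, x)` as parameter, and evaluated
at `y' = y`; joint differentiability of the kernel and the centers makes it continuous. -/
lemma Standing.gradSigma_continuousAt (hS : S.Standing χ Vbar ζ) {y x : E n} (hy : y ∈ χ)
    (hx : x ∈ χ) : ContinuousAt (fun p : E n × E n => S.gradSigma p.1 p.2) (y, x) := by
  have h : ContDiffAt ℝ 1 (Function.uncurry fun (p : E n × E n) (y' : E n) =>
      S.sigma y' (S.c p.2)) ((y, x), y) := by
    have h2 : ContDiffAt ℝ 1 (fun q : (E n × E n) × E n => (q.2, q.1.2)) ((y, x), y) :=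
      contDiffAt_snd.prodMk (contDiffAt_snd.comp _ contDiffAt_fst)
    exact ContDiffAt.comp (g := fun p : E n × E n => S.sigma p.1 (S.c p.2)) ((y, x), y)
      (hS.sigma_contDiffAt hy hx) h2
  exact (ContDiffAt.fderiv (m := 0) (x₀ := (y, x)) (g := Prod.fst) h contDiffAt_fst
    (by norm_num)).continuousAt

lemma Standing.gradSigma_continuousOn (hS : S.Standing χ Vbar ζ) :
    ContinuousOn (fun p : E n × E n => S.gradSigma p.1 p.2) (S.evalSet ζ) := fun _ hp =>
  (hS.gradSigma_continuousAt (hS.evalSet_fst_mem hp)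
    (hS.mem_of_mem_closedBall hp.1)).continuousWithinAt

lemma Standing.Gsigma_continuousOn (hS : S.Standing χ Vbar ζ) :
    ContinuousOn (fun p : E n × E n => S.Gsigma p.1 p.2) (S.evalSet ζ) := by
  have h1 := hS.gradSigma_continuousOn
  have h2 : ContinuousOn (fun p : E n × E n => ContinuousLinearMap.adjoint (S.gradSigma p.1 p.2))
      (S.evalSet ζ) := ContinuousLinearMap.adjoint.continuous.comp_continuousOn h1
  have h3 : ContinuousOn (fun p : E n × E n => S.G p.1) (S.evalSet ζ) :=
    (hS.G_continuous.comp continuous_fst).continuousOn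
  exact h1.clm_comp (h3.clm_comp h2)

lemma Standing.gradient_Vstar_continuous (hS : S.Standing χ Vbar ζ) :
    Continuous (gradient S.Vstar) :=
  (InnerProductSpace.toDual ℝ (E n)).symm.continuous.comp
    (hS.Vstar_contDiff.continuous_fderiv one_ne_zero)

variable {W : E n → E L}

lemma Standing.gradEps_eq (hS : S.Standing χ Vbar ζ) {y x : E n} (hy : y ∈ χ) (hx : x ∈ χ) :
    S.gradEps W y x = gradient S.Vstar y -
      ContinuousLinearMap.adjoint (S.gradSigma y x) (W x) := by
  refine ext_inner_right ℝ fun v => ?_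
  have h1 := (hS.Vstar_hasFDerivAt y).sub
    (((hasFDerivAt_const (W x) y).inner ℝ (hS.sigma_hasFDerivAt hy hx)))
  rw [gradEps, inner_gradient, inner_sub_left, inner_gradient,
    ContinuousLinearMap.adjoint_inner_left]
  erw [h1.fderiv]
  simp

lemma Standing.gradEps_continuousOn (hS : S.Standing χ Vbar ζ)
    (hW : ∀ x ∈ Metric.closedBall (0 : E n) ζ, ContDiffAt ℝ 1 W x) :
    ContinuousOn (fun p : E n × E n => S.gradEps W p.1 p.2) (S.evalSet ζ) := by
  have h1 : ContinuousOn (fun p : E n × E n => W p.2) (S.evalSet ζ) := fun p hp =>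
    (ContinuousAt.comp (f := Prod.snd) (hW p.2 hp.1).continuousAt
      continuousAt_snd).continuousWithinAt
  have h2 : ContinuousOn (fun p : E n × E n => ContinuousLinearMap.adjoint (S.gradSigma p.1 p.2))
      (S.evalSet ζ) :=
    ContinuousLinearMap.adjoint.continuous.comp_continuousOn hS.gradSigma_continuousOn
  have h3 : ContinuousOn (fun p : E n × E n => gradient S.Vstar p.1) (S.evalSet ζ) :=
    (hS.gradient_Vstar_continuous.comp continuous_fst).continuousOn
  refine (h3.sub (h2.clm_apply h1)).congr fun p hp => ?_
  exact hS.gradEps_eq (hS.evalSet_fst_mem hp) (hS.mem_of_mem_closedBall hp.1)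

lemma le_supState {h : E n → ℝ} (hc : ContinuousOn h (Metric.closedBall 0 ζ)) {x : E n}
    (hx : x ∈ Metric.closedBall (0 : E n) ζ) : h x ≤ supState ζ h :=
  le_csSup ((isCompact_closedBall _ _).bddAbove_image hc) (mem_image_of_mem h hx)

/-- `y` is a point at which the Bellman error is evaluated for the state `x`. -/
def IsEvalPoint (S : System n m L N) (y x : E n) : Prop :=
  y = x ∨ ∃ i, ∃ t, 0 ≤ t ∧ y = S.xi i x t

lemma Standing.mem_evalSet (hS : S.Standing χ Vbar ζ) {y x : E n}
    (hx : x ∈ Metric.closedBall (0 : E n) ζ) (hy : S.IsEvalPoint y x) : (y, x) ∈ S.evalSet ζ := by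
  rcases hy with rfl | ⟨i, t, ht, rfl⟩
  · exact hS.diag_mem_evalSet hx
  · exact ⟨hx, hS.xi_mem i x hx t ht⟩

/-- The extrapolation functions need not be continuous, so boundedness comes from the larger compact
set `evalSet`. It rules out the default value of `sSup` on unbounded sets. -/
lemma Standing.le_supEval (hS : S.Standing χ Vbar ζ) {h : E n → E n → ℝ}
    (hc : ContinuousOn (fun p : E n × E n => h p.1 p.2) (S.evalSet ζ)) {y x : E n}
    (hx : x ∈ Metric.closedBall (0 : E n) ζ) (hy : S.IsEvalPoint y x) :
    h y x ≤ S.supEval ζ h := by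
  refine le_csSup (((isCompact_evalSet S ζ).bddAbove_image hc).mono ?_) ⟨x, hx, y, hy, rfl⟩
  rintro _ ⟨x', hx', y', hy', rfl⟩
  exact ⟨(y', x'), hS.mem_evalSet hx' hy', rfl⟩

section Bounds

variable {y x : E n}

lemma Standing.norm_Gsigma_le (hS : S.Standing χ Vbar ζ)
    (hx : x ∈ Metric.closedBall (0 : E n) ζ) (hy : S.IsEvalPoint y x) :
    ‖S.Gsigma y x‖ ≤ S.supEval ζ (fun y x => ‖S.Gsigma y x‖) :=
  hS.le_supEval (h := fun y x => ‖S.Gsigma y x‖) hS.Gsigma_continuousOn.norm hx hy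

lemma ideal_snd_continuousOn
    (hW : ∀ x ∈ Metric.closedBall (0 : E n) ζ, ContDiffAt ℝ 1 W x) :
    ContinuousOn (fun p : E n × E n => W p.2) (S.evalSet ζ) :=
  fun p hp => (ContinuousAt.comp (f := Prod.snd) (hW p.2 hp.1).continuousAt
    continuousAt_snd).continuousWithinAt

lemma ideal_continuousOn
    (hW : ∀ x ∈ Metric.closedBall (0 : E n) ζ, ContDiffAt ℝ 1 W x) :
    ContinuousOn W (Metric.closedBall 0 ζ) := fun x hx =>
  (hW x hx).continuousAt.continuousWithinAt

lemma ideal_fderiv_continuousOn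
    (hW : ∀ x ∈ Metric.closedBall (0 : E n) ζ, ContDiffAt ℝ 1 W x) :
    ContinuousOn (fderiv ℝ W) (Metric.closedBall 0 ζ) :=
  fun x hx => ((hW x hx).fderiv_right (m := 0) (by norm_num)).continuousAt.continuousWithinAt

lemma Standing.norm_adjoint_Gsigma_le
    (hW : ∀ x ∈ Metric.closedBall (0 : E n) ζ, ContDiffAt ℝ 1 W x)
    (hS : S.Standing χ Vbar ζ)
    (hx : x ∈ Metric.closedBall (0 : E n) ζ) (hy : S.IsEvalPoint y x) :
    ‖ContinuousLinearMap.adjoint (S.Gsigma y x) (W x)‖ ≤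
      S.supEval ζ (fun y x => ‖ContinuousLinearMap.adjoint (S.Gsigma y x) (W x)‖) :=
  hS.le_supEval (h := fun y x => ‖ContinuousLinearMap.adjoint (S.Gsigma y x) (W x)‖)
    ((ContinuousLinearMap.adjoint.continuous.comp_continuousOn
      hS.Gsigma_continuousOn).clm_apply (ideal_snd_continuousOn hW)).norm hx hy

lemma Standing.norm_Delta_le
    (hW : ∀ x ∈ Metric.closedBall (0 : E n) ζ, ContDiffAt ℝ 1 W x)
    (hS : S.Standing χ Vbar ζ)
    (hx : x ∈ Metric.closedBall (0 : E n) ζ) (hy : S.IsEvalPoint y x) :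
    ‖S.Delta W y x‖ ≤ S.supEval ζ (fun y x => ‖S.Delta W y x‖) := by
  refine hS.le_supEval (h := fun y x => ‖S.Delta W y x‖) (ContinuousOn.norm ?_) hx hy
  have h1 := hS.gradEps_continuousOn hW
  have h2 := hS.gradSigma_continuousOn
  have h3 : ContinuousOn (fun p : E n × E n => S.G p.1) (S.evalSet ζ) :=
    (hS.G_continuous.comp continuous_fst).continuousOn
  have h4 : ContinuousOn (fun p : E n × E n => S.f p.1) (S.evalSet ζ) :=
    (hS.f_contDiff.continuous.comp continuous_fst).continuousOn
  have h5 := h3.clm_apply h1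
  exact ((continuousOn_const.mul ((ideal_snd_continuousOn hW).inner (h2.clm_apply h5))).add
    (continuousOn_const.mul (h1.inner h5))).sub (h1.inner h4)

lemma Standing.continuousOn_diag (hS : S.Standing χ Vbar ζ) {V : Type*} [TopologicalSpace V]
    {F : E n × E n → V} (hF : ContinuousOn F (S.evalSet ζ)) :
    ContinuousOn (fun x => F (x, x)) (Metric.closedBall 0 ζ) :=
  hF.comp (by fun_prop) fun _ hx => hS.diag_mem_evalSet hx

lemma Standing.GWsigma_continuousOn
    (hW : ∀ x ∈ Metric.closedBall (0 : E n) ζ, ContDiffAt ℝ 1 W x)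
    (hS : S.Standing χ Vbar ζ) :
    ContinuousOn (S.GWsigma W) (Metric.closedBall 0 ζ) :=
  (ideal_fderiv_continuousOn hW).clm_comp (hS.G_continuous.continuousOn.clm_comp
    (ContinuousLinearMap.adjoint.continuous.comp_continuousOn
      (hS.continuousOn_diag hS.gradSigma_continuousOn)))

lemma Standing.norm_GWsigma_le
    (hW : ∀ x ∈ Metric.closedBall (0 : E n) ζ, ContDiffAt ℝ 1 W x)
    (hS : S.Standing χ Vbar ζ)
    (hx : x ∈ Metric.closedBall (0 : E n) ζ) :
    ‖S.GWsigma W x‖ ≤ supState ζ (fun x => ‖S.GWsigma W x‖) :=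
  le_supState (hS.GWsigma_continuousOn hW).norm hx

lemma Standing.norm_GWsigma_apply_le
    (hW : ∀ x ∈ Metric.closedBall (0 : E n) ζ, ContDiffAt ℝ 1 W x)
    (hS : S.Standing χ Vbar ζ)
    (hx : x ∈ Metric.closedBall (0 : E n) ζ) :
    ‖S.GWsigma W x (W x)‖ ≤ supState ζ (fun x => ‖S.GWsigma W x (W x)‖) :=
  le_supState (h := fun x => ‖S.GWsigma W x (W x)‖)
    ((hS.GWsigma_continuousOn hW).clm_apply (ideal_continuousOn hW)).norm hx

lemma norm_ideal_le
    (hW : ∀ x ∈ Metric.closedBall (0 : E n) ζ, ContDiffAt ℝ 1 W x)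
    (hx : x ∈ Metric.closedBall (0 : E n) ζ) :
    ‖W x‖ ≤ supState ζ (fun x => ‖W x‖) :=
  le_supState (ideal_continuousOn hW).norm hx

lemma Standing.norm_fderiv_ideal_drift_le
    (hW : ∀ x ∈ Metric.closedBall (0 : E n) ζ, ContDiffAt ℝ 1 W x)
    (hS : S.Standing χ Vbar ζ)
    (hx : x ∈ Metric.closedBall (0 : E n) ζ) :
    ‖fderiv ℝ W x (S.f x)‖ ≤ supState ζ (fun x => ‖fderiv ℝ W x (S.f x)‖) :=
  le_supState (h := fun x => ‖fderiv ℝ W x (S.f x)‖) ((ideal_fderiv_continuousOn hW).clm_apply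
    hS.f_contDiff.continuous.continuousOn).norm hx

lemma Standing.norm_GVsigma_le (hS : S.Standing χ Vbar ζ)
    (hx : x ∈ Metric.closedBall (0 : E n) ζ) :
    ‖S.GVsigma x‖ ≤ supState ζ (fun x => ‖S.GVsigma x‖) :=
  le_supState (h := fun x => ‖S.GVsigma x‖)
    ((hS.continuousOn_diag hS.gradSigma_continuousOn).clm_apply
      (hS.G_continuous.continuousOn.clm_apply hS.gradient_Vstar_continuous.continuousOn)).norm hx

lemma Standing.norm_GVeps_le
    (hW : ∀ x ∈ Metric.closedBall (0 : E n) ζ, ContDiffAt ℝ 1 W x)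
    (hS : S.Standing χ Vbar ζ)
    (hx : x ∈ Metric.closedBall (0 : E n) ζ) :
    ‖S.GVeps W x‖ ≤ supState ζ (fun x => ‖S.GVeps W x‖) :=
  le_supState (h := fun x => ‖S.GVeps W x‖)
    (hS.gradient_Vstar_continuous.continuousOn.inner (hS.G_continuous.continuousOn.clm_apply
      (hS.continuousOn_diag (hS.gradEps_continuousOn hW)))).norm hx

/-- This supremum also runs over an unbounded time interval; the uniform bound `1 / Γ̲` of `Γ⁻¹`
keeps it finite. -/
lemma Standing.norm_gainInv_GWsigma_le
    (hW : ∀ x ∈ Metric.closedBall (0 : E n) ζ, ContDiffAt ℝ 1 W x)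
    (hS : S.Standing χ Vbar ζ) {Γ₀ : E L →L[ℝ] E L} {t₀ t : ℝ}
    {z : Signals n L} (hΓ₀ : PosDefOp Γ₀) (hz : S.IsClosedLoop t₀ Γ₀ z) (ht : t₀ ≤ t)
    (hx : x ∈ Metric.closedBall (0 : E n) ζ) :
    ‖Ring.inverse (z.Γ t) (S.GWsigma W x (W x))‖ ≤ S.supGammaGW ζ t₀ W z.Γ := by
  refine le_csSup ⟨1 / S.gammaLower Γ₀ * supState ζ (fun x => ‖S.GWsigma W x (W x)‖), ?_⟩
    ⟨x, hx, t, ht, rfl⟩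
  rintro _ ⟨x', hx', t', ht', rfl⟩
  refine (hS.norm_gainInv_apply_le hΓ₀ hz ht' _).trans ?_
  have := hS.gammaLower_pos hΓ₀
  gcongr
  exact hS.norm_GWsigma_apply_le hW hx'

end Bounds

end StaF.System

/-! ### The Bellman error and the terms of the Lyapunov derivative -/

namespace StaF.System

variable {n m L N : ℕ} {S : System n m L N}
  {χ : Set (E n)} {H : Type*} [NormedAddCommGroup H] [InnerProductSpace ℝ H]
  [CompleteSpace H] [RKHS ℝ H χ ℝ] {Vbar : H} {ζ : ℝ} {W : E n → E L}

lemma Standing.inner_G_comm (hS : S.Standing χ Vbar ζ) (y p q : E n) :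
    ⟪p, S.G y q⟫ = ⟪q, S.G y p⟫ := by
  rw [inner_G, inner_G, ← inner_apply_comm_of_isSelfAdjoint hS.R_posDef.inverse.1,
    real_inner_comm]

lemma Standing.inner_G_nonneg (hS : S.Standing χ Vbar ζ) (y p : E n) : 0 ≤ ⟪p, S.G y p⟫ := by
  rw [inner_G]
  exact hS.R_posDef.inverse.inner_nonneg _

lemma inner_Gsigma (y x : E n) (v w : E L) : ⟪v, S.Gsigma y x w⟫ =
    ⟪ContinuousLinearMap.adjoint (S.gradSigma y x) v,
      S.G y (ContinuousLinearMap.adjoint (S.gradSigma y x) w)⟫ := by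
  simp [Gsigma, ContinuousLinearMap.adjoint_inner_left]

lemma Standing.inner_Gsigma_comm (hS : S.Standing χ Vbar ζ) (y x : E n) (v w : E L) :
    ⟪v, S.Gsigma y x w⟫ = ⟪w, S.Gsigma y x v⟫ := by
  rw [inner_Gsigma, inner_Gsigma, hS.inner_G_comm]

lemma Standing.cost_uHat (hS : S.Standing χ Vbar ζ) (y x : E n) (wa : E L) :
    S.cost y (S.uHat y x wa) = S.Q y + 1 / 4 * ⟪wa, S.Gsigma y x wa⟫ := by
  rw [inner_Gsigma, inner_G, uHat, cost, map_smul, apply_ringInverse_apply hS.R_posDef.isUnit,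
    inner_smul_left, inner_smul_right, real_inner_comm]
  simp only [conj_trivial]
  ring

lemma Standing.gradient_Vstar_eq (hS : S.Standing χ Vbar ζ) {y x : E n} (hy : y ∈ χ)
    (hx : x ∈ χ) : gradient S.Vstar y =
      ContinuousLinearMap.adjoint (S.gradSigma y x) (W x) + S.gradEps W y x := by
  rw [hS.gradEps_eq hy hx]
  abel

/-- The Bellman error in terms of the weight estimation errors. -/
lemma Standing.delta_eq (hS : S.Standing χ Vbar ζ) {y x : E n} (hy : y ∈ χ) (hx : x ∈ χ)
    (wc wa : E L) : S.delta y x wc wa = -⟪W x - wc, S.omega y x wa⟫ +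
      1 / 4 * ⟪W x - wa, S.Gsigma y x (W x - wa)⟫ + S.Delta W y x := by
  -- With `∇V*` written as `∇σᵀ W + ∇ε`, the equation eliminates `Q` and the drift terms.
  have hjb := hS.hamilton_jacobi_bellman y
  rw [hS.gradient_Vstar_eq (W := W) hy hx] at hjb
  have hG : ⟪W x, S.gradSigma y x (S.G y (ContinuousLinearMap.adjoint (S.gradSigma y x) (W x)))⟫ =
    ⟪W x, S.Gsigma y x (W x)⟫ := rfl
  simp only [map_add, inner_add_left, inner_add_right,
    hS.inner_G_comm y (S.gradEps W y x), ContinuousLinearMap.adjoint_inner_left, hG] at hjb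
  rw [delta, hS.cost_uHat, omega, Delta]
  simp only [map_sub, inner_sub_left, inner_sub_right, inner_smul_right,
    hS.inner_Gsigma_comm y x wa (W x)]
  linarith

/-- The contribution of one evaluation point of the Bellman error to the Lyapunov derivative. -/
lemma Standing.bellman_term_le (hS : S.Standing χ Vbar ζ) {y x : E n} (hy : y ∈ χ) (hx : x ∈ χ)
    (wc wa : E L) {D₁ D₂ D₃ D₄ : ℝ} (h₁ : ‖S.Delta W y x‖ ≤ D₁) (h₂ : ‖S.Gsigma y x‖ ≤ D₂)
    (h₃ : ‖ContinuousLinearMap.adjoint (S.Gsigma y x) (W x)‖ ≤ D₃) (h₄ : ‖W x‖ ≤ D₄) :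
    S.delta y x wc wa / S.rho y x wa * ⟪W x - wc, S.omega y x wa⟫ +
      ⟪W x - wc, S.regressorMatrix y x wa (W x - wc)⟫ -
      ⟪S.omega y x wa, wc⟫ / (4 * S.rho y x wa) *
        ⟪W x - wa, ContinuousLinearMap.adjoint (S.Gsigma y x) wa⟫ ≤
    1 / √S.ν * (‖W x - wc‖ * D₁ + 1 / 4 * (‖W x - wa‖ * (D₂ * D₄ ^ 2) +
      ‖W x - wa‖ * ‖W x - wc‖ * D₃ + ‖W x - wa‖ ^ 2 * (D₂ * D₄))) := by
  have hr := S.one_le_rho hS.ν_pos y x wa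
  have hor := S.norm_omega_div_rho_le hS.ν_pos y x wa
  have hν := Real.sqrt_pos.2 hS.ν_pos
  rw [hS.delta_eq (W := W) hy hx, regressorMatrix_inner, real_inner_comm (W x - wc)]
  set ω := S.omega y x wa with hω
  set ρ := S.rho y x wa with hρ
  set c := W x - wc with hc
  set a := W x - wa with ha
  set w := W x with hw
  set K := S.Gsigma y x with hK
  have hρ0 : 0 < ρ := by linarith
  have ewc : wc = w - c := by rw [hc]; abel
  have ewa : wa = w - a := by rw [ha]; abel
  have e1 : ⟪ω, wc⟫ = ⟪ω, w⟫ - ⟪ω, c⟫ := by rw [ewc, inner_sub_right]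
  have e2 : ⟪a, ContinuousLinearMap.adjoint K wa⟫ =
      ⟪a, ContinuousLinearMap.adjoint K w⟫ - ⟪a, K a⟫ := by
    rw [ewa, map_sub, inner_sub_right, ContinuousLinearMap.adjoint_inner_right K a a,
      real_inner_comm (K a)]
  have bnd : ∀ v : E L, |⟪ω, v⟫ / ρ| ≤ 1 / √S.ν * ‖v‖ := fun v => by
    rw [abs_div, abs_of_pos hρ0, div_le_iff₀ hρ0]
    rw [div_le_iff₀ hρ0] at hor
    calc |⟪ω, v⟫| ≤ ‖ω‖ * ‖v‖ := abs_real_inner_le_norm _ _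
      _ ≤ 1 / √S.ν * ρ * ‖v‖ := by gcongr
      _ = _ := by ring
  have hD₂ : 0 ≤ D₂ := (norm_nonneg _).trans h₂
  have hD₄ : 0 ≤ D₄ := (norm_nonneg _).trans h₄
  have b1 : |⟪ω, c⟫ / ρ| ≤ 1 / √S.ν * ‖c‖ := bnd c
  have b2 : |⟪ω, w⟫ / ρ| ≤ 1 / √S.ν * D₄ := (bnd w).trans (by gcongr)
  have b3 : |⟪a, K a⟫| ≤ D₂ * ‖a‖ ^ 2 := (abs_real_inner_le_norm _ _).trans (by
    calc ‖a‖ * ‖K a‖ ≤ ‖a‖ * (D₂ * ‖a‖) := by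
          gcongr; exact (K.le_opNorm a).trans (by gcongr)
      _ = _ := by ring)
  -- The same quantity is bounded twice: by `D₃` where it multiplies the critic error, for the gain
  -- condition, and by `D₂ D₄` where it multiplies the ideal weights, for `ι`.
  have b4 : |⟪a, ContinuousLinearMap.adjoint K w⟫| ≤ ‖a‖ * D₃ :=
    (abs_real_inner_le_norm _ _).trans (by gcongr)
  have b5 : |⟪a, ContinuousLinearMap.adjoint K w⟫| ≤ ‖a‖ * (D₂ * D₄) :=
    (abs_real_inner_le_norm _ _).trans (by
      gcongr
      refine (ContinuousLinearMap.le_opNorm _ _).trans ?_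
      rw [LinearIsometryEquiv.norm_map]
      gcongr)
  have m1 : ⟪ω, c⟫ / ρ * S.Delta W y x ≤ 1 / √S.ν * ‖c‖ * D₁ :=
    (le_abs_self _).trans (by rw [abs_mul]; gcongr; exact h₁)
  have m2 : -(⟪ω, w⟫ / ρ * ⟪a, ContinuousLinearMap.adjoint K w⟫) ≤
      1 / √S.ν * D₄ * (‖a‖ * (D₂ * D₄)) :=
    (neg_le_abs _).trans (by rw [abs_mul]; gcongr)
  have m3 : ⟪ω, w⟫ / ρ * ⟪a, K a⟫ ≤ 1 / √S.ν * D₄ * (D₂ * ‖a‖ ^ 2) :=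
    (le_abs_self _).trans (by rw [abs_mul]; gcongr)
  have m4 : ⟪ω, c⟫ / ρ * ⟪a, ContinuousLinearMap.adjoint K w⟫ ≤
      1 / √S.ν * ‖c‖ * (‖a‖ * D₃) :=
    (le_abs_self _).trans (by rw [abs_mul]; gcongr)
  -- Since `ρ ≥ 1`, the damping of the critic law, normalized by `ρ`, dominates the regressor
  -- matrix, normalized by `ρ²`.
  have m5 : ⟪ω, c⟫ * ⟪ω, c⟫ / ρ ^ 2 ≤ ⟪ω, c⟫ * ⟪ω, c⟫ / ρ :=
    div_le_div_of_nonneg_left (mul_self_nonneg _) hρ0 (by nlinarith)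
  rw [e1, e2]
  -- The cubic term `⟪ω, c⟫ ⟪a, K a⟫ / (4ρ)` occurs with both signs, once from the Bellman error and
  -- once from the actor law, and disappears.
  have e3 : (-⟪ω, c⟫ + 1 / 4 * ⟪a, K a⟫ + S.Delta W y x) / ρ * ⟪ω, c⟫ +
      ⟪ω, c⟫ * ⟪ω, c⟫ / ρ ^ 2 - (⟪ω, w⟫ - ⟪ω, c⟫) / (4 * ρ) *
        (⟪a, ContinuousLinearMap.adjoint K w⟫ - ⟪a, K a⟫) =
      (⟪ω, c⟫ * ⟪ω, c⟫ / ρ ^ 2 - ⟪ω, c⟫ * ⟪ω, c⟫ / ρ) + ⟪ω, c⟫ / ρ * S.Delta W y x +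
      1 / 4 * (-(⟪ω, w⟫ / ρ * ⟪a, ContinuousLinearMap.adjoint K w⟫) +
        ⟪ω, w⟫ / ρ * ⟪a, K a⟫ + ⟪ω, c⟫ / ρ * ⟪a, ContinuousLinearMap.adjoint K w⟫) := by
    field_simp
    ring
  have e4 : ⟪c, ω⟫ = ⟪ω, c⟫ := real_inner_comm _ _
  simp only [e4]
  rw [e3]
  have e5 : 1 / √S.ν * (‖c‖ * D₁ + 1 / 4 * (‖a‖ * (D₂ * D₄ ^ 2) + ‖a‖ * ‖c‖ * D₃ +
      ‖a‖ ^ 2 * (D₂ * D₄))) = 1 / √S.ν * ‖c‖ * D₁ + 1 / 4 * (1 / √S.ν * D₄ * (‖a‖ * (D₂ * D₄)) +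
      1 / √S.ν * D₄ * (D₂ * ‖a‖ ^ 2) + 1 / √S.ν * ‖c‖ * (‖a‖ * D₃)) := by ring
  rw [e5]
  linarith

/-- The derivative of the optimal value function along the closed loop. -/
lemma Standing.value_term_le (hS : S.Standing χ Vbar ζ) {x : E n} (hx : x ∈ χ) (wa : E L) :
    ⟪gradient S.Vstar x, S.f x + S.g x (S.uHat x x wa)⟫ ≤
      -S.Q x + 1 / 2 * ‖S.GVeps W x‖ + 1 / 2 * ‖S.GVsigma x‖ * ‖W x - wa‖ := by
  set a := W x - wa with ha
  set p := gradient S.Vstar x with hp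
  have ewa : wa = W x - a := by rw [ha]; abel
  have hjb := hS.hamilton_jacobi_bellman x
  rw [← hp] at hjb
  have h1 : ⟪p, S.g x (S.uHat x x wa)⟫ =
      -(1 / 2) * ⟪p, S.G x (ContinuousLinearMap.adjoint (S.gradSigma x x) wa)⟫ := by
    rw [uHat, map_smul, inner_smul_right]
    rfl
  have h2 : ContinuousLinearMap.adjoint (S.gradSigma x x) wa =
      p - S.gradEps W x x - ContinuousLinearMap.adjoint (S.gradSigma x x) a := by
    rw [hp, hS.gradient_Vstar_eq (W := W) hx hx, ewa, map_sub]
    abel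
  have h3 : ⟪p, S.G x (ContinuousLinearMap.adjoint (S.gradSigma x x) a)⟫ =
      ⟪S.GVsigma x, a⟫ := by
    rw [hS.inner_G_comm, ContinuousLinearMap.adjoint_inner_left, GVsigma, real_inner_comm]
  have h4 : ⟪p, S.G x (S.gradEps W x x)⟫ = S.GVeps W x := rfl
  rw [inner_add_right, h1, h2, map_sub, map_sub, inner_sub_right, inner_sub_right, h3, h4]
  -- The value equation contributes `+¼ ⟪p, G p⟫` and the policy `-½ ⟪p, G p⟫`; the remaining `-¼
  -- ⟪p, G p⟫` is discarded.
  have h5 := hS.inner_G_nonneg x p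
  have h6 : S.GVeps W x ≤ ‖S.GVeps W x‖ := Real.le_norm_self _
  have h7 : ⟪S.GVsigma x, a⟫ ≤ ‖S.GVsigma x‖ * ‖a‖ := real_inner_le_norm _ _
  linarith

/-- The derivative of the ideal weights along the closed loop. -/
lemma fderiv_ideal_velocity (x : E n) (wa : E L) :
    fderiv ℝ W x (S.f x + S.g x (S.uHat x x wa)) = fderiv ℝ W x (S.f x) -
      (1 / 2 : ℝ) • S.GWsigma W x (W x) + (1 / 2 : ℝ) • S.GWsigma W x (W x - wa) := by
  have h : S.g x (S.uHat x x wa) =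
      -(1 / 2 : ℝ) • S.G x (ContinuousLinearMap.adjoint (S.gradSigma x x) wa) := by
    rw [uHat, map_smul]
    rfl
  rw [h, map_add, map_smul, map_sub]
  have h2 : fderiv ℝ W x (S.G x (ContinuousLinearMap.adjoint (S.gradSigma x x) wa)) =
      S.GWsigma W x wa := rfl
  rw [h2]
  module

end StaF.System

/-! ### The derivative of the Lyapunov function -/

namespace StaF.System

variable {n m L N : ℕ} {S : System n m L N}
  {χ : Set (E n)} {H : Type*} [NormedAddCommGroup H] [InnerProductSpace ℝ H]
  [CompleteSpace H] [RKHS ℝ H χ ℝ] {Vbar : H} {ζ : ℝ} {W : E n → E L}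
  {Γ₀ : E L →L[ℝ] E L} {t₀ T c₁ c₂ c₃ : ℝ} {z : Signals n L}

/-- The Lyapunov function along the closed loop. -/
noncomputable def lyapAt (S : System n m L N) (W : E n → E L) (z : Signals n L) (t : ℝ) : ℝ :=
  S.lyap z.Γ (z.x t) (W (z.x t) - z.Wc t) (W (z.x t) - z.Wa t) t

/-- The derivative of the Lyapunov function along the closed loop. -/
noncomputable def lyapDeriv (S : System n m L N) (W : E n → E L) (z : Signals n L) (t : ℝ) : ℝ :=
  ⟪gradient S.Vstar (z.x t), S.xRhs z t⟫ +
    ⟪W (z.x t) - z.Wc t, Ring.inverse (z.Γ t) (fderiv ℝ W (z.x t) (S.xRhs z t) - S.criticRhs z t)⟫ +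
    1 / 2 * ⟪W (z.x t) - z.Wc t,
      (S.infoMatrix z t - S.β • Ring.inverse (z.Γ t)) (W (z.x t) - z.Wc t)⟫ +
    ⟪W (z.x t) - z.Wa t, fderiv ℝ W (z.x t) (S.xRhs z t) - S.actorRhs z t⟫

lemma Standing.lyapAt_hasDerivWithinAt (hS : S.Standing χ Vbar ζ) (hΓ₀ : PosDefOp Γ₀)
    (hz : S.IsClosedLoop t₀ Γ₀ z) {t : ℝ} (ht : t₀ ≤ t)
    (hW : DifferentiableAt ℝ W (z.x t)) :
    HasDerivWithinAt (S.lyapAt W z) (S.lyapDeriv W z t) (Ici t) t := by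
  have hx := hz.x_deriv t ht
  have hV := (hS.Vstar_hasFDerivAt (z.x t)).comp_hasDerivWithinAt t hx
  have hWx := hW.hasFDerivAt.comp_hasDerivWithinAt t hx
  have hc := hWx.sub (hz.Wc_deriv t ht)
  have ha := hWx.sub (hz.Wa_deriv t ht)
  have hX := hS.gainInv_hasDerivWithinAt hΓ₀ hz ht
  have hXs := hS.gainInv_isSelfAdjoint hΓ₀ hz ht
  have h := (hV.add ((hc.inner ℝ (hX.clm_apply hc)).const_mul (1 / 2))).add
    ((ha.inner ℝ ha).const_mul (1 / 2))
  refine h.congr_deriv ?_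
  rw [lyapDeriv, inner_gradient, inner_add_right]
  simp only [Function.comp_apply, Pi.sub_apply]
  -- Symmetry of `Γ⁻¹` makes the two cross terms equal, which cancels the factor one half.
  rw [← inner_apply_comm_of_isSelfAdjoint hXs (W (z.x t) - z.Wc t)
      (fderiv ℝ W (z.x t) (S.xRhs z t) - S.criticRhs z t),
    real_inner_comm (fderiv ℝ W (z.x t) (S.xRhs z t) - S.actorRhs z t) (W (z.x t) - z.Wa t),
    real_inner_comm (Ring.inverse (z.Γ t) (W (z.x t) - z.Wc t))]
  ring

/-- The contribution of an evaluation point to the derivative of the Lyapunov function. -/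
noncomputable def bellmanTerm (S : System n m L N) (W : E n → E L) (y x : E n) (wc wa : E L) : ℝ :=
  S.delta y x wc wa / S.rho y x wa * ⟪W x - wc, S.omega y x wa⟫ +
    ⟪W x - wc, S.regressorMatrix y x wa (W x - wc)⟫ -
    ⟪S.omega y x wa, wc⟫ / (4 * S.rho y x wa) *
      ⟪W x - wa, ContinuousLinearMap.adjoint (S.Gsigma y x) wa⟫

/-- The factor `Γ` of the critic law cancels against `Γ⁻¹`. The term `½ M` from `(Γ⁻¹)'` is written
as `M - ½ M`: the full `M` is distributed over the evaluation points, where the critic damping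
dominates it, and `-½ M` is kept as decay. -/
lemma Standing.lyapDeriv_eq (hS : S.Standing χ Vbar ζ) (hΓ₀ : PosDefOp Γ₀)
    (hz : S.IsClosedLoop t₀ Γ₀ z) {t : ℝ} (ht : t₀ ≤ t) :
    S.lyapDeriv W z t = ⟪gradient S.Vstar (z.x t), S.xRhs z t⟫ +
      ⟪W (z.x t) - z.Wc t, Ring.inverse (z.Γ t) (fderiv ℝ W (z.x t) (S.xRhs z t))⟫ +
      ⟪W (z.x t) - z.Wa t, fderiv ℝ W (z.x t) (S.xRhs z t)⟫ +
      (S.ηa1 * ⟪W (z.x t) - z.Wa t, z.Wa t - z.Wc t⟫ + S.ηa2 * ⟪W (z.x t) - z.Wa t, z.Wa t⟫) +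
      (S.ηc1 * S.bellmanTerm W (z.x t) (z.x t) (z.Wc t) (z.Wa t) +
        S.ηc2 / N * ∑ i, S.bellmanTerm W (S.pt z i t) (z.x t) (z.Wc t) (z.Wa t)) -
      1 / 2 * ⟪W (z.x t) - z.Wc t, S.infoMatrix z t (W (z.x t) - z.Wc t)⟫ -
      S.β / 2 * ⟪W (z.x t) - z.Wc t, Ring.inverse (z.Γ t) (W (z.x t) - z.Wc t)⟫ := by
  have hu := hS.gain_isUnit hΓ₀ hz ht
  have hM := S.infoMatrix_inner z t (W (z.x t) - z.Wc t) (W (z.x t) - z.Wc t)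
  set c := W (z.x t) - z.Wc t with hc
  set a := W (z.x t) - z.Wa t with ha
  have h1 : ⟪c, Ring.inverse (z.Γ t) (S.criticRhs z t)⟫ =
      -(S.ηc1 * (S.delta (z.x t) (z.x t) (z.Wc t) (z.Wa t) / S.rho (z.x t) (z.x t) (z.Wa t) *
        ⟪c, S.omega (z.x t) (z.x t) (z.Wa t)⟫)) -
      S.ηc2 / N * ∑ i, S.delta (S.pt z i t) (z.x t) (z.Wc t) (z.Wa t) /
        S.rho (S.pt z i t) (z.x t) (z.Wa t) * ⟪c, S.omega (S.pt z i t) (z.x t) (z.Wa t)⟫ := by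
    rw [criticRhs, map_sub, map_smul, map_smul, ringInverse_apply_apply hu,
      ringInverse_apply_apply hu, inner_sub_right, inner_smul_right, inner_smul_right, inner_sum]
    simp only [inner_smul_right]
    ring
  have h2 : ⟪a, S.actorRhs z t⟫ = -(S.ηa1 * ⟪a, z.Wa t - z.Wc t⟫) - S.ηa2 * ⟪a, z.Wa t⟫ +
      S.ηc1 * (⟪S.omega (z.x t) (z.x t) (z.Wa t), z.Wc t⟫ /
        (4 * S.rho (z.x t) (z.x t) (z.Wa t)) *
          ⟪a, ContinuousLinearMap.adjoint (S.Gsigma (z.x t) (z.x t)) (z.Wa t)⟫) +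
      S.ηc2 / N * ∑ i, ⟪S.omega (S.pt z i t) (z.x t) (z.Wa t), z.Wc t⟫ /
        (4 * S.rho (S.pt z i t) (z.x t) (z.Wa t)) *
          ⟪a, ContinuousLinearMap.adjoint (S.Gsigma (S.pt z i t) (z.x t)) (z.Wa t)⟫ := by
    have hsum : ⟪a, ∑ i, (S.ηc2 * ⟪S.omega (S.pt z i t) (z.x t) (z.Wa t), z.Wc t⟫ /
        (4 * N * S.rho (S.pt z i t) (z.x t) (z.Wa t))) •
        ContinuousLinearMap.adjoint (S.Gsigma (S.pt z i t) (z.x t)) (z.Wa t)⟫ =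
      S.ηc2 / N * ∑ i, ⟪S.omega (S.pt z i t) (z.x t) (z.Wa t), z.Wc t⟫ /
        (4 * S.rho (S.pt z i t) (z.x t) (z.Wa t)) *
          ⟪a, ContinuousLinearMap.adjoint (S.Gsigma (S.pt z i t) (z.x t)) (z.Wa t)⟫ := by
      rw [inner_sum, Finset.mul_sum]
      refine Finset.sum_congr rfl fun i _ => ?_
      rw [inner_smul_right, ← mul_assoc, div_mul_div_comm]
      congr 2
      ring
    rw [actorRhs, inner_add_right, inner_add_right, inner_sub_right, hsum]
    simp only [inner_smul_right]
    ring
  rw [lyapDeriv, map_sub, inner_sub_right, inner_sub_right, ← hc, ← ha, h1, h2, sub_apply,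
    inner_sub_right, smul_apply, inner_smul_right]
  simp only [bellmanTerm, ← hc, ← ha, Finset.sum_add_distrib, Finset.sum_sub_distrib]
  rw [hM]
  ring

/-- Young's inequalities behind the gain conditions. -/
lemma young_bound {q p K₁ K₂ K₃ K₄ v C A Q D : ℝ} (hq : 0 < q) (hp : 0 < p)
    (h₃ : K₃ ^ 2 / p ≤ q / 3) (h₄ : K₄ ≤ p / 4)
    (hD : D ≤ -Q - q * C ^ 2 - p * A ^ 2 + C * K₁ + A * K₂ + C * A * K₃ + A ^ 2 * K₄ + v) :
    D ≤ -Q - q / 3 * C ^ 2 - p / 4 * A ^ 2 + (3 * K₁ ^ 2 / (4 * q) + 1 / p * K₂ ^ 2 + v) := by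
  -- The decay `q C²` is spent in thirds, on `K₁`, on `K₃` and on the result; the decay `p A²` in
  -- quarters, on `K₂`, `K₃`, `K₄` and on the result.
  have e1 : C * K₁ ≤ q / 3 * C ^ 2 + 3 * K₁ ^ 2 / (4 * q) := by
    have : q / 3 * C ^ 2 + 3 * K₁ ^ 2 / (4 * q) - C * K₁ = (2 * q * C - 3 * K₁) ^ 2 / (12 * q) := by
      field_simp; ring
    have h : 0 ≤ (2 * q * C - 3 * K₁) ^ 2 / (12 * q) := by positivity
    linarith
  have e2 : A * K₂ ≤ p / 4 * A ^ 2 + 1 / p * K₂ ^ 2 := by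
    have : p / 4 * A ^ 2 + 1 / p * K₂ ^ 2 - A * K₂ = (p * A - 2 * K₂) ^ 2 / (4 * p) := by
      field_simp; ring
    have h : 0 ≤ (p * A - 2 * K₂) ^ 2 / (4 * p) := by positivity
    linarith
  have e3 : C * A * K₃ ≤ q / 3 * C ^ 2 + p / 4 * A ^ 2 := by
    have : K₃ ^ 2 / p * C ^ 2 + p / 4 * A ^ 2 - C * A * K₃ = (p * A - 2 * (K₃ * C)) ^ 2 / (4 * p) := by
      field_simp; ring
    have h : 0 ≤ (p * A - 2 * (K₃ * C)) ^ 2 / (4 * p) := by positivity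
    have h' : K₃ ^ 2 / p * C ^ 2 ≤ q / 3 * C ^ 2 := by gcongr
    linarith
  have e4 : A ^ 2 * K₄ ≤ p / 4 * A ^ 2 := by nlinarith [sq_nonneg A]
  linarith

lemma Standing.infoMatrix_inner_ge (hS : S.Standing χ Vbar ζ)
    (hex : S.IsExciting T c₁ c₂ c₃ t₀ z) {t : ℝ} (ht : t₀ ≤ t) (v : E L) :
    S.ηc2 * c₂ * ‖v‖ ^ 2 ≤ ⟪v, S.infoMatrix z t v⟫ := by
  have h1 := hS.ηc1_pos
  have h2 := hS.ηc2_pos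
  have h := ((ContinuousLinearMap.le_def _ _).1 (hex.second t ht)).inner_nonneg_right v
  simp only [sub_apply, inner_sub_right, smul_apply, one_apply_eq_self, inner_smul_right,
    real_inner_self_eq_norm_sq, excitationSum, sum_apply, inner_sum] at h
  rw [infoMatrix_inner]
  have h3 := mul_nonneg h1.le (S.regressorMatrix_inner_nonneg (z.x t) (z.x t) (z.Wa t) v)
  have h4 : c₂ * ‖v‖ ^ 2 ≤
      1 / N * ∑ i, ⟪v, S.regressorMatrix (S.pt z i t) (z.x t) (z.Wa t) v⟫ := by
    simp only [regressorMatrix, smul_apply, inner_smul_right]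
    linarith
  have h5 := mul_le_mul_of_nonneg_left h4 h2.le
  calc _ = S.ηc2 * (c₂ * ‖v‖ ^ 2) := by ring
    _ ≤ S.ηc2 * (1 / N * ∑ i, ⟪v, S.regressorMatrix (S.pt z i t) (z.x t) (z.Wa t) v⟫) := h5
    _ = S.ηc2 / N * ∑ i, ⟪v, S.regressorMatrix (S.pt z i t) (z.x t) (z.Wa t) v⟫ := by ring
    _ ≤ _ := le_add_of_nonneg_left h3

lemma Standing.cLower_pos (hS : S.Standing χ Vbar ζ) (hΓ₀ : PosDefOp Γ₀) (hT : 0 < T)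
    (hc₁ : 0 ≤ c₁) (hc₂ : 0 ≤ c₂) (hc₃ : 0 ≤ c₃) (hc : 0 < c₁ ∨ 0 < c₂ ∨ 0 < c₃) :
    0 < S.cLower T c₁ c₂ c₃ Γ₀ := by
  have h1 := hS.ηc2_pos
  have h2 := hS.β_pos
  have h3 := hS.gammaUpper_pos hΓ₀ hT hc₁ hc₂ hc₃ hc
  rw [cLower]
  positivity

/-- The bound of the Lyapunov derivative inside the ball of radius `ζ`. -/
theorem Standing.lyapDeriv_le (hS : S.Standing χ Vbar ζ)
    (hW : ∀ x ∈ Metric.closedBall (0 : E n) ζ, ContDiffAt ℝ 1 W x)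
    (hΓ₀ : PosDefOp Γ₀) (hT : 0 < T) (hc₁ : 0 ≤ c₁) (hc₂ : 0 ≤ c₂) (hc₃ : 0 ≤ c₃)
    (hc : 0 < c₁ ∨ 0 < c₂ ∨ 0 < c₃) (hgain : S.GainConditions ζ T c₁ c₂ c₃ W Γ₀)
    (ht₀ : 0 ≤ t₀) (hz : S.IsClosedLoop t₀ Γ₀ z) (hex : S.IsExciting T c₁ c₂ c₃ t₀ z)
    {t : ℝ} (ht : t₀ ≤ t) (hx : z.x t ∈ Metric.closedBall (0 : E n) ζ) :
    S.lyapDeriv W z t ≤ -S.Q (z.x t)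
      - S.ηc2 * S.cLower T c₁ c₂ c₃ Γ₀ / 3 * ‖W (z.x t) - z.Wc t‖ ^ 2
      - (S.ηa1 + S.ηa2) / 4 * ‖W (z.x t) - z.Wa t‖ ^ 2
      + S.iota ζ T c₁ c₂ c₃ W Γ₀ t₀ z.Γ := by
  have hηc1 := hS.ηc1_pos
  have hηc2 := hS.ηc2_pos
  have hηa1 := hS.ηa1_pos
  have hηa2 := hS.ηa2_pos
  have hβ := hS.β_pos
  have hN := hS.natCast_pos
  have hν := Real.sqrt_pos.2 hS.ν_pos
  have hΓl := hS.gammaLower_pos hΓ₀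
  have hΓu := hS.gammaUpper_pos hΓ₀ hT hc₁ hc₂ hc₃ hc
  have hcl := hS.cLower_pos hΓ₀ hT hc₁ hc₂ hc₃ hc
  have hxχ := hS.mem_of_mem_closedBall hx
  have ept : ∀ i, S.IsEvalPoint (S.pt z i t) (z.x t) := fun i =>
    Or.inr ⟨i, t, ht₀.trans ht, rfl⟩
  have sW := norm_ideal_le hW hx
  have sGW := hS.norm_GWsigma_le hW hx
  have sGWW := hS.norm_GWsigma_apply_le hW hx
  have sF := hS.norm_fderiv_ideal_drift_le hW hx
  have sGV := hS.norm_GVsigma_le hx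
  have sVe := hS.norm_GVeps_le hW hx
  have sX := hS.norm_gainInv_GWsigma_le hW hΓ₀ hz ht hx
  have hbell : ∀ y, S.IsEvalPoint y (z.x t) → S.bellmanTerm W y (z.x t) (z.Wc t) (z.Wa t) ≤ _ :=
    fun y hy => hS.bellman_term_le (hS.evalSet_fst_mem (hS.mem_evalSet hx hy)) hxχ (z.Wc t) (z.Wa t)
      (hS.norm_Delta_le hW hx hy) (hS.norm_Gsigma_le hx hy) (hS.norm_adjoint_Gsigma_le hW hx hy) sW
  have hval := hS.value_term_le (W := W) hxχ (z.Wa t)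
  have hM := hS.infoMatrix_inner_ge hex ht (W (z.x t) - z.Wc t)
  have hXl := hS.le_gainInv_inner hΓ₀ hz hT hc₁ hc₂ hc₃ hc hex ht (W (z.x t) - z.Wc t)
  have hXn := hS.norm_gainInv_apply_le hΓ₀ hz ht
  have hg₃ := hgain.critic
  have hg₄ := hgain.actor
  have hvel := fderiv_ideal_velocity (S := S) (W := W) (z.x t) (z.Wa t)
  rw [hS.lyapDeriv_eq hΓ₀ hz ht, iota]
  change fderiv ℝ W (z.x t) (S.xRhs z t) = _ at hvel
  change ⟪gradient S.Vstar (z.x t), S.xRhs z t⟫ ≤ _ at hval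
  generalize S.xRhs z t = xdot at *
  have ewc : z.Wa t - z.Wc t = (W (z.x t) - z.Wc t) - (W (z.x t) - z.Wa t) := by abel
  have ewa : z.Wa t = W (z.x t) - (W (z.x t) - z.Wa t) := by abel
  set c := W (z.x t) - z.Wc t with hcdef
  set a := W (z.x t) - z.Wa t with hadef
  set D₁ := S.supEval ζ (fun y x => ‖S.Delta W y x‖)
  set D₂ := S.supEval ζ (fun y x => ‖S.Gsigma y x‖)
  set D₃ := S.supEval ζ (fun y x => ‖ContinuousLinearMap.adjoint (S.Gsigma y x) (W x)‖)
  set D₄ := supState ζ (fun x => ‖W x‖)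
  set DG := supState ζ (fun x => ‖S.GWsigma W x‖)
  set DGW := supState ζ (fun x => ‖S.GWsigma W x (W x)‖)
  set DF := supState ζ (fun x => ‖fderiv ℝ W x (S.f x)‖)
  set DV := supState ζ (fun x => ‖S.GVsigma x‖)
  set DVe := supState ζ (fun x => ‖S.GVeps W x‖)
  set DX := S.supGammaGW ζ t₀ W z.Γ
  set Γl := S.gammaLower Γ₀
  set Γu := S.gammaUpper T c₁ c₂ c₃ Γ₀ with hΓudef
  set X := Ring.inverse (z.Γ t) with hX
  set wdot := fderiv ℝ W (z.x t) xdot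
  set Bd := 1 / √S.ν * (‖c‖ * D₁ + 1 / 4 * (‖a‖ * (D₂ * D₄ ^ 2) + ‖a‖ * ‖c‖ * D₃ +
    ‖a‖ ^ 2 * (D₂ * D₄))) with hBd
  have e1 : S.ηc1 * S.bellmanTerm W (z.x t) (z.x t) (z.Wc t) (z.Wa t) +
      S.ηc2 / N * ∑ i, S.bellmanTerm W (S.pt z i t) (z.x t) (z.Wc t) (z.Wa t) ≤
      (S.ηc1 + S.ηc2) * Bd := by
    have h1 : ∑ i, S.bellmanTerm W (S.pt z i t) (z.x t) (z.Wc t) (z.Wa t) ≤ N * Bd := by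
      refine (Finset.sum_le_sum fun i _ => hbell _ (ept i)).trans (le_of_eq ?_)
      simp
    calc _ ≤ S.ηc1 * Bd + S.ηc2 / N * (N * Bd) := by
          gcongr
          exact hbell _ (Or.inl rfl)
      _ = _ := by field_simp
  have e2 : ⟪c, X wdot⟫ ≤ ‖c‖ * (DF / Γl + DX / 2 + 1 / 2 * (DG * ‖a‖ / Γl)) := by
    refine (real_inner_le_norm _ _).trans ?_
    gcongr
    rw [hvel, map_add, map_sub, map_smul, map_smul]
    refine (norm_add_le _ _).trans (add_le_add ((norm_sub_le _ _).trans (add_le_add ?_ ?_)) ?_)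
    · refine (hXn _).trans ?_
      rw [one_div, inv_mul_eq_div]
      gcongr
    · rw [norm_smul]
      norm_num
      linarith
    · rw [norm_smul]
      norm_num
      refine (hXn _).trans ?_
      rw [one_div, inv_mul_eq_div]
      gcongr
      exact (ContinuousLinearMap.le_opNorm _ _).trans (by gcongr)
  have e3 : ⟪a, wdot⟫ ≤ ‖a‖ * (DF + DGW / 2 + 1 / 2 * (DG * ‖a‖)) := by
    refine (real_inner_le_norm _ _).trans ?_
    gcongr
    rw [hvel]
    refine (norm_add_le _ _).trans (add_le_add ((norm_sub_le _ _).trans (add_le_add sF ?_)) ?_)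
    · rw [norm_smul]
      norm_num
      linarith
    · rw [norm_smul]
      norm_num
      exact (ContinuousLinearMap.le_opNorm _ _).trans (by gcongr)
  have e4 : ⟪a, z.Wa t - z.Wc t⟫ ≤ ‖a‖ * ‖c‖ - ‖a‖ ^ 2 := by
    rw [ewc, inner_sub_right, real_inner_self_eq_norm_sq]
    have := real_inner_le_norm a c
    linarith
  have e5 : ⟪a, z.Wa t⟫ ≤ ‖a‖ * D₄ - ‖a‖ ^ 2 := by
    rw [ewa, inner_sub_right, real_inner_self_eq_norm_sq]
    have := (real_inner_le_norm a (W (z.x t))).trans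
      (mul_le_mul_of_nonneg_left sW (norm_nonneg a))
    linarith
  -- The pointwise excitation bounds `½ M` and the upper bound `Γ̄` of the gain bounds `(β/2) Γ⁻¹`;
  -- `c̲` is defined as the sum of both contributions divided by `η_{c2}`.
  have e6 : S.ηc2 * S.cLower T c₁ c₂ c₃ Γ₀ * ‖c‖ ^ 2 ≤
      1 / 2 * ⟪c, S.infoMatrix z t c⟫ + S.β / 2 * ⟪c, X c⟫ := by
    have h1 : S.ηc2 * S.cLower T c₁ c₂ c₃ Γ₀ * ‖c‖ ^ 2 =
        1 / 2 * (S.ηc2 * c₂ * ‖c‖ ^ 2) + S.β / 2 * (1 / Γu * ‖c‖ ^ 2) := by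
      rw [cLower, ← hΓudef]
      field_simp
      ring
    rw [h1]
    gcongr
  have hfin := young_bound (q := S.ηc2 * S.cLower T c₁ c₂ c₃ Γ₀) (p := S.ηa1 + S.ηa2)
    (K₁ := (S.ηc1 + S.ηc2) * D₁ / √S.ν + DF / Γl + DX / 2)
    (K₂ := (DGW + DV) / 2 + S.ηa2 * D₄ + DF + (S.ηc1 + S.ηc2) * D₂ * D₄ ^ 2 / (4 * √S.ν))
    (K₃ := DG / (2 * Γl) + (S.ηc1 + S.ηc2) * D₃ / (4 * √S.ν) + S.ηa1)
    (K₄ := DG / 2 + (S.ηc1 + S.ηc2) * D₄ * D₂ / (4 * √S.ν)) (v := 1 / 2 * DVe)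
    (C := ‖c‖) (A := ‖a‖) (Q := S.Q (z.x t)) (by positivity) (by positivity) hg₃ hg₄ le_rfl
  rw [← mul_assoc 4 S.ηc2] at hfin
  refine le_trans (le_of_le_of_eq
      (b := (-S.Q (z.x t) + 1 / 2 * DVe + 1 / 2 * DV * ‖a‖) +
        ‖c‖ * (DF / Γl + DX / 2 + 1 / 2 * (DG * ‖a‖ / Γl)) +
        ‖a‖ * (DF + DGW / 2 + 1 / 2 * (DG * ‖a‖)) +
        (S.ηa1 * (‖a‖ * ‖c‖ - ‖a‖ ^ 2) + S.ηa2 * (‖a‖ * D₄ - ‖a‖ ^ 2)) +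
        (S.ηc1 + S.ηc2) * Bd - S.ηc2 * S.cLower T c₁ c₂ c₃ Γ₀ * ‖c‖ ^ 2) ?_ ?_) hfin
  · have h1 := mul_le_mul_of_nonneg_left e4 hηa1.le
    have h2 := mul_le_mul_of_nonneg_left e5 hηa2.le
    have h3 : 1 / 2 * ‖S.GVsigma (z.x t)‖ * ‖a‖ ≤ 1 / 2 * DV * ‖a‖ := by gcongr
    linarith
  · rw [hBd]
    field_simp
    ring

end StaF.System

/-! ### Comparison arguments and ultimate boundedness -/

namespace StaF

namespace ClassK

variable {v : ℝ → ℝ}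

theorem lt_iff_lt (hv : ClassK v) {a b : ℝ} (ha : 0 ≤ a) (hb : 0 ≤ b) : v a < v b ↔ a < b :=
  hv.2.1.lt_iff_lt ha hb

theorem le_iff_le (hv : ClassK v) {a b : ℝ} (ha : 0 ≤ a) (hb : 0 ≤ b) : v a ≤ v b ↔ a ≤ b :=
  hv.2.1.le_iff_le ha hb

theorem nonneg (hv : ClassK v) {a : ℝ} (ha : 0 ≤ a) : 0 ≤ v a := by
  simpa [hv.2.2] using (hv.le_iff_le le_rfl ha).2 ha

theorem mem_range (hv : ClassK v) {y b : ℝ} (hb : 0 ≤ b) (hy : 0 ≤ y) (hyb : y ≤ v b) :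
    y ∈ v '' Ici 0 := by
  obtain ⟨s, hs, rfl⟩ := intermediate_value_Icc hb (hv.1.mono Icc_subset_Ici_self)
    ⟨hv.2.2.le.trans hy, hyb⟩
  exact ⟨s, hs.1, rfl⟩

end ClassK

theorem kInv_nonneg {v : ℝ → ℝ} {y : ℝ} (hy : y ∈ v '' Ici 0) : 0 ≤ kInv v y :=
  Function.invFunOn_mem hy

theorem apply_kInv {v : ℝ → ℝ} {y : ℝ} (hy : y ∈ v '' Ici 0) : v (kInv v y) = y :=
  Function.invFunOn_eq hy

/-- If `V` has a strictly negative right derivative wherever it equals `c` and is left-continuous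
as long as it does not exceed `c`, then it never exceeds `c`. -/
theorem le_of_rightDeriv_neg_on_level {V V' : ℝ → ℝ} {t₀ c : ℝ} (h₀ : V t₀ ≤ c)
    (hleft : ∀ t, t₀ < t → (∀ s ∈ Ico t₀ t, V s ≤ c) → ContinuousWithinAt V (Icc t₀ t) t)
    (hderiv : ∀ t, t₀ ≤ t → V t ≤ c → HasDerivWithinAt V (V' t) (Ici t) t)
    (hneg : ∀ t, t₀ ≤ t → V t = c → V' t < 0) {t : ℝ} (ht : t₀ ≤ t) : V t ≤ c := by
  by_contra! hlt
  set B : Set ℝ := {s | t₀ ≤ s ∧ c < V s} with hB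
  have hBne : B.Nonempty := ⟨t, ht, hlt⟩
  have hBbdd : BddBelow B := ⟨t₀, fun s hs => hs.1⟩
  set u := sInf B
  have htu : t₀ ≤ u := le_csInf hBne fun s hs => hs.1
  have hbefore : ∀ s ∈ Ico t₀ u, V s ≤ c := fun s hs => by
    by_contra! h
    exact absurd (csInf_le hBbdd ⟨hs.1, h⟩) hs.2.not_ge
  have hVu : V u ≤ c := by
    rcases htu.eq_or_lt with h | h
    · rwa [← h]
    -- The bound holds strictly before the first exit time `u`; left continuity carries it to `u`
    -- itself.
    · have hc := (hleft u h hbefore).mono (Ico_subset_Icc_self : Ico t₀ u ⊆ _)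
      have : (𝓝[Ico t₀ u] u).NeBot := by
        rw [← mem_closure_iff_nhdsWithin_neBot, closure_Ico h.ne]
        exact right_mem_Icc.2 htu
      exact le_of_tendsto hc (eventually_mem_nhdsWithin.mono hbefore)
  have hafter : ∀ᶠ s in 𝓝[>] u, V s ≤ c := by
    have hd := hderiv u htu hVu
    rcases hVu.eq_or_lt with h | h
    -- On the level itself the negative right derivative makes the slopes just after `u` negative,
    -- so no exit can start there.
    · have hs := hd.mono (Ioi_subset_Ici_self) |>.limsup_slope_le' self_notMem_Ioi (hneg u htu h)
      filter_upwards [hs, self_mem_nhdsWithin] with s hs hus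
      have hus' : 0 < s - u := sub_pos.2 hus
      rw [slope_def_field, div_neg_iff] at hs
      rcases hs with hs | hs <;> linarith
    · exact ((hd.continuousWithinAt.mono Ioi_subset_Ici_self).eventually_lt_const h).mono
        fun s hs => hs.le
  obtain ⟨w, huw, hw⟩ := mem_nhdsGT_iff_exists_Ioo_subset.1 hafter
  obtain ⟨s, hs, hsw⟩ := exists_lt_of_csInf_lt hBne huw
  rcases (csInf_le hBbdd hs).eq_or_lt with h | h
  · exact absurd hs.2 (h ▸ hVu.not_gt)
  · exact absurd hs.2 (hw ⟨h, hsw⟩ : V s ≤ c).not_gt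

/-- A function that decreases at rate `κ` above the level `ℓ` is below `ℓ` after a time that
depends only on its initial bound. -/
theorem le_of_rightDeriv_le_neg_above {V V' : ℝ → ℝ} {t₀ c ℓ κ : ℝ} (h₀ : V t₀ ≤ c) (hℓ : ℓ ≤ c)
    (hκ : 0 < κ) (hcont : ContinuousOn V (Ici t₀))
    (hderiv : ∀ t, t₀ ≤ t → HasDerivWithinAt V (V' t) (Ici t) t)
    (hneg : ∀ t, t₀ ≤ t → ℓ ≤ V t → V' t ≤ -κ) {t : ℝ}
    (ht : t₀ + 2 * (c - ℓ) / κ ≤ t) : V t ≤ ℓ := by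
  set τ := 2 * (c - ℓ) / κ with hτ
  have hτ0 : 0 ≤ τ := div_nonneg (by linarith) hκ.le
  have hτκ : κ / 2 * τ = c - ℓ := by rw [hτ]; field_simp
  have h1 : V (t₀ + τ) ≤ ℓ := by
    -- The barrier falls at rate `κ / 2`, strictly slower than `V`, because the comparison principle
    -- needs a strict inequality; this is the factor two in `τ`. From then on the constant `ℓ` is a
    -- barrier.
    have := image_le_of_deriv_right_lt_deriv_boundary' (f := V) (f' := V') (a := t₀) (b := t₀ + τ)
      (B := fun s => c - κ / 2 * (s - t₀)) (B' := fun _ => -(κ / 2))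
      (hcont.mono Icc_subset_Ici_self) (fun s hs => hderiv s hs.1) (by simpa using h₀)
      (by fun_prop)
      (fun s _ => by
        have := ((((hasDerivAt_id s).sub_const t₀).const_mul (κ / 2)).const_sub c)
        simpa using this.hasDerivWithinAt)
      (fun s hs hVs => by
        have h2 : κ / 2 * (s - t₀) ≤ κ / 2 * τ :=
          mul_le_mul_of_nonneg_left (by linarith [hs.2]) (by linarith)
        have := hneg s hs.1 (by linarith)
        linarith)
      (right_mem_Icc.2 (by linarith))
    simp only [add_sub_cancel_left] at this
    linarith
  exact image_le_of_deriv_right_lt_deriv_boundary' (f := V) (f' := V') (a := t₀ + τ) (b := t)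
    (B := fun _ => ℓ) (B' := fun _ => 0)
    (hcont.mono fun s hs => (le_add_of_nonneg_right hτ0).trans hs.1)
    (fun s hs => hderiv s ((le_add_of_nonneg_right hτ0).trans hs.1)) h1 continuousOn_const
    (fun s _ => hasDerivWithinAt_const _ _ _)
    (fun s hs hVs => by
      have := hneg s ((le_add_of_nonneg_right hτ0).trans hs.1) hVs.ge
      linarith)
    (right_mem_Icc.2 ht)

/-- Time after which a Lyapunov function with the rate `-2 v_l(‖Z‖) + ι` and initial value at
most `vlo ζ` guarantees `‖Z‖ ≤ b`. -/
noncomputable def settlingTime (vlo vhi vl : ℝ → ℝ) (ζ ι b : ℝ) : ℝ :=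
  if ζ ≤ b then 0 else 2 * (vlo ζ - vlo b) / (2 * vl (kInv vhi (vlo b)) - ι)

/-- Uniform ultimate boundedness of a signal `y`, from a Lyapunov function `V` along it. -/
theorem uniformly_ultimately_bounded {vlo vhi vl : ℝ → ℝ} (hvlo : ClassK vlo) (hvhi : ClassK vhi)
    (hvl : ClassK vl) {ζ ι : ℝ} (hζ : 0 ≤ ζ) (hι : ι ∈ vl '' Ici 0) (hζζ : vlo ζ ≤ vhi ζ)
    (hgain : kInv vl ι < kInv vhi (vlo ζ)) {y V V' : ℝ → ℝ} {t₀ : ℝ} (hy : ∀ t, 0 ≤ y t)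
    (hlo : ∀ t, t₀ ≤ t → vlo (y t) ≤ V t) (hhi : ∀ t, t₀ ≤ t → V t ≤ vhi (y t))
    (hcont : ∀ t, t₀ < t → (∀ s ∈ Ico t₀ t, y s ≤ ζ) → ContinuousWithinAt V (Icc t₀ t) t)
    (hderiv : ∀ t, t₀ ≤ t → y t ≤ ζ → HasDerivWithinAt V (V' t) (Ici t) t)
    (hrate : ∀ t, t₀ ≤ t → y t ≤ ζ → V' t ≤ -(2 * vl (y t)) + ι)
    (h₀ : y t₀ ≤ kInv vhi (vlo ζ)) :
    vhi (kInv vl ι) ∈ vlo '' Ici 0 ∧ (∀ t, t₀ ≤ t → y t ≤ ζ) ∧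
      limsup y atTop ≤ kInv vlo (vhi (kInv vl ι)) ∧
      ∀ b, kInv vlo (vhi (kInv vl ι)) < b → 0 ≤ settlingTime vlo vhi vl ζ ι b ∧
        ∀ t, t₀ + settlingTime vlo vhi vl ζ ι b ≤ t → y t ≤ b := by
  have hs0 := kInv_nonneg hι
  have hvs := apply_kInv hι
  -- Nonnegativity turns `ι < v_l(s)` into `ι < 2 v_l(s)`, the sign condition needed for the rate.
  have hι0 : 0 ≤ ι := hvs ▸ hvl.nonneg hs0
  have hζr : vlo ζ ∈ vhi '' Ici 0 := hvhi.mem_range hζ (hvlo.nonneg hζ) hζζ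
  have hlt : vhi (kInv vl ι) < vlo ζ := by
    rw [← apply_kInv hζr]
    exact (hvhi.lt_iff_lt hs0 (kInv_nonneg hζr)).2 hgain
  have hr : vhi (kInv vl ι) ∈ vlo '' Ici 0 := hvlo.mem_range hζ (hvhi.nonneg hs0) hlt.le
  have hyV : ∀ t, t₀ ≤ t → ∀ b, 0 ≤ b → V t ≤ vlo b → y t ≤ b := fun t ht b hb h =>
    (hvlo.le_iff_le (hy t) hb).1 ((hlo t ht).trans h)
  have hVy : ∀ t, t₀ ≤ t → ∀ ℓ ∈ vhi '' Ici 0, ℓ ≤ V t → kInv vhi ℓ ≤ y t := fun t ht ℓ hℓ h => by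
    rw [← hvhi.le_iff_le (kInv_nonneg hℓ) (hy t), apply_kInv hℓ]
    exact h.trans (hhi t ht)
  have hrate' : ∀ s, kInv vl ι < s → ι < vl s := fun s hs => by
    have := (hvl.lt_iff_lt hs0 (hs0.trans hs.le)).2 hs
    rwa [hvs] at this
  have hV₀ : V t₀ ≤ vlo ζ := by
    refine (hhi t₀ le_rfl).trans ?_
    rw [← apply_kInv hζr]
    exact (hvhi.le_iff_le (hy t₀) (kInv_nonneg hζr)).2 h₀
  -- On the level `vlo ζ` the signal is at least `vhi⁻¹(vlo ζ)`, which exceeds `v_l⁻¹(ι)`, so `V`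
  -- strictly decreases there. Regularity of `V` is used only while the signal is known to be at
  -- most `ζ`.
  have hV : ∀ t, t₀ ≤ t → V t ≤ vlo ζ := fun t ht =>
    le_of_rightDeriv_neg_on_level (V' := V') hV₀
      (fun t ht h => hcont t ht fun s hs => hyV s hs.1 ζ hζ (h s hs))
      (fun t ht h => hderiv t ht (hyV t ht ζ hζ h))
      (fun t ht h => by
        have h1 := hrate t ht (hyV t ht ζ hζ h.le)
        have h2 := hrate' _ (hgain.trans_le (hVy t ht _ hζr h.ge))
        linarith) ht
  have hyζ : ∀ t, t₀ ≤ t → y t ≤ ζ := fun t ht => hyV t ht ζ hζ (hV t ht)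
  have hVcont : ContinuousOn V (Ici t₀) := fun t ht => by
    have h1 := (hderiv t ht (hyζ t ht)).continuousWithinAt
    rcases (mem_Ici.1 ht).eq_or_lt with h | h
    · rwa [← h] at h1 ⊢
    · have h2 := (hcont t h fun s hs => hyζ s hs.1).union h1
      rwa [Icc_union_Ici_eq_Ici ht] at h2
  have hb : ∀ b, kInv vlo (vhi (kInv vl ι)) < b → 0 ≤ settlingTime vlo vhi vl ζ ι b ∧
        ∀ t, t₀ + settlingTime vlo vhi vl ζ ι b ≤ t → y t ≤ b := by
    intro b hb
    rw [settlingTime]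
    split_ifs with hbζ
    · exact ⟨le_rfl, fun t ht => (hyζ t (by simpa using ht)).trans hbζ⟩
    · push Not at hbζ
      have hb0 : 0 ≤ b := (kInv_nonneg hr).trans hb.le
      have hℓ : vhi (kInv vl ι) < vlo b := by
        rw [← apply_kInv hr]
        exact (hvlo.lt_iff_lt (kInv_nonneg hr) hb0).2 hb
      have hℓζ : vlo b < vlo ζ := (hvlo.lt_iff_lt hb0 hζ).2 hbζ
      have hℓr : vlo b ∈ vhi '' Ici 0 :=
        hvhi.mem_range hζ (hvlo.nonneg hb0) (hℓζ.le.trans hζζ)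
      have hs : kInv vl ι < kInv vhi (vlo b) := by
        rwa [← hvhi.lt_iff_lt hs0 (kInv_nonneg hℓr), apply_kInv hℓr]
      -- Above the level `vlo b` the signal is at least `vhi⁻¹(vlo b)`; this difference is the
      -- guaranteed decay rate there.
      have hκ : 0 < 2 * vl (kInv vhi (vlo b)) - ι := by linarith [hrate' _ hs]
      have hτ : 0 ≤ 2 * (vlo ζ - vlo b) / (2 * vl (kInv vhi (vlo b)) - ι) :=
        div_nonneg (by linarith) hκ.le
      refine ⟨hτ, fun t ht => hyV t ((le_add_of_nonneg_right hτ).trans ht) b hb0 ?_⟩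
      refine le_of_rightDeriv_le_neg_above hV₀ hℓζ.le hκ hVcont
        (fun t ht => hderiv t ht (hyζ t ht)) (fun t ht h => ?_) ht
      have h1 := hrate t ht (hyζ t ht)
      have h2 := (hvl.le_iff_le (kInv_nonneg hℓr) (hy t)).2 (hVy t ht _ hℓr h)
      linarith
  refine ⟨hr, hyζ, le_of_forall_gt_imp_ge_of_dense fun b hb' => ?_, hb⟩
  refine limsup_le_of_le ?_ ((eventually_ge_atTop _).mono (hb b hb').2)
  -- The lower bound zero makes the real `limsup` a genuine one rather than a default value.
  exact (isBoundedUnder_of ⟨0, hy⟩ : IsBoundedUnder (· ≥ ·) atTop y).isCoboundedUnder_le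

theorem normZ_nonneg {n L : ℕ} (x : E n) (wc wa : E L) : 0 ≤ normZ x wc wa := Real.sqrt_nonneg _

theorem norm_le_normZ {n L : ℕ} (x : E n) (wc wa : E L) : ‖x‖ ≤ normZ x wc wa :=
  Real.le_sqrt_of_sq_le (by nlinarith [sq_nonneg ‖wc‖, sq_nonneg ‖wa‖])

/-- Needed to read off `vlo ζ ≤ vhi ζ` from the bounds of the Lyapunov function. The norm is placed
in a weight component, since the state dimension may be zero. -/
theorem exists_normZ_eq {n L : ℕ} (hL : 0 < L) {ζ : ℝ} (hζ : 0 ≤ ζ) :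
    ∃ (x : E n) (wc wa : E L), normZ x wc wa = ζ :=
  ⟨0, EuclideanSpace.single ⟨0, hL⟩ ζ, 0, by simp [normZ, Real.sqrt_sq_eq_abs, abs_of_nonneg hζ]⟩

namespace System

variable {n m L N : ℕ} {S : System n m L N} {χ : Set (E n)} {H : Type*} [NormedAddCommGroup H]
  [InnerProductSpace ℝ H] [CompleteSpace H] [RKHS ℝ H χ ℝ] {Vbar : H} {ζ : ℝ}

theorem Standing.lyapAt_continuousWithinAt (hS : S.Standing χ Vbar ζ) {W : E n → E L}
    {Γ₀ : E L →L[ℝ] E L} (hΓ₀ : PosDefOp Γ₀) {t₀ : ℝ} {z : Signals n L}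
    (hz : S.IsClosedLoop t₀ Γ₀ z) {t : ℝ} (ht : t₀ ≤ t) (hW : ContinuousAt W (z.x t)) :
    ContinuousWithinAt (S.lyapAt W z) (Ici t₀) t := by
  have hx := hz.x_cont t ht
  have hWx : ContinuousWithinAt (fun s => W (z.x s)) (Ici t₀) t :=
    hW.comp_continuousWithinAt hx
  have hc := hWx.sub (hz.Wc_cont t ht)
  have ha := hWx.sub (hz.Wa_cont t ht)
  have hΓ := hS.gainInv_continuousOn hΓ₀ hz t ht
  have hV : ContinuousWithinAt (fun s => S.Vstar (z.x s)) (Ici t₀) t :=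
    hS.Vstar_contDiff.continuous.continuousAt.comp_continuousWithinAt hx
  exact (hV.add ((hc.inner (𝕜 := ℝ) (hΓ.clm_apply hc)).const_mul (1 / 2))).add
    ((ha.inner (𝕜 := ℝ) ha).const_mul (1 / 2))

end System

end StaF

/-! ### Assembly of the theorem -/

theorem mainTheorem1 {n m L N : ℕ} (S : StaF.System n m L N) (χ : Set (StaF.E n))
    {H : Type*} [NormedAddCommGroup H] [InnerProductSpace ℝ H] [CompleteSpace H]
    [RKHS ℝ H χ ℝ] (Vbar : H) (ζ : ℝ) (hS : S.Standing χ Vbar ζ)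
    (W : StaF.E n → StaF.E L) (hW : W = S.idealWeights Vbar)
    (Γ₀ : StaF.E L →L[ℝ] StaF.E L) (hΓ₀ : StaF.PosDefOp Γ₀)
    (T c₁ c₂ c₃ : ℝ) (hT : 0 < T) (hc₁ : 0 ≤ c₁) (hc₂ : 0 ≤ c₂) (hc₃ : 0 ≤ c₃)
    (hc : 0 < c₁ ∨ 0 < c₂ ∨ 0 < c₃)
    (vlo vhi vl : ℝ → ℝ) (hvlo : StaF.ClassK vlo) (hvhi : StaF.ClassK vhi)
    (hvl : StaF.ClassK vl)
    (hvl_le : ∀ (x : StaF.E n) (wc wa : StaF.E L), StaF.normZ x wc wa ≤ ζ →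
      vl (StaF.normZ x wc wa) ≤ S.Q x / 2
        + S.ηc2 * S.cLower T c₁ c₂ c₃ Γ₀ / 6 * ‖wc‖ ^ 2
        + (S.ηa1 + S.ηa2) / 8 * ‖wa‖ ^ 2)
    (hgain : S.GainConditions ζ T c₁ c₂ c₃ W Γ₀)
    (ι : ℝ) (hι : ι ∈ vl '' Set.Ici 0)
    (hgain3 : StaF.kInv vl ι < StaF.kInv vhi (vlo ζ)) :
    ∃ τ : ℝ → ℝ, ∀ (t₀ : ℝ) (z : StaF.Signals n L), 0 ≤ t₀ →
      S.IsClosedLoop t₀ Γ₀ z →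
      S.IsExciting T c₁ c₂ c₃ t₀ z →
      S.iota ζ T c₁ c₂ c₃ W Γ₀ t₀ z.Γ = ι →
      (∀ t, t₀ ≤ t → ∀ (x : StaF.E n) (wc wa : StaF.E L),
        vlo (StaF.normZ x wc wa) ≤ S.lyap z.Γ x wc wa t ∧
        S.lyap z.Γ x wc wa t ≤ vhi (StaF.normZ x wc wa)) →
      z.normZAt W t₀ ≤ StaF.kInv vhi (vlo ζ) →
      vhi (StaF.kInv vl ι) ∈ vlo '' Set.Ici 0 ∧
      (∀ t, t₀ ≤ t → z.normZAt W t ≤ ζ) ∧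
      Filter.limsup (z.normZAt W) Filter.atTop ≤ StaF.kInv vlo (vhi (StaF.kInv vl ι)) ∧
      ∀ b, StaF.kInv vlo (vhi (StaF.kInv vl ι)) < b →
        0 ≤ τ b ∧ ∀ t, t₀ + τ b ≤ t → z.normZAt W t ≤ b := by
  -- The settling time is chosen before the initial time and the solution, which is the claimed
  -- uniformity.
  refine ⟨StaF.settlingTime vlo vhi vl ζ ι, fun t₀ z ht₀ hz hex hιz hlyap hZ₀ => ?_⟩
  have hWd : ∀ x ∈ Metric.closedBall (0 : StaF.E n) ζ, ContDiffAt ℝ 1 W x := fun x hx => by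
    rw [hW]
    exact hS.idealWeights_contDiffAt (hS.mem_interior hx)
  have hxball : ∀ t, z.normZAt W t ≤ ζ → z.x t ∈ Metric.closedBall (0 : StaF.E n) ζ := fun t h =>
    mem_closedBall_zero_iff.2 ((StaF.norm_le_normZ _ _ _).trans h)
  refine StaF.uniformly_ultimately_bounded (V := S.lyapAt W z) (V' := S.lyapDeriv W z)
    hvlo hvhi hvl hS.ζ_pos.le hι ?_ hgain3 (fun t => StaF.normZ_nonneg _ _ _)
    (fun t ht => (hlyap t ht _ _ _).1) (fun t ht => (hlyap t ht _ _ _).2) ?_ ?_ ?_ hZ₀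
  · obtain ⟨x, wc, wa, h⟩ := StaF.exists_normZ_eq (n := n) hS.L_pos hS.ζ_pos.le
    have := hlyap t₀ le_rfl x wc wa
    rw [h] at this
    exact this.1.trans this.2
  · intro t ht hbefore
    -- The weights are known to be regular only over the ball. Its closedness keeps the left limit
    -- of the states inside, so `V_L` is continuous at `t` before `‖Z(t)‖ ≤ ζ` is known.
    have hx : z.x t ∈ Metric.closedBall (0 : StaF.E n) ζ := by
      have : (𝓝[Ico t₀ t] t).NeBot := by
        rw [← mem_closure_iff_nhdsWithin_neBot, closure_Ico ht.ne]
        exact right_mem_Icc.2 ht.le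
      exact Metric.isClosed_closedBall.mem_of_tendsto
        ((hz.x_cont t ht.le).mono Ico_subset_Ici_self)
        (eventually_mem_nhdsWithin.mono fun s hs => hxball s (hbefore s hs))
    exact (hS.lyapAt_continuousWithinAt hΓ₀ hz ht.le (hWd _ hx).continuousAt).mono
      Icc_subset_Ici_self
  · exact fun t ht h => hS.lyapAt_hasDerivWithinAt hΓ₀ hz ht
      ((hWd _ (hxball t h)).differentiableAt one_ne_zero)
  · intro t ht h
    have h1 := hS.lyapDeriv_le hWd hΓ₀ hT hc₁ hc₂ hc₃ hc hgain ht₀ hz hex ht (hxball t h)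
    have h2 := hvl_le _ _ _ h
    rw [hιz] at h1
    rw [StaF.Signals.normZAt]
    linarith
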